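/- **Conventions.** $\{0,1\}^*$ is the set of finite binary words, $|x|$ is the length of $x$, $U^l$ is the uniform distribution on $\{0,1\}^l$, $\mathcal P(X)$ is the set of discrete probability distributions on $X$, and $d_{tv}(\mu,\nu)=\frac12\sum_x|\mu(x)-\nu(x)|$. $\langle x_0,\dots,x_{k-1}\rangle$ encodes a tuple of words by doubling every bit and inserting the separators $01$; $\mathrm{En}_{\mathbb N}$ is binary notation, $\mathrm{En}_{\mathbb N^n}(K)=\langle \mathrm{En}_{\mathbb N}(K_0),\dots,\mathrm{En}_{\mathbb N}(K_{n-1})\rangle$, and a rational is encoded by the pair $\langle\text{numerator},\text{denominator}\rangle$ of its irreducible fraction. An *encoded set* is a set $E$ with an injection $\mathrm{En}_E:E\to\{0,1\}^*$ whose image is decidable in polynomial time. Algorithms are deterministic multi-tape Turing machines with one read-only tape per input. Fix $n\ge 1$; $\mathbb N[K]$ denotes polynomials in $K_0,\dots,K_{n-1}$ with natural coefficients, and $K=(J,k)$ with $J\in\mathbb N^{n-1}$, $k=K_{n-1}$. "Poly-time in $K$" means: in at most $p(K)$ steps for some $p\in\mathbb N[K]$. *Fall space* $\mathcal F$ of rank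 $n$: a set of bounded functions $\mathbb N^n\to\mathbb R^{\ge0}$, closed under sums and under passing to smaller non-negative functions, that contains $2^{-h}$ for some $h\in\mathbb N[K]$. *Resource classes.* $\Gamma_0=\{0\}$. A function $\gamma:\mathbb N^n\to\mathbb N$ is *steadily growing* if it is bounded by a polynomial, non-decreasing in the last argument, and $\gamma(J,k)\le\frac12\gamma(J,t(J,k))$ for some $t\in\mathbb N[K]$ and all $J,k$. For such $\gamma$, $\Gamma_\gamma$ is the set of all $\gamma':\mathbb N^n\to\mathbb N$ with $\gamma'(J,k)\le\gamma(J,t(J,k))$ for some $t\in\mathbb N[K]$ and all $J,k$. For $\alpha:\mathbb N^m\to\mathbb N^n$, $\Gamma\alpha=\{\gamma':\mathbb N^m\to\mathbb N\mid\exists\gamma\in\Gamma:\gamma'\le\gamma\circ\alpha\}$. *Schemes.* For $\Gamma=(\Gamma_R,\Gamma_A)$, a *$\Gamma$-scheme* $S:X\to Y$ consists of algorithms $S:\mathbb N^n\times X\times\{0,1\}^*\times\{0,1\}^*\to Y$ and $R_S:\mathbb N^n\times\{0,1\}^*\to\mathbb N$ that run in time at most a polynomial in $K$, uniformly in the other inputs,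 and of advice $A_S:\mathbb N^n\to\{0,1\}^*$ such that $R_S(K,A_S(K))$ is in $\Gamma_R$ and $|A_S|\in\Gamma_A$. $S^K_x$ is the law of $S(K,x,y,A_S(K))$ for $y\sim U^{R_S(K,A_S(K))}$. An *$M\Gamma$-scheme* has random advice instead: distributions $M_S^K\in\mathcal P(\{0,1\}^*)$ supported on words of length $l(K)$ for some $l\in\Gamma_A$, with $R_S(K,z)\le\rho(K)$ on the support for some $\rho\in\Gamma_R$; $S^K_x$ is the law of $S(K,x,y,z)$ for $z\sim M_S^K$, $y\sim U^{R_S(K,z)}$. *Problems.* A *distributional estimation problem* $(\mathcal D,f)$ of rank $n$ is a family $\mathcal D^K\in\mathcal P(\{0,1\}^*)$, $K\in\mathbb N^n$, with a bounded $f:\mathrm{supp}\,\mathcal D\to\mathbb R$, $\mathrm{supp}\,\mathcal D=\bigcup_K\mathrm{supp}\,\mathcal D^K$; $\bar f$ is the extension of $f$ by $0$. $\mathcal D$ is *$\mathcal F(\Gamma)$-samplable* if there is a $\Gamma$-scheme $\sigma$ without input (formally, with the one-point set as input set) such that $d_{tv}(\mathcal D^K,\sigma^K)\in\mathcal F$ as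 a function of $K$. $\mathcal D$ is *$\mathcal F(M\Gamma)$-samplable relative to* Markov kernels $\pi^K$ to an encoded set $Y$ if for some $M\Gamma$-scheme $\sigma:Y\to\{0,1\}^*$ the function $\mathbb E_{y\sim\pi^K_*\mathcal D^K}[d_{tv}(\mathcal D^K\mid(\pi^K)^{-1}(y),\,\sigma^K_y)]$ of $K$ is in $\mathcal F$. $\mathcal D$ is *$\mathcal F(\Gamma)$-dominated* by $\mathcal E$ if for some bounded $\Gamma$-scheme $W:\{0,1\}^*\to\mathbb Q^{\ge0}$ the function $\sum_x|\mathcal E^K(x)\,\mathbb E[W^K(x)]-\mathcal D^K(x)|$ of $K$ is in $\mathcal F$. *Reductions.* $\alpha:\mathbb N^m\to\mathbb N^n$ is an *efficient injection* if its components are bounded by polynomials, it is poly-time computable in its argument, and it has a left inverse whose components are bounded by polynomials. A *precise pseudo-invertible $\mathcal F(\Gamma)$-reduction* of $(\mathcal D,f)$ of rank $m$ to $(\mathcal E,g)$ of rank $n$ over an efficient injection $\alpha$ ($\mathcal F$ of rank $m$) is a $\Gamma\alpha$-scheme $\pi:\{0,1\}^*\to\{0,1\}^*$ such that (i) $\pi_*\mathcal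 D$ is $\mathcal F(\Gamma\alpha)$-dominated by $(\mathcal E^{\alpha(L)})_{L\in\mathbb N^m}$; (ii) $\mathbb E_{x\sim\mathcal D^L,\;y\sim\pi^L_x}|f(x)-\bar g(y)|$, as a function of $L$, is in $\mathcal F$; (iii) $\mathcal D$ is $\mathcal F(M\Gamma\alpha)$-samplable relative to $\pi$. *Universal machine.* Let $\mathcal U$ be a prefix-free universal Turing machine with a program tape and two input tapes: for every machine $M$ with two inputs there are a word $a$ and a polynomial $q$ such that, whenever $M$ halts on $(x_0,x_1)$ within $t$ steps with output $y$, $\mathcal U$ with inputs $(x_0,x_1)$ and any infinite binary program tape that begins with $a$ halts within $q(t)$ steps with output $y$. $\mathrm{Ev}^k(a;x_0,x_1)$ is the content of the output tape of $\mathcal U$ after $k$ steps on the program $a000\cdots$ and the inputs $x_0,x_1$. **Theorem.** Let $\mathcal F$ be a fall space of rank $n$. Let $r,s:\mathbb N^n\to\mathbb N$ be steadily growing and poly-time computable in $K$ with $1\le r\le s$. Put $\Gamma_{red}=(\Gamma_r,\Gamma_0)$ and $\Gamma_{smp}=(\Gamma_s,\Gamma_0)$. Let $E$ be a prefix-free encoded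 set, i.e. $\mathrm{En}_E(\varphi)\ne\mathrm{En}_E(\psi)z$ for all $\varphi,\psi\in E$ and all non-empty words $z$, and let $\mathfrak F:E\times\mathbb N\times\{0,1\}^*\to\mathbb R$ be bounded. Let $\mathcal D_{\mathfrak F}^K$ be the law of $$\langle b,\ \mathrm{En}_{\mathbb N}(K_{n-1}),\ a,\ \mathrm{Ev}^{K_{n-1}}(a;\mathrm{En}_{\mathbb N^n}(K),w)\rangle,\qquad b,a\sim U^{r(K)},\ w\sim U^{s(K)}\text{ independent},$$ and let $f_{\mathfrak F}(\langle b,\mathrm{En}_{\mathbb N}(k),a,x\rangle)=\mathfrak F(\varphi,k,x)$ if $b=\mathrm{En}_E(\varphi)z$ for some $\varphi\in E$ and $z\in\{0,1\}^*$, and $0$ if there are no such $\varphi,z$. For $p\in\mathbb N[K]$ let $\alpha_p(J,k)=(J,p(J,k))$. Then: 1. Let $(\mathcal D,f)$ be a distributional estimation problem of rank $n$ such that $\mathcal D$ is $\mathcal F(\Gamma_{smp})$-samplable and there are $\varphi\in E$ and a one-variable polynomial $q$ with natural coefficients such that $f(x)=\mathfrak F(\varphi,k,x)$ for all $x\in\mathrm{supp}\,\mathcal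 D$ and all $k\ge q(|x|)$. Then there are $p\in\mathbb N[K]$, strictly increasing in the last argument, and a precise pseudo-invertible $\mathcal F(\Gamma_{red})$-reduction of $(\mathcal D,f)$ to $(\mathcal D_{\mathfrak F},f_{\mathfrak F})$ over $\alpha_p$. 2. For every $p\in\mathbb N[K]$ that is strictly increasing in the last argument, $\alpha_p$ is an efficient injection. 3. $\mathcal D_{\mathfrak F}$ is $\mathcal F(\Gamma_{smp})$-samplable. Hence, let $\mathrm{SampX}_{\mathfrak F}$ be the class of all problems $(\mathcal D,f)$ as in 1. If $f_{\mathfrak F}$ satisfies the condition on $f$ in 1 on $\mathrm{supp}\,\mathcal D_{\mathfrak F}$, then $(\mathcal D_{\mathfrak F},f_{\mathfrak F})$ belongs to $\mathrm{SampX}_{\mathfrak F}$ and every problem in $\mathrm{SampX}_{\mathfrak F}$ reduces to it as in 1. -/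

import Mathlib

namespace PolyEst

/-! ## Words and encodings -/

/-- Finite binary strings. -/
abbrev Word := List Bool

/-- Every bit is written twice. -/
def double : Word → Word
  | [] => []
  | b :: w => b :: b :: double w

/-- The encoding of a tuple of words: bits are doubled, components are separated by `01`. -/
def tuple : List Word → Word
  | [] => []
  | [w] => double w
  | w :: v :: l => double w ++ (false :: true :: tuple (v :: l))

theorem double_injective : ∀ w v : Word, double w = double v → w = v
  | [], [], _ => rfl
  | [], b :: v, h => by simp [double] at h
  | a :: w, [], h => by simp [double] at h
  | a :: w, b :: v, h => by
      simp only [double, List.cons.injEq] at h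
      rw [h.1, double_injective w v h.2.2]

theorem double_sep_injective : ∀ (w v u t : Word),
    double w ++ (false :: true :: u) = double v ++ (false :: true :: t) → w = v ∧ u = t
  | [], [], u, t, h => by simpa [double] using h
  | [], b :: v, u, t, h => by
      simp only [double, List.nil_append, List.cons_append, List.cons.injEq] at h
      obtain ⟨h1, h2, -⟩ := h
      rw [← h1] at h2
      exact absurd h2 (by decide)
  | a :: w, [], u, t, h => by
      simp only [double, List.nil_append, List.cons_append, List.cons.injEq] at h
      obtain ⟨h1, h2, -⟩ := h
      rw [h1] at h2
      exact absurd h2 (by decide)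
  | a :: w, b :: v, u, t, h => by
      simp only [double, List.cons_append, List.cons.injEq] at h
      obtain ⟨h3, h4⟩ := double_sep_injective w v u t h.2.2
      exact ⟨by rw [h.1, h3], h4⟩

theorem tuple_injective : ∀ l m : List Word, l.length = m.length → tuple l = tuple m → l = m
  | [], [], _, _ => rfl
  | [], _ :: _, hl, _ => by simp at hl
  | _ :: _, [], hl, _ => by simp at hl
  | [w], [v], _, h => by
      simp only [tuple] at h
      rw [double_injective w v h]
  | [_], _ :: _ :: _, hl, _ => by simp at hl
  | _ :: _ :: _, [_], hl, _ => by simp at hl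
  | w :: w' :: l, v :: v' :: m, hl, h => by
      simp only [tuple] at h
      obtain ⟨h1, h2⟩ := double_sep_injective _ _ _ _ h
      have h3 := tuple_injective (w' :: l) (v' :: m) (by simpa using hl) h2
      rw [h1, h3]

/-- A type with an injective encoding by words. -/
class Coded (X : Type*) where
  /-- the encoding -/
  enc : X → Word
  enc_injective : Function.Injective enc

instance : Coded Word := ⟨id, Function.injective_id⟩

/-- The set with one element, encoded by the empty word. -/
instance : Coded Unit := ⟨fun _ => [], fun _ _ _ => rfl⟩

theorem bits_injective : Function.Injective Nat.bits := fun a b h =>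
  Nat.digits_inj_iff (b := 2) |>.1 (by rw [Nat.digits_two_eq_bits, Nat.digits_two_eq_bits, h])

/-- Natural numbers in binary, least significant digit first. -/
instance : Coded ℕ := ⟨Nat.bits, bits_injective⟩

/-- A non-negative rational is encoded as the pair of numerator and denominator
of its irreducible fraction. -/
instance : Coded ℚ≥0 := ⟨fun q => tuple [Coded.enc q.num, Coded.enc q.den], fun p q h => by
  have h1 := tuple_injective [Coded.enc p.num, Coded.enc p.den] [Coded.enc q.num, Coded.enc q.den]
    rfl h
  simp only [List.cons.injEq, and_true] at h1
  exact NNRat.ext_num_den (Coded.enc_injective h1.1) (Coded.enc_injective h1.2)⟩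

/-- The index set `ℕ^n` is encoded as an `n`-tuple of natural numbers. -/
instance (n : ℕ) : Coded (Fin n → ℕ) :=
  ⟨fun K => tuple (List.ofFn fun i => Coded.enc (K i)), fun K L h => by
    have h1 := tuple_injective _ _ (by simp) h
    funext i
    exact Coded.enc_injective (congrFun (List.ofFn_injective h1) i)⟩

/-! ## Multi-tape Turing machines -/

inductive Move
  | left
  | stay
  | right

def Move.offset : Move → ℤ
  | .left => -1
  | .stay => 0
  | .right => 1

/-- A deterministic Turing machine with `n` read-only input tapes and `work + 1` read-write tapes,
all two-way infinite, over the tape alphabet `0`, `1`, blank (`none`). The read-write tape number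
`0` is the output tape. The machine halts when `δ` returns `none`. -/
structure TM (n : ℕ) where
  State : Type
  [finite : Finite State]
  start : State
  work : ℕ
  δ : State → (Fin n → Option Bool) → (Fin (work + 1) → Option Bool) →
    Option (State × (Fin n → Move) × (Fin (work + 1) → Option Bool × Move))

namespace TM

variable {n : ℕ}

structure Cfg (M : TM n) where
  state : M.State
  inHead : Fin n → ℤ
  cells : Fin (M.work + 1) → ℤ → Option Bool
  head : Fin (M.work + 1) → ℤ

/-- All heads start in cell `0`, all read-write tapes are blank. -/
def init (M : TM n) : M.Cfg :=
  ⟨M.start, fun _ => 0, fun _ _ => none, fun _ => 0⟩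

/-- One time step with input tapes `inp`; `none` if the machine has halted. -/
def step (M : TM n) (inp : Fin n → ℤ → Option Bool) (c : M.Cfg) : Option M.Cfg :=
  (M.δ c.state (fun i => inp i (c.inHead i)) (fun j => c.cells j (c.head j))).map fun d =>
    ⟨d.1, fun i => c.inHead i + (d.2.1 i).offset,
      fun j => Function.update (c.cells j) (c.head j) (d.2.2 j).1,
      fun j => c.head j + (d.2.2 j).2.offset⟩

/-- The configuration after `t` time steps (a halted machine stays where it is). -/
def run (M : TM n) (inp : Fin n → ℤ → Option Bool) (t : ℕ) : M.Cfg :=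
  (fun c => (M.step inp c).getD c)^[t] M.init

/-- The word on the output tape: the bits in cells `0, 1, …` up to the first blank cell. -/
noncomputable def Cfg.output {M : TM n} (c : M.Cfg) : Word :=
  (List.range (sInf {i : ℕ | c.cells 0 i = none})).map fun i => c.cells 0 (i : ℤ) == some true

/-- On the input tapes `inp` the machine halts within `t` time steps, with output `y`. -/
def OutputsWithin (M : TM n) (inp : Fin n → ℤ → Option Bool) (y : Word) (t : ℕ) : Prop :=
  M.step inp (M.run inp t) = none ∧ (M.run inp t).output = y

end TM

/-- The tape that holds the word `w` in cells `0, …, |w| - 1` and is blank elsewhere. -/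
def wordTape (w : Word) : ℤ → Option Bool :=
  fun i => if 0 ≤ i then w[i.toNat]? else none

/-- The tape that holds, from cell `0` on, the word `a` followed by the infinite sequence `z`. -/
def programTape (a : Word) (z : ℕ → Bool) : ℤ → Option Bool :=
  fun i => if 0 ≤ i then some (a.getD i.toNat (z (i.toNat - a.length))) else none

/-- `U`, whose tape `0` is the program tape, is a prefix-free universal machine: every machine `M`
has a self-delimiting program `a` such that `U` simulates `M` with polynomial overhead on every
infinite program tape that begins with `a`, whatever bits come after `a`. -/
def TM.IsPrefixFreeUniversal {n : ℕ} (U : TM (n + 1)) : Prop :=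
  ∀ M : TM n, ∃ (a : Word) (q : Polynomial ℕ), ∀ (x : Fin n → Word) (y : Word) (t : ℕ),
    M.OutputsWithin (fun i => wordTape (x i)) y t →
      ∀ z : ℕ → Bool,
        U.OutputsWithin (Fin.cons (programTape a z) fun i => wordTape (x i)) y (q.eval t)

/-- `Ev^k(a; x)`: the output of `U` when executed for `k` time steps on the program `a`,
continued by an infinite sequence of zeros, and the inputs `x`. -/
noncomputable def TM.ev {n : ℕ} (U : TM (n + 1)) (k : ℕ) (a : Word) (x : Fin n → Word) : Word :=
  (U.run (Fin.cons (programTape a fun _ => false) fun i => wordTape (x i)) k).output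

open Classical in
/-- The image of the encoding is decidable in polynomial time. -/
def PolyTimeDecidableImage (X : Type*) [Coded X] : Prop :=
  ∃ (M : TM 1) (q : Polynomial ℕ), ∀ w : Word,
    M.OutputsWithin ![wordTape w] [decide (w ∈ Set.range (Coded.enc : X → Word))]
      (q.eval w.length)

/-! ## Growth spaces and fall spaces -/

/-- `Γ_poly` of rank `n`. -/
def GammaPoly (n : ℕ) : Set ((Fin n → ℕ) → ℕ) :=
  {γ | ∃ p : MvPolynomial (Fin n) ℕ, ∀ K, γ K ≤ MvPolynomial.eval K p}

/-- `Γ_0` of rank `n`. -/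
def GammaZero (n : ℕ) : Set ((Fin n → ℕ) → ℕ) :=
  {γ | ∀ K, γ K = 0}

/-- `α_p(J, k) = (J, p(J, k))`. -/
noncomputable def alphaP {n : ℕ} (p : MvPolynomial (Fin (n + 1)) ℕ) (K : Fin (n + 1) → ℕ) :
    Fin (n + 1) → ℕ :=
  Function.update K (Fin.last n) (MvPolynomial.eval K p)

/-- `γ` is (strictly) increasing in the last argument. -/
def IncreasingLast {n : ℕ} (γ : (Fin (n + 1) → ℕ) → ℕ) : Prop :=
  ∀ K : Fin (n + 1) → ℕ, StrictMono fun k => γ (Function.update K (Fin.last n) k)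

structure SteadilyGrowing {n : ℕ} (γ : (Fin (n + 1) → ℕ) → ℕ) : Prop where
  poly : γ ∈ GammaPoly (n + 1)
  mono : ∀ K : Fin (n + 1) → ℕ, Monotone fun k => γ (Function.update K (Fin.last n) k)
  doubling : ∃ s : MvPolynomial (Fin (n + 1)) ℕ, ∀ K, (γ K : ℝ) ≤ 1 / 2 * γ (alphaP s K)

/-- The growth space `Γ_{γ*}` of a steadily growing function `γ*`. -/
def GammaOf {n : ℕ} (γs : (Fin (n + 1) → ℕ) → ℕ) : Set ((Fin (n + 1) → ℕ) → ℕ) :=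
  {γ | ∃ p : MvPolynomial (Fin (n + 1)) ℕ, ∀ K, γ K ≤ γs (alphaP p K)}

/-- The pullback `Γα` of a growth space. -/
def pullGrowth {m n : ℕ} (Γ : Set ((Fin n → ℕ) → ℕ)) (α : (Fin m → ℕ) → Fin n → ℕ) :
    Set ((Fin m → ℕ) → ℕ) :=
  {γ | ∃ γ' ∈ Γ, ∀ L, γ L ≤ γ' (α L)}

structure FallSpace (n : ℕ) where
  carrier : Set ((Fin n → ℕ) → ℝ)
  nonneg : ∀ ε ∈ carrier, ∀ K, 0 ≤ ε K
  bounded : ∀ ε ∈ carrier, ∃ C : ℝ, ∀ K, ε K ≤ C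
  add : ∀ ε₁ ∈ carrier, ∀ ε₂ ∈ carrier, ε₁ + ε₂ ∈ carrier
  mono : ∀ ε₁ ∈ carrier, ∀ ε₂ : (Fin n → ℕ) → ℝ,
    (∀ K, 0 ≤ ε₂ K) → (∀ K, ε₂ K ≤ ε₁ K) → ε₂ ∈ carrier
  exp_mem : ∃ h : MvPolynomial (Fin n) ℕ,
    (fun K => (1 / 2 : ℝ) ^ (MvPolynomial.eval K h)) ∈ carrier

/-! ## Polynomial-time functions and schemes -/

/-- `α` is computable in time polynomial in the numbers `L` (not in their length). -/
def PolyTime {m : ℕ} {Y : Type*} [Coded Y] (α : (Fin m → ℕ) → Y) : Prop :=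
  ∃ (M : TM 1) (p : MvPolynomial (Fin m) ℕ), ∀ L,
    M.OutputsWithin ![wordTape (Coded.enc L)] (Coded.enc (α L)) (MvPolynomial.eval L p)

/-- The clauses about running time of `S : ℕ^n × X × Word × Word → Y` and
`R : ℕ^n × Word → ℕ`: both are computed by Turing machines whose running time is bounded
by a polynomial in the index `K`, uniformly in all other inputs. -/
structure SchemeTime {n : ℕ} {X Y : Type*} [Coded X] [Coded Y]
    (S : (Fin n → ℕ) → X → Word → Word → Y) (R : (Fin n → ℕ) → Word → ℕ) : Prop where
  alg : ∃ (M : TM 4) (p : MvPolynomial (Fin n) ℕ), ∀ K x y z,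
    M.OutputsWithin ![wordTape (Coded.enc K), wordTape (Coded.enc x), wordTape y, wordTape z]
      (Coded.enc (S K x y z)) (MvPolynomial.eval K p)
  rnd : ∃ (M : TM 2) (p : MvPolynomial (Fin n) ℕ), ∀ K z,
    M.OutputsWithin ![wordTape (Coded.enc K), wordTape z]
      (Coded.enc (R K z)) (MvPolynomial.eval K p)

/-- The uniform distribution on words of length `l`. -/
noncomputable def unif (l : ℕ) : PMF Word :=
  (PMF.uniformOfFintype (Fin l → Bool)).map List.ofFn

/-- A polynomial-time `(ΓR, ΓA)`-scheme of signature `X → Y`: an algorithm `alg` with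
`rnd K (adv K)` random bits and the advice `adv K`. -/
structure Scheme (n : ℕ) (ΓR ΓA : Set ((Fin n → ℕ) → ℕ)) (X Y : Type*) [Coded X] [Coded Y] where
  alg : (Fin n → ℕ) → X → Word → Word → Y
  rnd : (Fin n → ℕ) → Word → ℕ
  adv : (Fin n → ℕ) → Word
  time : SchemeTime alg rnd
  rnd_mem : (fun K => rnd K (adv K)) ∈ ΓR
  adv_mem : (fun K => (adv K).length) ∈ ΓA

/-- The distribution of the random variable `S^K(x)`. -/
noncomputable def Scheme.kernel {n : ℕ} {ΓR ΓA : Set ((Fin n → ℕ) → ℕ)} {X Y : Type*}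
    [Coded X] [Coded Y] (S : Scheme n ΓR ΓA X Y) (K : Fin n → ℕ) (x : X) : PMF Y :=
  (unif (S.rnd K (S.adv K))).map fun y => S.alg K x y (S.adv K)

/-- A polynomial-time `MΓ`-scheme of signature `X → Y`: the advice itself is random. -/
structure MScheme (n : ℕ) (ΓR ΓA : Set ((Fin n → ℕ) → ℕ)) (X Y : Type*) [Coded X] [Coded Y] where
  alg : (Fin n → ℕ) → X → Word → Word → Y
  rnd : (Fin n → ℕ) → Word → ℕ
  adv : (Fin n → ℕ) → PMF Word
  time : SchemeTime alg rnd
  rnd_mem : ∃ ρ ∈ ΓR, ∀ K, ∀ z ∈ (adv K).support, rnd K z ≤ ρ K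
  adv_mem : ∃ l ∈ ΓA, ∀ K, ∀ z ∈ (adv K).support, z.length = l K

/-- The distribution `S^K_x`. -/
noncomputable def MScheme.kernel {n : ℕ} {ΓR ΓA : Set ((Fin n → ℕ) → ℕ)} {X Y : Type*}
    [Coded X] [Coded Y] (S : MScheme n ΓR ΓA X Y) (K : Fin n → ℕ) (x : X) : PMF Y :=
  (S.adv K).bind fun z => (unif (S.rnd K z)).map fun y => S.alg K x y z

/-! ## Word ensembles and distributional estimation problems -/

/-- Word ensembles of rank `n`. -/
abbrev Ensemble (n : ℕ) := (Fin n → ℕ) → PMF Word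

/-- The union of the supports. -/
def Ensemble.supp {n : ℕ} (D : Ensemble n) : Set Word := {x | ∃ K, x ∈ (D K).support}

/-- Expected value. -/
noncomputable def expect {X : Type*} (μ : PMF X) (f : X → ℝ) : ℝ := ∑' x, (μ x).toReal * f x

/-- Total variation distance of two probability mass functions. -/
noncomputable def tvDist {X : Type*} (μ ν : X → ℝ) : ℝ := 1 / 2 * ∑' x, |μ x - ν x|

/-- The mass function of `μ ∣ κ⁻¹(y)`, the conditional distribution of `x ∼ μ`
given that the Markov kernel `κ` sent `x` to `y`. -/
noncomputable def posterior {X Y : Type*} (μ : PMF X) (κ : X → PMF Y) (y : Y) (x : X) : ℝ :=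
  (μ x * κ x y / (μ.bind κ) y).toReal

/-- A distributional estimation problem `(D, f)` of rank `n`. -/
structure DistProblem (n : ℕ) where
  dist : Ensemble n
  f : dist.supp → ℝ
  bounded : ∃ C : ℝ, ∀ x, |f x| ≤ C

/-- The extension of `f` by zero to all words. -/
noncomputable def DistProblem.fbar {n : ℕ} (P : DistProblem n) : Word → ℝ :=
  Function.extend Subtype.val P.f 0

section

variable {m n : ℕ}

/-- `D` is `F(Γ)`-samplable, `Γ = (ΓR, ΓA)`. -/
def Samplable (F : FallSpace n) (ΓR ΓA : Set ((Fin n → ℕ) → ℕ)) (D : Ensemble n) : Prop :=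
  ∃ σ : Scheme n ΓR ΓA Unit Word,
    (fun K => tvDist (fun x => (D K x).toReal) (fun x => (σ.kernel K () x).toReal)) ∈ F.carrier

/-- `D` is `F(MΓ)`-samplable relative to the family of Markov kernels `κ`. -/
def MSamplableRel (F : FallSpace n) (ΓR ΓA : Set ((Fin n → ℕ) → ℕ)) (D : Ensemble n)
    {Y : Type*} [Coded Y] (κ : (Fin n → ℕ) → Word → PMF Y) : Prop :=
  ∃ σ : MScheme n ΓR ΓA Y Word,
    (fun K => expect ((D K).bind (κ K)) fun y =>
      tvDist (posterior (D K) (κ K) y) (fun x => (σ.kernel K y x).toReal)) ∈ F.carrier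

/-- `D` is `F(Γ)`-dominated by `D'`. -/
def Dominated (F : FallSpace n) (ΓR ΓA : Set ((Fin n → ℕ) → ℕ)) (D D' : Ensemble n) : Prop :=
  ∃ W : Scheme n ΓR ΓA Word ℚ≥0,
    (∃ C : ℚ≥0, ∀ K x y, W.alg K x y (W.adv K) ≤ C) ∧
    (fun K => ∑' x, |(D' K x).toReal * expect (W.kernel K x) (fun q => (q : ℝ))
      - (D K x).toReal|) ∈ F.carrier

/-- `α : ℕ^m → ℕ^n` is an efficient injection. -/
structure EfficientInjection (α : (Fin m → ℕ) → Fin n → ℕ) : Prop where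
  poly : ∀ i, (fun L => α L i) ∈ GammaPoly m
  time : PolyTime α
  inv : ∃ β : (Fin n → ℕ) → Fin m → ℕ,
    (∀ i, (fun K => β K i) ∈ GammaPoly n) ∧ ∀ L, β (α L) = L

/-- `π` is a precise pseudo-invertible `G(Γ)`-reduction of `P` to `Q` over `α`,
`Γ = (ΓR, ΓA)`. -/
structure IsPreciseReduction (G : FallSpace m) {ΓR ΓA : Set ((Fin n → ℕ) → ℕ)}
    (P : DistProblem m) (Q : DistProblem n) (α : (Fin m → ℕ) → Fin n → ℕ)
    (π : Scheme m (pullGrowth ΓR α) (pullGrowth ΓA α) Word Word) : Prop where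
  inj : EfficientInjection α
  dominated : Dominated G (pullGrowth ΓR α) (pullGrowth ΓA α)
    (fun K => (P.dist K).bind (π.kernel K)) (fun K => Q.dist (α K))
  precise : (fun K => expect (P.dist K) fun x =>
    expect (π.kernel K x) fun y => |P.fbar x - Q.fbar y|) ∈ G.carrier
  samplable : MSamplableRel G (pullGrowth ΓR α) (pullGrowth ΓA α) P.dist π.kernel

/-- There is a precise pseudo-invertible `G(Γ)`-reduction of `P` to `Q` over `α_p`, for some
polynomial `p` that is increasing in the last argument. -/
def ReducesTo (G : FallSpace (n + 1)) (ΓR ΓA : Set ((Fin (n + 1) → ℕ) → ℕ))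
    (P Q : DistProblem (n + 1)) : Prop :=
  ∃ p : MvPolynomial (Fin (n + 1)) ℕ, IncreasingLast (fun K => MvPolynomial.eval K p) ∧
    ∃ π : Scheme (n + 1) (pullGrowth ΓR (alphaP p)) (pullGrowth ΓA (alphaP p)) Word Word,
      IsPreciseReduction (ΓR := ΓR) (ΓA := ΓA) G P Q (alphaP p) π

/-- `Q` is complete for the class `C` with respect to the reductions of `ReducesTo`. -/
def IsCompleteFor (G : FallSpace (n + 1)) (ΓR ΓA : Set ((Fin (n + 1) → ℕ) → ℕ))
    (C : Set (DistProblem (n + 1))) (Q : DistProblem (n + 1)) : Prop :=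
  Q ∈ C ∧ ∀ P ∈ C, ReducesTo G ΓR ΓA P Q

/-! ## The complete problem -/

/-- The encoded set `E` is prefix-free. -/
def PrefixFree (E : Type*) [Coded E] : Prop :=
  ∀ (φ ψ : E) (z : Word), z ≠ [] → Coded.enc φ ≠ Coded.enc ψ ++ z

/-- The ensemble `D_𝔉` (it does not depend on `𝔉`): the law of
`⟨b, En(K_last), a, Ev^{K_last}(a; En(K), w)⟩` for independent uniform `b`, `a` of length `r K`
and `w` of length `s K`. -/
noncomputable def universalEnsemble (r s : (Fin (n + 1) → ℕ) → ℕ) (U : TM 3) :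
    Ensemble (n + 1) := fun K =>
  (unif (r K)).bind fun b => (unif (r K)).bind fun a => (unif (s K)).map fun w =>
    tuple [b, Coded.enc (K (Fin.last n)), a, U.ev (K (Fin.last n)) a ![Coded.enc K, w]]

/-- The value `𝔉(φ, k, x)` if `b = En(φ)z` for some `φ` and `z`, and `0` if there are none. -/
noncomputable def prefixValue {E : Type*} [Coded E] (𝔉 : E → ℕ → Word → ℝ)
    (b : Word) (k : ℕ) (x : Word) : ℝ :=
  Function.extend (fun t : E × Word => Coded.enc t.1 ++ t.2) (fun t => 𝔉 t.1 k x) 0 b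

/-- The function `⟨b, En(k), a, x⟩ ↦ prefixValue 𝔉 b k x`
(and `0` on words that are not of this form). -/
noncomputable def universalFun {E : Type*} [Coded E] (𝔉 : E → ℕ → Word → ℝ) : Word → ℝ :=
  Function.extend
    (fun t : Word × ℕ × Word × Word => tuple [t.1, Coded.enc t.2.1, t.2.2.1, t.2.2.2])
    (fun t => prefixValue 𝔉 t.1 t.2.1 t.2.2.2) 0

theorem abs_extend_le {α β : Type*} (i : α → β) (g : α → ℝ) (C : ℝ) (hC : 0 ≤ C)
    (hg : ∀ a, |g a| ≤ C) (b : β) : |Function.extend i g 0 b| ≤ C := by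
  classical
  rw [Function.extend_def]
  split_ifs
  · exact hg _
  · simpa using hC

theorem abs_universalFun_le {E : Type*} [Coded E] (𝔉 : E → ℕ → Word → ℝ) (C : ℝ)
    (hC : ∀ φ k x, |𝔉 φ k x| ≤ C) (y : Word) : |universalFun 𝔉 y| ≤ max C 0 :=
  abs_extend_le _ _ _ (le_max_right _ _) (fun _ =>
    abs_extend_le _ _ _ (le_max_right _ _) (fun _ => (hC _ _ _).trans (le_max_left _ _)) _) _

/-- The problem `(D_𝔉, f_𝔉)`. -/
noncomputable def universalProblem (r s : (Fin (n + 1) → ℕ) → ℕ) (U : TM 3)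
    {E : Type*} [Coded E] (𝔉 : E → ℕ → Word → ℝ) (h𝔉 : ∃ C : ℝ, ∀ φ k x, |𝔉 φ k x| ≤ C) :
    DistProblem (n + 1) where
  dist := universalEnsemble r s U
  f := fun y => universalFun 𝔉 y
  bounded := h𝔉.elim fun C hC => ⟨max C 0, fun y => abs_universalFun_le 𝔉 C hC y⟩

/-- The class `X_𝔉`: there are `φ ∈ E` and a polynomial `q` such that `f(x) = 𝔉(φ, k, x)` for all
`x` in the domain of `f` and all `k ≥ q(|x|)`. -/
def EventuallyValue {E : Type*} (𝔉 : E → ℕ → Word → ℝ) {S : Set Word} (f : S → ℝ) : Prop :=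
  ∃ (φ : E) (q : Polynomial ℕ), ∀ (x : S) (k : ℕ), q.eval (x : Word).length ≤ k → f x = 𝔉 φ k x

/-- The class `SampX_𝔉[F(Γ)]`. -/
def SampX {E : Type*} (F : FallSpace n) (ΓR ΓA : Set ((Fin n → ℕ) → ℕ))
    (𝔉 : E → ℕ → Word → ℝ) : Set (DistProblem n) :=
  {P | Samplable F ΓR ΓA P.dist ∧ EventuallyValue 𝔉 P.f}

end

end PolyEst

open PolyEst

namespace PolyEst

/-! Let `σ` sample the distributions of a problem whose function agrees with 𝔉(φ, k, ·) for large k.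
The reduction sends x to ⟨En(φ)u, p(L), av, x⟩, where u, v are random bits and a is a program by
which the universal machine, given the code of `alphaP p L` and random bits w, computes the output
of `σ` at L. If x is drawn from `σ` itself, the image is the law of the universal ensemble at
`alphaP p L`, conditioned on b beginning with En(φ) and the program with a; since a is
self-delimiting, v does not affect the run. So the image has density 2^(|En(φ)|+|a|) on a decidable
event and 0 elsewhere, and the constant does not depend on L (`bind_unif_prefix_apply`,
`bind_kernel_reduceScheme`). The word x is literally the last component, which makes the reduction
invertible, and prefix-freeness of the codes together with q(|x|) ≤ p(L) makes the values agree.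
Thus all three conditions hold without error for the sampler. Passing to the given distributions
costs a constant times their distance from the sampler, because Markov kernels contract this
distance (`tsum_abs_bind_sub_le`, `expect_le_mul_tsum_abs_sub`, `expect_tvDist_posterior_le`).

The difficulty is the choice of p. The program sees `alphaP p L` and must recover L from it; but
p(L) is also the clock and must exceed the simulation time, which depends on the program and so,
apparently, on p. The circle is broken by p(L) = (4g+2)^(c+1), where g is the sum of the components
of L. This number is 2^(c+1) times an odd one, so c can be read off its trailing zeros, after which
g is found by search; one machine serves all c (`exists_machine_powIndex`). Its time is polynomial
in g and the length of its first input, and that length is linear in (4g+2)(c+1). With x = 4g+2 the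
requirement becomes q(x(c+1)) ≤ x^(c+1) for a polynomial q that does not involve c, which holds for
large c (`Polynomial.exists_eval_le_pow`). In `exists_program` the machine, the program and the
overhead are fixed first, and c last.

All machines come from a calculus of polynomial-time functions of words (`FP`, `FPon`), whose
structured programs are compiled to Turing machines (`exec_outputsWithin`). Clocked simulation of a
Turing machine belongs to the calculus (`FPon.run`), so given schemes and the universal machine can
be called as subroutines. Because running times have to be bounded in the index alone, machines read
only prefixes of their other inputs (`exists_machine`).

The universal ensemble is sampled exactly with 2r + s bits by clocked evaluation; steady growth
absorbs the constant factor. -/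

/-! ## A structured language over registers that hold words -/

/-- Registers: the input tapes (which can only be consumed) and infinitely many work registers. -/
abbrev Reg (n : ℕ) := Fin n ⊕ ℕ

abbrev Store (n : ℕ) := Reg n → Word

/-- Structured programs over registers. -/
inductive Cmd (n : ℕ)
  | skip
  | push (r : ℕ) (b : Bool)
  | pop (r : Reg n)
  | seq (c d : Cmd n)
  | case (r : Reg n) (c d e : Cmd n)
  | loop (r : Reg n) (c : Cmd n)

/-- `Exec c S S' t`: started on `S`, the program `c` ends with `S'` after at most `t` steps. -/
inductive Exec {n : ℕ} : Cmd n → Store n → Store n → ℕ → Prop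
  | skip {S : Store n} {t : ℕ} (ht : 1 ≤ t) : Exec .skip S S t
  | push {S : Store n} {t r : ℕ} {b : Bool} (ht : 1 ≤ t) :
      Exec (.push r b) S (Function.update S (.inr r) (b :: S (.inr r))) t
  | pop {S : Store n} {t : ℕ} {r : Reg n} (ht : 1 ≤ t) :
      Exec (.pop r) S (Function.update S r (S r).tail) t
  | seq {c d : Cmd n} {S S₁ S₂ : Store n} {t₁ t₂ t : ℕ} (h₁ : Exec c S S₁ t₁)
      (h₂ : Exec d S₁ S₂ t₂) (ht : t₁ + t₂ ≤ t) : Exec (.seq c d) S S₂ t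
  | case_nil {r : Reg n} {c d e : Cmd n} {S S' : Store n} {t₁ t : ℕ} (hr : S r = [])
      (h : Exec c S S' t₁) (ht : t₁ + 1 ≤ t) : Exec (.case r c d e) S S' t
  | case_false {r : Reg n} {c d e : Cmd n} {S S' : Store n} {t₁ t : ℕ} {w : Word}
      (hr : S r = false :: w) (h : Exec d S S' t₁) (ht : t₁ + 1 ≤ t) :
      Exec (.case r c d e) S S' t
  | case_true {r : Reg n} {c d e : Cmd n} {S S' : Store n} {t₁ t : ℕ} {w : Word}
      (hr : S r = true :: w) (h : Exec e S S' t₁) (ht : t₁ + 1 ≤ t) :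
      Exec (.case r c d e) S S' t
  | loop_nil {r : Reg n} {c : Cmd n} {S : Store n} {t : ℕ} (hr : S r = []) (ht : 1 ≤ t) :
      Exec (.loop r c) S S t
  | loop_cons {r : Reg n} {c : Cmd n} {S S₁ S₂ : Store n} {t₁ t₂ t : ℕ} (hr : S r ≠ [])
      (h₁ : Exec c S S₁ t₁) (h₂ : Exec (.loop r c) S₁ S₂ t₂) (ht : t₁ + t₂ + 1 ≤ t) :
      Exec (.loop r c) S S₂ t

theorem Exec.mono {n : ℕ} {c : Cmd n} {S S' : Store n} {t t' : ℕ} (h : Exec c S S' t)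
    (ht' : t ≤ t') : Exec c S S' t' := by
  cases h with
  | skip ht => exact .skip (ht.trans ht')
  | push ht => exact .push (ht.trans ht')
  | pop ht => exact .pop (ht.trans ht')
  | seq h₁ h₂ ht => exact .seq h₁ h₂ (ht.trans ht')
  | case_nil hr h ht => exact .case_nil hr h (ht.trans ht')
  | case_false hr h ht => exact .case_false hr h (ht.trans ht')
  | case_true hr h ht => exact .case_true hr h (ht.trans ht')
  | loop_nil hr ht => exact .loop_nil hr (ht.trans ht')
  | loop_cons hr h₁ h₂ ht => exact .loop_cons hr h₁ h₂ (ht.trans ht')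

theorem Exec.of_eq {n : ℕ} {c : Cmd n} {S S' S'' : Store n} {t : ℕ} (h : Exec c S S' t)
    (e : S' = S'') : Exec c S S'' t := e ▸ h

/-- A step adds at most one bit to a register, so every time bound is also a bound for the length of
the results. The length estimates for compositions rest on this. -/
theorem Exec.length_le {n : ℕ} {c : Cmd n} {S S' : Store n} {t : ℕ} (h : Exec c S S' t)
    (r : Reg n) : (S' r).length ≤ (S r).length + t := by
  induction h with
  | skip ht => omega
  | @push S t r' b ht =>
    by_cases h : r = .inr r'
    · subst h; simp; omega
    · simp [Function.update_of_ne h]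
  | @pop S t r' ht =>
    by_cases h : r = r'
    · subst h; simp; omega
    · simp [Function.update_of_ne h]
  | seq _ _ ht ih₁ ih₂ => omega
  | case_nil hr h ht ih => omega
  | case_false hr h ht ih => omega
  | case_true hr h ht ih => omega
  | loop_nil hr ht => omega
  | loop_cons hr h₁ h₂ ht ih₁ ih₂ => omega

/-! ## Compilation to Turing machines -/

/-- Control states of a program. -/
inductive Lab {n : ℕ} : Cmd n → Type
  | skip : Lab .skip
  | push₁ {r b} : Lab (.push r b)
  | push₂ {r b} : Lab (.push r b)
  | pop {r} : Lab (.pop r)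
  | seqL {c d} : Lab c → Lab (.seq c d)
  | seqR {c d} : Lab d → Lab (.seq c d)
  | case₀ {r c d e} : Lab (.case r c d e)
  | case₁ {r c d e} : Lab c → Lab (.case r c d e)
  | case₂ {r c d e} : Lab d → Lab (.case r c d e)
  | case₃ {r c d e} : Lab e → Lab (.case r c d e)
  | loop₀ {r c} : Lab (.loop r c)
  | loop₁ {r c} : Lab c → Lab (.loop r c)

theorem Lab.finite {n : ℕ} (c : Cmd n) : Finite (Lab c) := by
  induction c with
  | skip => exact Finite.of_surjective (fun _ : Unit => Lab.skip) fun | .skip => ⟨(), rfl⟩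
  | push r b =>
    exact Finite.of_surjective (fun x : Bool => if x then Lab.push₁ else Lab.push₂)
      fun | .push₁ => ⟨true, rfl⟩ | .push₂ => ⟨false, rfl⟩
  | pop r => exact Finite.of_surjective (fun _ : Unit => Lab.pop) fun | .pop => ⟨(), rfl⟩
  | seq c d hc hd =>
    exact Finite.of_surjective (fun x : Lab c ⊕ Lab d => x.elim Lab.seqL Lab.seqR)
      fun | .seqL l => ⟨.inl l, rfl⟩ | .seqR l => ⟨.inr l, rfl⟩
  | case r c d e hc hd he =>
    exact Finite.of_surjective (fun x : Unit ⊕ Lab c ⊕ Lab d ⊕ Lab e =>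
      x.elim (fun _ => Lab.case₀) fun y => y.elim Lab.case₁ fun z => z.elim Lab.case₂ Lab.case₃)
      fun
        | .case₀ => ⟨.inl (), rfl⟩
        | .case₁ l => ⟨.inr (.inl l), rfl⟩
        | .case₂ l => ⟨.inr (.inr (.inl l)), rfl⟩
        | .case₃ l => ⟨.inr (.inr (.inr l)), rfl⟩
  | loop r c hc =>
    exact Finite.of_surjective (fun x : Unit ⊕ Lab c => x.elim (fun _ => Lab.loop₀) Lab.loop₁)
      fun | .loop₀ => ⟨.inl (), rfl⟩ | .loop₁ l => ⟨.inr l, rfl⟩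

def Lab.start {n : ℕ} : (c : Cmd n) → Lab c
  | .skip => .skip
  | .push _ _ => .push₁
  | .pop _ => .pop
  | .seq c _ => .seqL (Lab.start c)
  | .case _ _ _ _ => .case₀
  | .loop _ _ => .loop₀

/-- The actions of one time step. -/
abbrev Acts (n m : ℕ) := (Fin n → Move) × (Fin (m + 1) → Option Bool × Move)

def Acts.idle {n m : ℕ} (w : Fin (m + 1) → Option Bool) : Acts n m :=
  (fun _ => .stay, fun j => (w j, .stay))

/-- The symbol at the top of a register. -/
def regSym {n m : ℕ} (u : Fin n → Option Bool) (w : Fin (m + 1) → Option Bool) :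
    Reg n → Option Bool
  | .inl i => u i
  | .inr j => if h : j < m + 1 then w ⟨j, h⟩ else none

/-- The transition function of a program; `none` stands for its exit. -/
def Lab.next {n m : ℕ} (u : Fin n → Option Bool) (w : Fin (m + 1) → Option Bool) :
    (c : Cmd n) → Lab c → Option (Lab c) × Acts n m
  | _, .skip => (none, .idle w)
  | _, .push₁ (r := r) =>
      (some .push₂, fun _ => .stay, fun j => (w j, if j.val = r then .right else .stay))
  | _, .push₂ (r := r) (b := b) =>
      (none, fun _ => .stay, fun j => (if j.val = r then some b else w j, .stay))
  | _, .pop (r := .inl i) =>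
      (none, fun k => if k = i then .right else .stay, fun j => (w j, .stay))
  -- If the top is blank the register is empty, and its head has to remain on cell `-1`.
  | _, .pop (r := .inr r) =>
      (none, fun _ => .stay,
        fun j => if j.val = r ∧ (w j).isSome then (none, .left) else (w j, .stay))
  | _, .seqL (c := c) (d := d) l =>
      (some (((Lab.next u w c l).1.map .seqL).getD (.seqR (Lab.start d))), (Lab.next u w c l).2)
  | _, .seqR (d := d) l => ((Lab.next u w d l).1.map .seqR, (Lab.next u w d l).2)
  | _, .case₀ (r := r) (c := c) (d := d) (e := e) =>
      (some (match regSym u w r with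
        | none => .case₁ (Lab.start c)
        | some false => .case₂ (Lab.start d)
        | some true => .case₃ (Lab.start e)), .idle w)
  | _, .case₁ (c := c) l => ((Lab.next u w c l).1.map .case₁, (Lab.next u w c l).2)
  | _, .case₂ (d := c) l => ((Lab.next u w c l).1.map .case₂, (Lab.next u w c l).2)
  | _, .case₃ (e := c) l => ((Lab.next u w c l).1.map .case₃, (Lab.next u w c l).2)
  | _, .loop₀ (r := r) (c := c) =>
      ((regSym u w r).map fun _ => .loop₁ (Lab.start c), .idle w)
  | _, .loop₁ (c := c) l =>
      (some (((Lab.next u w c l).1.map .loop₁).getD .loop₀), (Lab.next u w c l).2)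

/-- Heads and cells of a machine with `n` input tapes and `m + 1` work tapes. -/
structure Phys (n m : ℕ) where
  inHead : Fin n → ℤ
  cells : Fin (m + 1) → ℤ → Option Bool
  head : Fin (m + 1) → ℤ

def Phys.act {n m : ℕ} (T : Phys n m) (a : Acts n m) : Phys n m :=
  ⟨fun i => T.inHead i + (a.1 i).offset,
    fun j => Function.update (T.cells j) (T.head j) (a.2 j).1,
    fun j => T.head j + (a.2 j).2.offset⟩

/-! ### Runs of compiled programs -/

section Reach

variable {n m : ℕ} (inp : Fin n → ℤ → Option Bool)

/-- The transition of the program `c` in control state `l` with tapes `T`. -/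
def Phys.next (T : Phys n m) (c : Cmd n) (l : Lab c) : Option (Lab c) × Acts n m :=
  Lab.next (fun i => inp i (T.inHead i)) (fun j => T.cells j (T.head j)) c l

/-- Reachability in a given number of steps. -/
inductive Reach (c : Cmd n) : Option (Lab c) → Phys n m → Option (Lab c) → Phys n m → ℕ → Prop
  | refl (x : Option (Lab c)) (T : Phys n m) : Reach c x T x T 0
  | step {l : Lab c} {T T' : Phys n m} {y : Option (Lab c)} {k : ℕ}
      (h : Reach c (T.next inp c l).1 (T.act (T.next inp c l).2) y T' k) :
      Reach c (some l) T y T' (k + 1)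

variable {inp}

theorem Reach.trans {c : Cmd n} {x y z : Option (Lab c)} {T₁ T₂ T₃ : Phys n m} {k₁ k₂ : ℕ}
    (h₁ : Reach inp c x T₁ y T₂ k₁) (h₂ : Reach inp c y T₂ z T₃ k₂) :
    Reach inp c x T₁ z T₃ (k₁ + k₂) := by
  induction h₁ with
  | refl => simpa using h₂
  | step _ ih =>
    have := Reach.step (ih h₂)
    rwa [show ∀ a b : ℕ, a + 1 + b = a + b + 1 by omega]

/-- The control states of a subprogram embed by `f` into those of the whole program; `φ` extends `f`
by the place to which control passes when the subprogram exits: the second half of a sequence, the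
head of a loop, or the exit of the whole. -/
theorem Reach.lift {c d : Cmd n} (φ : Option (Lab c) → Option (Lab d)) (f : Lab c → Lab d)
    (hφ : ∀ l, φ (some l) = some (f l))
    (hf : ∀ (T : Phys n m) l, T.next inp d (f l) = (φ (T.next inp c l).1, (T.next inp c l).2))
    {x y : Option (Lab c)} {T T' : Phys n m} {k : ℕ} (h : Reach inp c x T y T' k) :
    Reach inp d (φ x) T (φ y) T' k := by
  induction h with
  | refl => exact .refl _ _
  | step _ ih =>
    rw [hφ]
    refine .step ?_
    rwa [hf]

end Reach

/-- A bound for the numbers of the registers of a program. -/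
def Cmd.bound {n : ℕ} : Cmd n → ℕ
  | .skip => 0
  | .push r _ => r
  | .pop (.inl _) => 0
  | .pop (.inr r) => r
  | .seq c d => max c.bound d.bound
  | .case (.inl _) c d e => max c.bound (max d.bound e.bound)
  | .case (.inr r) c d e => max r (max c.bound (max d.bound e.bound))
  | .loop (.inl _) c => c.bound
  | .loop (.inr r) c => max r c.bound

/-- The tapes `T` represent the store `S`. -/
structure Represents {n m : ℕ} (x : Fin n → Word) (S : Store n) (T : Phys n m) : Prop where
  inp : ∀ i, ∃ p : ℕ, T.inHead i = p ∧ S (.inl i) = (x i).drop p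
  cells : ∀ j : Fin (m + 1), T.cells j = wordTape (S (.inr j)).reverse
  head : ∀ j : Fin (m + 1), T.head j = (S (.inr j)).length - 1

/-- A work register lies on its tape as a stack that grows to the right, with the head on the last
occupied cell. For an empty register this is the blank cell `-1`, so the machine can see emptiness.
-/
theorem wordTape_top (w : Word) : wordTape w.reverse ((w.length : ℤ) - 1) = w.head? := by
  cases w with
  | nil => simp [wordTape]
  | cons b w => simp [wordTape]

theorem wordTape_natCast (w : Word) (p : ℕ) : wordTape w p = w[p]? := by
  simp [wordTape]

theorem update_wordTape_push (b : Bool) (w : Word) :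
    Function.update (wordTape w.reverse) (w.length : ℤ) (some b) = wordTape (b :: w).reverse := by
  funext i
  by_cases h : i = w.length
  · subst h; simp [wordTape]
  · rw [Function.update_of_ne h]
    unfold wordTape
    split_ifs with h0
    · obtain ⟨k, rfl⟩ := Int.eq_ofNat_of_zero_le h0
      have : k ≠ w.length := by simpa using h
      simp only [Int.toNat_natCast, List.reverse_cons]
      rcases lt_or_gt_of_ne this with h1 | h1
      · rw [List.getElem?_append_left (by simpa using h1)]
      · rw [List.getElem?_eq_none (by simp; omega), List.getElem?_eq_none (by simp; omega)]
    · rfl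

theorem update_wordTape_pop (b : Bool) (w : Word) :
    Function.update (wordTape (b :: w).reverse) (w.length : ℤ) none = wordTape w.reverse := by
  rw [← update_wordTape_push, Function.update_idem]
  conv_rhs => rw [← Function.update_eq_self (w.length : ℤ) (wordTape w.reverse)]
  congr 1
  simp [wordTape]

section Compile

variable {n m : ℕ} {x : Fin n → Word}

theorem Represents.regSym {S : Store n} {T : Phys n m} (h : Represents x S T) (r : Reg n)
    (hr : ∀ j, r = .inr j → j ≤ m) :
    regSym (fun i => wordTape (x i) (T.inHead i)) (fun j => T.cells j (T.head j)) r
      = (S r).head? := by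
  cases r with
  | inl i =>
    obtain ⟨p, h1, h2⟩ := h.inp i
    simp only [PolyEst.regSym, h1, h2, wordTape_natCast, List.head?_drop]
  | inr j =>
    have hj : j < m + 1 := by have := hr j rfl; omega
    simp only [PolyEst.regSym, hj, dite_true]
    rw [h.cells, h.head, wordTape_top]

theorem Represents.idle {S : Store n} {T : Phys n m} (h : Represents x S T) :
    Represents x S (T.act (.idle fun j => T.cells j (T.head j))) := by
  have : T.act (.idle fun j => T.cells j (T.head j)) = T := by
    simp [Phys.act, Acts.idle, Move.offset, Function.update_eq_self]
  rwa [this]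

/-- The factor 2 is due to `push`, which first moves the head and then writes. All other commands
cost no more machine steps than `Exec` counts. -/
theorem exec_reach {c : Cmd n} {S S' : Store n} {t : ℕ} (h : Exec c S S' t) (hc : c.bound ≤ m)
    {T : Phys n m} (hT : Represents x S T) :
    ∃ (T' : Phys n m) (k : ℕ), k ≤ 2 * t ∧ Represents x S' T' ∧
      Reach (fun i => wordTape (x i)) c (some (Lab.start c)) T none T' k := by
  induction h generalizing T with
  | skip ht => exact ⟨_, 1, by omega, hT.idle, .step (.refl _ _)⟩
  | @push S t r b ht =>
    refine ⟨_, 2, by omega, ?_, .step (.step (.refl _ _))⟩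
    constructor
    · intro i
      simpa [Phys.act, Phys.next, Lab.start, Lab.next, Move.offset] using hT.inp i
    · intro j
      simp only [Phys.act, Phys.next, Lab.start, Lab.next, Function.update_eq_self]
      by_cases hj : j.val = r
      · subst hj
        have := hT.head j
        simp only [if_true, Function.update_self, hT.head j, hT.cells j]
        rw [← update_wordTape_push]
        simp [Move.offset]
      · rw [Function.update_of_ne (by simpa using hj)]
        simp [hj, hT.cells j]
    · intro j
      simp only [Phys.act, Phys.next, Lab.start, Lab.next, Function.update_eq_self]
      by_cases hj : j.val = r
      · subst hj
        simp [hT.head j, Move.offset]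
      · rw [Function.update_of_ne (by simpa using hj)]
        simp [hj, hT.head j, Move.offset]
  | @pop S t r ht =>
    cases r with
    | inl i =>
      refine ⟨_, 1, by omega, ?_, .step (.refl _ _)⟩
      constructor
      · intro k
        obtain ⟨p, h1, h2⟩ := hT.inp k
        by_cases hk : k = i
        · subst hk
          refine ⟨p + 1, ?_, ?_⟩
          · simp [Phys.act, Phys.next, Lab.start, Lab.next, Move.offset, h1]
          · simp [h2]
        · refine ⟨p, ?_, ?_⟩
          · simp [Phys.act, Phys.next, Lab.start, Lab.next, Move.offset, h1, hk]
          · rw [Function.update_of_ne (by simpa using hk), h2]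
      · intro j
        simpa [Phys.act, Phys.next, Lab.start, Lab.next] using hT.cells j
      · intro j
        simpa [Phys.act, Phys.next, Lab.start, Lab.next, Move.offset] using hT.head j
    | inr r =>
      refine ⟨_, 1, by omega, ?_, .step (.refl _ _)⟩
      constructor
      · intro k
        simpa [Phys.act, Phys.next, Lab.start, Lab.next, Move.offset] using hT.inp k
      · intro j
        simp only [Phys.act, Phys.next, Lab.start, Lab.next]
        by_cases hj : j.val = r
        · subst hj
          simp only [true_and, Function.update_self, hT.head j, hT.cells j, wordTape_top]
          cases hS : S (.inr j) with
          | nil =>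
            simp [wordTape]
          | cons b w => simpa using update_wordTape_pop b w
        · rw [Function.update_of_ne (by simpa using hj)]
          simp [hj, hT.cells j]
      · intro j
        simp only [Phys.act, Phys.next, Lab.start, Lab.next]
        by_cases hj : j.val = r
        · subst hj
          simp only [true_and, Function.update_self, hT.head j, hT.cells j, wordTape_top]
          cases hS : S (.inr j) with
          | nil => simp [Move.offset]
          | cons b w => simp [Move.offset]; ring
        · rw [Function.update_of_ne (by simpa using hj)]
          simp [hj, hT.head j, Move.offset]
  | @seq c d S S₁ S₂ t₁ t₂ t h₁ h₂ ht ih₁ ih₂ =>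
    simp only [Cmd.bound, max_le_iff] at hc
    obtain ⟨T₁, k₁, hk₁, hT₁, r₁⟩ := ih₁ hc.1 hT
    obtain ⟨T₂, k₂, hk₂, hT₂, r₂⟩ := ih₂ hc.2 hT₁
    refine ⟨T₂, k₁ + k₂, by omega, hT₂, ?_⟩
    have e₁ := r₁.lift (d := .seq c d) (fun o => some ((o.map .seqL).getD (.seqR (Lab.start d))))
      .seqL (fun _ => rfl) (fun _ _ => rfl)
    have e₂ := r₂.lift (d := .seq c d) (fun o => o.map .seqR) .seqR (fun _ => rfl)
      (fun _ _ => rfl)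
    exact e₁.trans e₂
  | @case_nil r c d e S S' t₁ t hr h ht ih =>
    have hcb : c.bound ≤ m ∧ ∀ j, r = .inr j → j ≤ m := by
      cases r <;> simp_all [Cmd.bound]
    obtain ⟨T', k, hk, hT', hR⟩ := ih hcb.1 hT.idle
    refine ⟨T', k + 1, by omega, hT', .step ?_⟩
    have hs := hT.regSym r hcb.2
    rw [hr] at hs
    have e₁ := hR.lift (d := .case r c d e) (fun o => o.map .case₁) .case₁ (fun _ => rfl)
      (fun _ _ => rfl)
    simp only [Phys.next, Lab.start, Lab.next, hs]
    exact e₁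
  | @case_false r c d e S S' t₁ t w hr h ht ih =>
    have hcb : d.bound ≤ m ∧ ∀ j, r = .inr j → j ≤ m := by
      cases r <;> simp_all [Cmd.bound]
    obtain ⟨T', k, hk, hT', hR⟩ := ih hcb.1 hT.idle
    refine ⟨T', k + 1, by omega, hT', .step ?_⟩
    have hs := hT.regSym r hcb.2
    rw [hr] at hs
    have e₁ := hR.lift (d := .case r c d e) (fun o => o.map .case₂) .case₂ (fun _ => rfl)
      (fun _ _ => rfl)
    simp only [Phys.next, Lab.start, Lab.next, hs]
    exact e₁
  | @case_true r c d e S S' t₁ t w hr h ht ih =>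
    have hcb : e.bound ≤ m ∧ ∀ j, r = .inr j → j ≤ m := by
      cases r <;> simp_all [Cmd.bound]
    obtain ⟨T', k, hk, hT', hR⟩ := ih hcb.1 hT.idle
    refine ⟨T', k + 1, by omega, hT', .step ?_⟩
    have hs := hT.regSym r hcb.2
    rw [hr] at hs
    have e₁ := hR.lift (d := .case r c d e) (fun o => o.map .case₃) .case₃ (fun _ => rfl)
      (fun _ _ => rfl)
    simp only [Phys.next, Lab.start, Lab.next, hs]
    exact e₁
  | @loop_nil r c S t hr ht =>
    have hcb : ∀ j, r = .inr j → j ≤ m := by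
      cases r <;> simp_all [Cmd.bound]
    refine ⟨_, 1, by omega, hT.idle, .step ?_⟩
    have hs := hT.regSym r hcb
    rw [hr] at hs
    simp only [Phys.next, Lab.start, Lab.next, hs]
    exact .refl _ _
  | @loop_cons r c S S₁ S₂ t₁ t₂ t hr h₁ h₂ ht ih₁ ih₂ =>
    have hcb : c.bound ≤ m ∧ ∀ j, r = .inr j → j ≤ m := by
      cases r <;> simp_all [Cmd.bound]
    obtain ⟨T₁, k₁, hk₁, hT₁, r₁⟩ := ih₁ hcb.1 hT.idle
    obtain ⟨T₂, k₂, hk₂, hT₂, r₂⟩ := ih₂ hc hT₁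
    refine ⟨T₂, (k₁ + k₂) + 1, by omega, hT₂, .step ?_⟩
    have hs := hT.regSym r hcb.2
    obtain ⟨b, w, hbw⟩ := List.exists_cons_of_ne_nil hr
    rw [hbw] at hs
    have e₁ := r₁.lift (d := .loop r c) (fun o => some ((o.map .loop₁).getD .loop₀)) .loop₁
      (fun _ => rfl) (fun _ _ => rfl)
    simp only [Phys.next, Lab.start, Lab.next, hs]
    exact e₁.trans r₂

/-- The Turing machine of a program; its first step moves the heads of the work tapes to
cell `-1`. -/
def Cmd.toTM (c : Cmd n) (m : ℕ) : TM n where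
  State := Unit ⊕ Option (Lab c)
  finite := by have := Lab.finite c; infer_instance
  start := .inl ()
  work := m
  δ
    | .inl _, _, w => some (.inr (some (Lab.start c)), fun _ => .stay, fun j => (w j, .left))
    | .inr none, _, _ => none
    | .inr (some l), u, w => some (.inr (Lab.next u w c l).1, (Lab.next u w c l).2)

def Phys.toCfg (c : Cmd n) (o : Option (Lab c)) (T : Phys n m) : (c.toTM m).Cfg :=
  ⟨.inr o, T.inHead, T.cells, T.head⟩

theorem Reach.iterate {inp : Fin n → ℤ → Option Bool} {c : Cmd n} {y z : Option (Lab c)}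
    {T T' : Phys n m} {k : ℕ} (h : Reach inp c y T z T' k) :
    (fun d => ((c.toTM m).step inp d).getD d)^[k] (T.toCfg c y) = T'.toCfg c z := by
  induction h with
  | refl => rfl
  | step _ ih => rw [Function.iterate_succ_apply]; exact ih

end Compile

section Run

variable {n : ℕ}

theorem TM.run_succ (M : TM n) (inp : Fin n → ℤ → Option Bool) (t : ℕ) :
    M.run inp (t + 1) = (M.step inp (M.run inp t)).getD (M.run inp t) :=
  Function.iterate_succ_apply' _ _ _

theorem TM.run_of_halted (M : TM n) (inp : Fin n → ℤ → Option Bool) {t t' : ℕ}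
    (h : M.step inp (M.run inp t) = none) (ht : t ≤ t') : M.run inp t' = M.run inp t := by
  obtain ⟨k, rfl⟩ := Nat.exists_eq_add_of_le ht
  clear ht
  induction k with
  | zero => rfl
  | succ k ih => rw [← add_assoc, TM.run_succ, ih, h]; rfl

theorem TM.OutputsWithin.mono {M : TM n} {inp : Fin n → ℤ → Option Bool} {y : Word} {t t' : ℕ}
    (h : M.OutputsWithin inp y t) (ht : t ≤ t') : M.OutputsWithin inp y t' := by
  unfold TM.OutputsWithin at *
  rwa [M.run_of_halted inp h.1 ht]

theorem TM.Cfg.output_eq {M : TM n} (d : M.Cfg) (w : Word)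
    (h : ∀ i < w.length, d.cells 0 i = w[i]?) (h' : d.cells 0 w.length = none) :
    d.output = w := by
  have h2 : sInf {i : ℕ | d.cells 0 i = none} = w.length := by
    apply le_antisymm
    · exact Nat.sInf_le h'
    · refine le_csInf ⟨_, h'⟩ fun b hb => ?_
      by_contra! hlt
      have := h b hlt
      rw [hb, List.getElem?_eq_getElem hlt] at this
      simp at this
  -- In `output` the list of cell numbers is coerced to integers through the monad structure of
  -- lists; `h3` turns this into a `map`.
  have h3 : ∀ l : List ℕ, (do let a ← l; pure (a : ℤ)) = l.map Nat.cast := fun l => by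
    simp [bind, pure, List.map_eq_flatMap]
  unfold TM.Cfg.output
  rw [h2, h3, List.map_map]
  apply List.ext_getElem
  · simp
  · intro i h1 h4
    simp only [List.getElem_map, List.getElem_range, Function.comp_apply, h i h4,
      List.getElem?_eq_getElem h4]
    cases w[i] <;> rfl

theorem TM.Cfg.output_of_wordTape {M : TM n} (d : M.Cfg) (w : Word) (h : d.cells 0 = wordTape w) :
    d.output = w :=
  d.output_eq w (fun i _ => by rw [h, wordTape_natCast]) (by rw [h, wordTape_natCast]; simp)

/-- Register `0` is the output tape and has its top at the right end, whence the reversal. The extra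
step puts the heads on cell `-1`. -/
theorem exec_outputsWithin {x : Fin n → Word} {c : Cmd n} {S : Store n} {t : ℕ}
    (h : Exec c (Sum.elim x fun _ => []) S t) :
    (c.toTM c.bound).OutputsWithin (fun i => wordTape (x i)) (S (.inr 0)).reverse
      (2 * t + 1) := by
  have hinit : Represents x (Sum.elim x fun _ => []) (n := n) (m := c.bound)
      ⟨fun _ => 0, fun _ _ => none, fun _ => -1⟩ := by
    refine ⟨fun i => ⟨0, rfl, rfl⟩, fun j => ?_, fun j => rfl⟩
    funext i; simp [wordTape]
  obtain ⟨T', k, hk, hT', hR⟩ := exec_reach h le_rfl hinit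
  have hrun : (c.toTM c.bound).run (fun i => wordTape (x i)) (k + 1) = T'.toCfg c none := by
    rw [← hR.iterate]
    unfold TM.run
    rw [Function.iterate_succ_apply]
    congr 1
    simp [TM.step, TM.init, Cmd.toTM, Phys.toCfg, Move.offset]
  refine TM.OutputsWithin.mono (t := k + 1) ⟨?_, ?_⟩ (by omega)
  · rw [hrun]; rfl
  · rw [hrun]
    exact TM.Cfg.output_of_wordTape _ _ (hT'.cells 0)

end Run

/-! ## Basic programs -/

theorem eval_mono_nat (q : Polynomial ℕ) {a b : ℕ} (h : a ≤ b) : q.eval a ≤ q.eval b := by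
  rw [Polynomial.eval_eq_sum, Polynomial.eval_eq_sum]
  exact Finset.sum_le_sum fun i _ => Nat.mul_le_mul_left _ (Nat.pow_le_pow_left h i)

section Programs

variable {n : ℕ}

def Cmd.seqN (c : ℕ → Cmd n) : ℕ → Cmd n
  | 0 => .skip
  | k + 1 => .seq (Cmd.seqN c k) (c k)

theorem exec_seqN {c : ℕ → Cmd n} {T : ℕ → Store n} {t : ℕ → ℕ} {k : ℕ}
    (h : ∀ i < k, Exec (c i) (T i) (T (i + 1)) (t i)) :
    Exec (Cmd.seqN c k) (T 0) (T k) (1 + ∑ i ∈ Finset.range k, t i) := by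
  induction k with
  | zero => exact .skip (by simp)
  | succ k ih =>
    rw [Finset.sum_range_succ]
    exact .seq (ih fun i hi => h i (by omega)) (h k (by omega)) (by omega)

/-- The family `T` is the loop invariant, indexed by the number of completed rounds. -/
theorem exec_loop {r : Reg n} {c : Cmd n} {T : ℕ → Store n} {k t : ℕ}
    (h0 : ∀ i < k, T i r ≠ []) (hk : T k r = [])
    (h : ∀ i < k, Exec c (T i) (T (i + 1)) t) :
    Exec (.loop r c) (T 0) (T k) (k * (t + 1) + 1) := by
  induction k generalizing T with
  | zero => exact .loop_nil hk (by simp)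
  | succ k ih =>
    refine .loop_cons (h0 0 (by omega)) (h 0 (by omega))
      (ih (T := fun i => T (i + 1)) (fun i hi => h0 _ (by omega)) hk
        (fun i hi => h _ (by omega))) ?_
    ring_nf; omega

def Cmd.clear (r : ℕ) : Cmd n := .loop (.inr r) (.pop (.inr r))

theorem exec_clear (r : ℕ) (S : Store n) :
    Exec (Cmd.clear r) S (Function.update S (.inr r) []) (2 * (S (.inr r)).length + 1) := by
  have := exec_loop (r := .inr r) (c := .pop (.inr r)) (k := (S (.inr r)).length) (t := 1)
    (T := fun i => Function.update S (.inr r) ((S (.inr r)).drop i)) (n := n)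
    (fun i hi => by simpa using hi) (by simp) (fun i hi => (Exec.pop le_rfl).of_eq (by simp))
  simp only [List.drop_zero, Function.update_eq_self, List.drop_length] at this
  exact this.mono (by omega)

/-- Moves the word in register `r` to register `o`, which reverses it. -/
def Cmd.moveRev (r : Reg n) (o : ℕ) : Cmd n :=
  .loop r (.case r .skip (.seq (.push o false) (.pop r)) (.seq (.push o true) (.pop r)))

theorem exec_moveRev {r : Reg n} {o : ℕ} (h : r ≠ .inr o) (S : Store n) :
    Exec (Cmd.moveRev r o) S
      (Function.update (Function.update S r []) (.inr o) ((S r).reverse ++ S (.inr o)))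
      (4 * (S r).length + 1) := by
  have := exec_loop (r := r)
    (c := .case r .skip (.seq (.push o false) (.pop r)) (.seq (.push o true) (.pop r)))
    (k := (S r).length) (t := 3)
    (T := fun i => Function.update (Function.update S r ((S r).drop i)) (.inr o)
      (((S r).take i).reverse ++ S (.inr o)))
    (fun i hi => by rw [Function.update_of_ne h]; simpa using hi)
    (by rw [Function.update_of_ne h]; simp)
    (fun i hi => by
      have hr : Function.update (Function.update S r ((S r).drop i)) (.inr o)
          (((S r).take i).reverse ++ S (.inr o)) r = (S r)[i] :: (S r).drop (i + 1) := by
        rw [Function.update_of_ne h]; simp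
      have ht : ((S r).take (i + 1)).reverse = (S r)[i] :: ((S r).take i).reverse := by
        rw [List.take_succ_eq_append_getElem hi]; simp
      cases hb : (S r)[i] with
      | false =>
        rw [hb] at hr ht
        refine .case_false hr ((Exec.seq (.push le_rfl) (.pop le_rfl) le_rfl).of_eq ?_) le_rfl
        funext s
        by_cases h1 : s = r
        · subst h1
          simp only [Function.update_of_ne h, Function.update_self]; simp
        · by_cases h2 : s = .inr o
          · subst h2; simp [h1, ht]
          · simp [h1, h2]
      | true =>
        rw [hb] at hr ht
        refine .case_true hr ((Exec.seq (.push le_rfl) (.pop le_rfl) le_rfl).of_eq ?_) le_rfl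
        funext s
        by_cases h1 : s = r
        · subst h1
          simp only [Function.update_of_ne h, Function.update_self]; simp
        · by_cases h2 : s = .inr o
          · subst h2; simp [h1, ht]
          · simp [h1, h2])
  simp only [List.drop_zero, Function.update_eq_self, List.drop_length, List.take_zero,
    List.reverse_nil, List.nil_append, List.take_length] at this
  exact this.mono (by omega)

/-- Moves the word in register `r` to the registers `a` and `o`, which reverses it. -/
def Cmd.moveRev₂ (r : Reg n) (a o : ℕ) : Cmd n :=
  .loop r (.case r .skip (.seq (.push a false) (.seq (.push o false) (.pop r)))
    (.seq (.push a true) (.seq (.push o true) (.pop r))))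

theorem exec_moveRev₂ {r : Reg n} {a o : ℕ} (h : r ≠ .inr o) (h' : r ≠ .inr a) (hao : a ≠ o)
    (S : Store n) :
    Exec (Cmd.moveRev₂ r a o) S
      (Function.update (Function.update (Function.update S r []) (.inr a)
        ((S r).reverse ++ S (.inr a))) (.inr o) ((S r).reverse ++ S (.inr o)))
      (5 * (S r).length + 1) := by
  have hao' : (.inr a : Reg n) ≠ .inr o := by simpa using hao
  have := exec_loop (r := r)
    (c := .case r .skip (.seq (.push a false) (.seq (.push o false) (.pop r)))
      (.seq (.push a true) (.seq (.push o true) (.pop r))))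
    (k := (S r).length) (t := 4)
    (T := fun i => Function.update (Function.update (Function.update S r ((S r).drop i)) (.inr a)
      (((S r).take i).reverse ++ S (.inr a))) (.inr o) (((S r).take i).reverse ++ S (.inr o)))
    (fun i hi => by rw [Function.update_of_ne h, Function.update_of_ne h']; simpa using hi)
    (by rw [Function.update_of_ne h, Function.update_of_ne h']; simp)
    (fun i hi => by
      have ht : ((S r).take (i + 1)).reverse = (S r)[i] :: ((S r).take i).reverse := by
        rw [List.take_succ_eq_append_getElem hi]; simp
      have hr : Function.update (Function.update (Function.update S r ((S r).drop i)) (.inr a)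
          (((S r).take i).reverse ++ S (.inr a))) (.inr o)
          (((S r).take i).reverse ++ S (.inr o)) r = (S r)[i] :: (S r).drop (i + 1) := by
        rw [Function.update_of_ne h, Function.update_of_ne h']; simp
      cases hb : (S r)[i] with
      | false =>
        rw [hb] at hr ht
        refine .case_false hr ((Exec.seq (.push le_rfl) (.seq (.push le_rfl) (.pop le_rfl) le_rfl)
          le_rfl).of_eq ?_) le_rfl
        funext s
        by_cases h1 : s = r
        · subst h1
          simp only [Function.update_of_ne h, Function.update_of_ne h', Function.update_self]; simp
        · by_cases h2 : s = .inr o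
          · subst h2; simp [h1, ht, hao'.symm]
          · by_cases h3 : s = .inr a
            · subst h3; simp [h1, h2, ht]
            · simp [h1, h2, h3]
      | true =>
        rw [hb] at hr ht
        refine .case_true hr ((Exec.seq (.push le_rfl) (.seq (.push le_rfl) (.pop le_rfl) le_rfl)
          le_rfl).of_eq ?_) le_rfl
        funext s
        by_cases h1 : s = r
        · subst h1
          simp only [Function.update_of_ne h, Function.update_of_ne h', Function.update_self]; simp
        · by_cases h2 : s = .inr o
          · subst h2; simp [h1, ht, hao'.symm]
          · by_cases h3 : s = .inr a
            · subst h3; simp [h1, h2, ht]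
            · simp [h1, h2, h3])
  simp only [List.drop_zero, Function.update_eq_self, List.drop_length, List.take_zero,
    List.reverse_nil, List.nil_append, List.take_length] at this
  exact this.mono (by omega)

/-- Copies register `a` to register `o`, using the auxiliary register `b`. -/
def Cmd.copy (a o b : ℕ) : Cmd n := .seq (.moveRev (.inr a) b) (.moveRev₂ (.inr b) a o)

/-- Moving a stack reverses it. The word goes to `b` and back, and the second move refills `a` and
fills `o` at the same time. -/
theorem exec_copy {a o b : ℕ} (hao : a ≠ o) (hab : a ≠ b) (hob : o ≠ b) (S : Store n)
    (hb : S (.inr b) = []) (ho : S (.inr o) = []) :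
    Exec (Cmd.copy a o b) S (Function.update S (.inr o) (S (.inr a)))
      (9 * (S (.inr a)).length + 2) := by
  refine (Exec.seq (exec_moveRev (by simpa using hab) S)
    (exec_moveRev₂ (by simpa using hob.symm) (by simpa using hab.symm) hao _) le_rfl).of_eq ?_
    |>.mono ?_
  · funext s
    by_cases h1 : s = .inr o
    · subst h1; simp [ho, hb, hob, hao.symm]
    · by_cases h2 : s = .inr a
      · subst h2; simp [h1, hb, hab]
      · by_cases h3 : s = .inr b
        · subst h3; simp [h1, h2, hb]
        · simp [h1, h2, h3]
  · simp [hb]; omega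

/-- Writes `w 0, …, w (m - 1)` to the registers `d, …, d + m - 1`. -/
def Store.setBlock (S : Store n) (d m : ℕ) (w : ℕ → Word) : Store n
  | .inl i => S (.inl i)
  | .inr j => if d ≤ j ∧ j < d + m then w (j - d) else S (.inr j)

theorem Store.setBlock_zero (S : Store n) (d : ℕ) (w : ℕ → Word) : S.setBlock d 0 w = S := by
  funext s
  cases s with
  | inl i => rfl
  | inr j => simp only [Store.setBlock]; rw [if_neg (by omega)]

theorem Store.setBlock_succ (S : Store n) (d m : ℕ) (w : ℕ → Word) :
    S.setBlock d (m + 1) w = Function.update (S.setBlock d m w) (.inr (d + m)) (w m) := by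
  funext s
  cases s with
  | inl i => simp [Store.setBlock]
  | inr j =>
    by_cases h : j = d + m
    · subst h; simp [Store.setBlock]
    · rw [Function.update_of_ne (by simpa using h)]
      simp only [Store.setBlock]
      by_cases h2 : d ≤ j ∧ j < d + m
      · rw [if_pos h2, if_pos (by omega)]
      · rw [if_neg h2, if_neg (by omega)]

theorem Store.setBlock_of_lt (S : Store n) {d m j : ℕ} (w : ℕ → Word) (h : j < d) :
    S.setBlock d m w (.inr j) = S (.inr j) := by
  simp only [Store.setBlock]; rw [if_neg (by omega)]

theorem Store.setBlock_of_ge (S : Store n) {d m j : ℕ} (w : ℕ → Word) (h : d + m ≤ j) :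
    S.setBlock d m w (.inr j) = S (.inr j) := by
  simp only [Store.setBlock]; rw [if_neg (by omega)]

theorem Store.setBlock_add (S : Store n) {d m i : ℕ} (w : ℕ → Word) (h : i < m) :
    S.setBlock d m w (.inr (d + i)) = w i := by
  simp only [Store.setBlock]; rw [if_pos (by omega), Nat.add_sub_cancel_left]

theorem exec_clearBlock (d m : ℕ) (S : Store n) :
    Exec (Cmd.seqN (fun i => Cmd.clear (d + i)) m) S (S.setBlock d m fun _ => [])
      (1 + ∑ i ∈ Finset.range m, (2 * (S (.inr (d + i))).length + 1)) := by
  have := exec_seqN (n := n) (c := fun i => Cmd.clear (d + i)) (k := m)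
    (T := fun i => S.setBlock d i fun _ => [])
    (t := fun i => 2 * (S (.inr (d + i))).length + 1) (fun i _ => by
      have := exec_clear (d + i) (S.setBlock d i fun _ => [])
      rw [S.setBlock_of_ge _ le_rfl] at this
      exact this.of_eq (S.setBlock_succ _ _ _).symm)
  rwa [S.setBlock_zero] at this

theorem exec_copyBlock {e d b m : ℕ} (h : e + m ≤ d ∨ d + m ≤ e) (hb : e + m ≤ b) (hb' : d + m ≤ b)
    (S : Store n) (hS : ∀ i < m, S (.inr (d + i)) = []) (hSb : S (.inr b) = []) :
    Exec (Cmd.seqN (fun i => Cmd.copy (e + i) (d + i) b) m) S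
      (S.setBlock d m fun i => S (.inr (e + i)))
      (1 + ∑ i ∈ Finset.range m, (9 * (S (.inr (e + i))).length + 2)) := by
  have := exec_seqN (n := n) (c := fun i => Cmd.copy (e + i) (d + i) b) (k := m)
    (T := fun i => S.setBlock d i fun i => S (.inr (e + i)))
    (t := fun i => 9 * (S (.inr (e + i))).length + 2) (fun i hi => by
      have he : S.setBlock d i (fun i => S (.inr (e + i))) (.inr (e + i)) = S (.inr (e + i)) := by
        rcases h with h | h
        · exact S.setBlock_of_lt _ (by omega)
        · exact S.setBlock_of_ge _ (by omega)
      have := exec_copy (a := e + i) (o := d + i) (b := b) (by omega) (by omega) (by omega)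
        (S.setBlock d i fun i => S (.inr (e + i)))
        (by rw [S.setBlock_of_ge _ (by omega), hSb])
        (by rw [S.setBlock_of_ge _ le_rfl, hS i hi])
      rw [he] at this
      exact this.of_eq (S.setBlock_succ _ _ _).symm)
  rwa [S.setBlock_zero] at this

end Programs

/-! ## Polynomial-time functions of words -/

/-- The total length of a family of words. -/
def size {ι : Type} [Fintype ι] (v : ι → Word) : ℕ := ∑ i, (v i).length

theorem length_le_size {ι : Type} [Fintype ι] (v : ι → Word) (i : ι) : (v i).length ≤ size v :=
  Finset.single_le_sum (f := fun i => (v i).length) (fun _ _ => Nat.zero_le _) (Finset.mem_univ i)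

/-- `f` is computed in polynomial time by programs that read the registers `a i`, write the
register `o`, and use the registers from `b` on as auxiliary space. -/
def FP {ι : Type} [Fintype ι] (f : (ι → Word) → Word) : Prop :=
  ∃ q : Polynomial ℕ, ∀ (n : ℕ) (a : ι → ℕ) (o b : ℕ), (∀ i, a i < b) → o < b → (∀ i, a i ≠ o) →
    ∃ c : Cmd n, ∀ S : Store n, S (.inr o) = [] → (∀ r, b ≤ r → S (.inr r) = []) →
      Exec c S (Function.update S (.inr o) (f fun i => S (.inr (a i))))
        (q.eval (size fun i => S (.inr (a i))))

/-! ### Closure of `FP` under composition and bounded iteration -/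

section FP

variable {ι : Type} [Fintype ι] {f g : (ι → Word) → Word}

/-- A result is no longer than the time spent on writing it. To apply `Exec.length_le`, the program
is placed on a concrete store with the arguments in the first registers and the result in the next
one. -/
theorem FP.length_le (hf : FP f) : ∃ q : Polynomial ℕ, ∀ v, (f v).length ≤ q.eval (size v) := by
  obtain ⟨q, hq⟩ := hf
  refine ⟨q, fun v => ?_⟩
  let e := Fintype.equivFin ι
  obtain ⟨c, hc⟩ := hq 0 (fun i => e i) (Fintype.card ι) (Fintype.card ι + 1)
    (fun i => by have := (e i).2; omega) (by omega) (fun i => (e i).2.ne)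
  let S : Store 0 := fun r => r.elim (fun _ => []) fun j =>
    if h : j < Fintype.card ι then v (e.symm ⟨j, h⟩) else []
  have hS : (fun i => S (.inr (e i : ℕ))) = v := by
    funext i
    simp [S, (e i).2]
  have := (hc S (by simp [S]) (fun r hr => by simp [S]; omega)).length_le (.inr (Fintype.card ι))
  rw [hS] at this
  simpa [S] using this

theorem FP.proj (i : ι) : FP fun v : ι → Word => v i := by
  refine ⟨9 * .X + 2, fun n a o b ha ho hao => ⟨Cmd.copy (a i) o b, fun S hSo hSb => ?_⟩⟩
  refine (exec_copy (hao i) (ha i).ne ho.ne S (hSb b le_rfl) hSo).mono ?_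
  have := length_le_size (fun i => S (.inr (a i))) i
  simp only [Polynomial.eval_add, Polynomial.eval_mul, Polynomial.eval_X, Polynomial.eval_ofNat]
  omega

theorem FP.nil : FP fun _ : ι → Word => [] :=
  ⟨1, fun n a o b ha ho hao => ⟨.skip, fun S hSo hSb => (Exec.skip (by simp)).of_eq (by
    rw [← hSo, Function.update_eq_self])⟩⟩

theorem FP.cons (b : Bool) (hf : FP f) : FP fun v => b :: f v := by
  obtain ⟨q, hq⟩ := hf
  refine ⟨q + 1, fun n a o d ha ho hao => ?_⟩
  obtain ⟨c, hc⟩ := hq n a o d ha ho hao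
  refine ⟨.seq c (.push o b), fun S hSo hSb => ?_⟩
  exact (Exec.seq (hc S hSo hSb) (.push le_rfl) (by simp)).of_eq (by simp)

theorem FP.tail (hf : FP f) : FP fun v => (f v).tail := by
  obtain ⟨q, hq⟩ := hf
  refine ⟨q + 1, fun n a o d ha ho hao => ?_⟩
  obtain ⟨c, hc⟩ := hq n a o d ha ho hao
  refine ⟨.seq c (.pop (.inr o)), fun S hSo hSb => ?_⟩
  exact (Exec.seq (hc S hSo hSb) (.pop le_rfl) (by simp)).of_eq (by simp)

/-- Case distinction on the first bit of a word. -/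
def caseHead {α : Type*} (w : Word) (x y z : α) : α :=
  match w with
  | [] => x
  | false :: _ => y
  | true :: _ => z

theorem FP.caseHead {g₀ g₁ g₂ : (ι → Word) → Word} (hf : FP f) (h₀ : FP g₀) (h₁ : FP g₁)
    (h₂ : FP g₂) : FP fun v => caseHead (f v) (g₀ v) (g₁ v) (g₂ v) := by
  obtain ⟨q, hq⟩ := hf
  obtain ⟨q₀, hq₀⟩ := h₀
  obtain ⟨q₁, hq₁⟩ := h₁
  obtain ⟨q₂, hq₂⟩ := h₂
  -- Time `q` evaluates the word that decides the case, and `2 * q + 1` clears it from the auxiliary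
  -- register `d`; the branch test takes one more step.
  refine ⟨3 * q + q₀ + q₁ + q₂ + 2, fun n a o d ha ho hao => ?_⟩
  obtain ⟨c, hc⟩ := hq n a d (d + 1) (fun i => (ha i).trans (by omega)) (by omega)
    (fun i => (ha i).ne)
  obtain ⟨c₀, hc₀⟩ := hq₀ n a o (d + 1) (fun i => (ha i).trans (by omega)) (by omega) hao
  obtain ⟨c₁, hc₁⟩ := hq₁ n a o (d + 1) (fun i => (ha i).trans (by omega)) (by omega) hao
  obtain ⟨c₂, hc₂⟩ := hq₂ n a o (d + 1) (fun i => (ha i).trans (by omega)) (by omega) hao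
  refine ⟨.seq c (.seq (.case (.inr d) c₀ c₁ c₂) (.clear d)), fun S hSo hSb => ?_⟩
  have e := hc S (hSb d le_rfl) (fun r hr => hSb r (by omega))
  have hlen := e.length_le (.inr d)
  rw [hSb d le_rfl] at hlen
  simp only [Function.update_self, List.length_nil, zero_add] at hlen
  set v : ι → Word := fun i => S (.inr (a i)) with hv
  set S₁ : Store n := Function.update S (.inr d) (f v) with hS₁
  have hv₁ : (fun i => S₁ (.inr (a i))) = v := by
    funext i
    rw [hS₁, Function.update_of_ne (by simpa using (ha i).ne)]
  have hS₁o : S₁ (.inr o) = [] := by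
    rw [hS₁, Function.update_of_ne (by simpa using ho.ne)]; exact hSo
  have hS₁b : ∀ r, d + 1 ≤ r → S₁ (.inr r) = [] := fun r hr => by
    rw [hS₁, Function.update_of_ne (by simp; omega)]; exact hSb r (by omega)
  have hd : S₁ (.inr d) = f v := by simp [hS₁]
  have e₂ : Exec (.case (.inr d) c₀ c₁ c₂) S₁
      (Function.update S₁ (.inr o) (PolyEst.caseHead (f v) (g₀ v) (g₁ v) (g₂ v)))
      ((q₀ + q₁ + q₂).eval (size v) + 1) := by
    have k₀ := hc₀ S₁ hS₁o hS₁b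
    have k₁ := hc₁ S₁ hS₁o hS₁b
    have k₂ := hc₂ S₁ hS₁o hS₁b
    rw [hv₁] at k₀ k₁ k₂
    simp only [Polynomial.eval_add]
    rcases hfv : f v with _ | ⟨_ | _, w⟩
    · exact .case_nil (hd.trans hfv) k₀ (by omega)
    · exact .case_false (hd.trans hfv) k₁ (by omega)
    · exact .case_true (hd.trans hfv) k₂ (by omega)
  refine ((e.seq (e₂.seq (exec_clear d _) le_rfl) le_rfl).of_eq ?_).mono ?_
  · funext s
    by_cases h1 : s = .inr d
    · subst h1
      have : (.inr d : Reg n) ≠ .inr o := by simpa using ho.ne'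
      simp [this, hSb d le_rfl]
    · by_cases h2 : s = .inr o
      · subst h2; simp [h1]
      · simp [h1, h2, hS₁]
  · rw [Function.update_of_ne (by simpa using ho.ne'), hd]
    simp only [Polynomial.eval_add, Polynomial.eval_mul, Polynomial.eval_ofNat]
    omega

/-- Extension of a finite family of words by the empty word. -/
def extendFin {m : ℕ} (w : Fin m → Word) (j : ℕ) : Word := if h : j < m then w ⟨j, h⟩ else []

/-- Evaluation of finitely many functions into a block of registers. -/
theorem exec_evalBlock {m : ℕ} {f : Fin m → (ι → Word) → Word} (hf : ∀ k, FP (f k)) :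
    ∃ q : Polynomial ℕ, ∀ (n : ℕ) (a : ι → ℕ) (d : ℕ), (∀ i, a i < d) →
      ∃ c : Cmd n, ∀ S : Store n, (∀ r, d ≤ r → S (.inr r) = []) →
        Exec c S (S.setBlock d m (extendFin fun k => f k fun i => S (.inr (a i))))
          (q.eval (size fun i => S (.inr (a i)))) := by
  choose q hq using hf
  refine ⟨1 + ∑ k, q k, fun n a d ha => ?_⟩
  have := fun k : Fin m => hq k n a (d + k) (d + m) (fun i => (ha i).trans_le (by omega))
    (by omega) (fun i => by have := ha i; omega)
  choose c hc using this
  refine ⟨Cmd.seqN (fun i => if h : i < m then c ⟨i, h⟩ else .skip) m, fun S hS => ?_⟩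
  have := exec_seqN (n := n) (c := fun i => if h : i < m then c ⟨i, h⟩ else .skip) (k := m)
    (T := fun i => S.setBlock d i (extendFin fun k => f k fun i => S (.inr (a i))))
    (t := fun i => if h : i < m then (q ⟨i, h⟩).eval (size fun i => S (.inr (a i))) else 0)
    (fun i hi => by
      have := hc ⟨i, hi⟩ (S.setBlock d i (extendFin fun k => f k fun i => S (.inr (a i))))
        (by rw [S.setBlock_of_ge _ le_rfl]; exact hS _ (by simp))
        (fun r hr => by rw [S.setBlock_of_ge _ (by omega)]; exact hS _ (by omega))
      have ha' : (fun j => S.setBlock d i (extendFin fun k => f k fun i => S (.inr (a i)))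
          (.inr (a j))) = fun j => S (.inr (a j)) := by
        funext j
        exact S.setBlock_of_lt _ (ha j)
      rw [ha'] at this
      simp only [hi, dite_true]
      refine this.of_eq ?_
      rw [S.setBlock_succ]
      simp [extendFin, hi])
  rw [S.setBlock_zero] at this
  refine this.mono (le_of_eq ?_)
  rw [Finset.sum_range, Polynomial.eval_add, Polynomial.eval_finsetSum]
  simp

/-- The inner values go to a block of registers that starts at `b`. None of them is longer than the
time `q` used to compute them, so the outer program runs on arguments of total size at most `m * q`;
the block is cleared afterwards. -/
theorem FP.comp_fin {m : ℕ} {g : (Fin m → Word) → Word} {f : Fin m → (ι → Word) → Word}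
    (hg : FP g) (hf : ∀ k, FP (f k)) : FP fun v => g fun k => f k v := by
  obtain ⟨p, hp⟩ := hg
  obtain ⟨q, hq⟩ := exec_evalBlock hf
  refine ⟨q + p.comp ((m : Polynomial ℕ) * q) + 1 + (m : Polynomial ℕ) * (2 * q + 1),
    fun n a o b ha ho hao => ?_⟩
  obtain ⟨c₁, hc₁⟩ := hq n a b ha
  obtain ⟨c₂, hc₂⟩ := hp n (fun k : Fin m => b + k) o (b + m) (fun k => by omega) (by omega)
    (fun k => by omega)
  refine ⟨.seq c₁ (.seq c₂ (Cmd.seqN (fun i => Cmd.clear (b + i)) m)), fun S hSo hSb => ?_⟩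
  have e₁ := hc₁ S hSb
  set v : ι → Word := fun i => S (.inr (a i)) with hv
  set w : Fin m → Word := fun k => f k v with hw
  have hwl : ∀ k : Fin m, (w k).length ≤ q.eval (size v) := fun k => by
    have := e₁.length_le (.inr (b + k))
    rw [S.setBlock_add _ k.2, hSb _ (by omega)] at this
    simpa [extendFin] using this
  have hwk : (fun k : Fin m => S.setBlock b m (extendFin w) (.inr (b + k))) = w := by
    funext k
    rw [S.setBlock_add _ k.2]
    simp [extendFin]
  have e₂ := hc₂ (S.setBlock b m (extendFin w)) (by rw [S.setBlock_of_lt _ ho, hSo])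
    (fun r hr => by rw [S.setBlock_of_ge _ hr]; exact hSb r (by omega))
  rw [hwk] at e₂
  refine ((e₁.seq (e₂.seq (exec_clearBlock b m _) le_rfl) le_rfl).of_eq ?_).mono ?_
  · funext s
    rcases s with i | j
    · simp [Store.setBlock]
    · by_cases h1 : j = o
      · subst h1; rw [Store.setBlock_of_lt _ _ ho]; simp [hw]
      · by_cases h2 : b ≤ j ∧ j < b + m
        · simp [Store.setBlock, h2, h1, hSb j h2.1]
        · simp [Store.setBlock, h2, h1]
  · have h1 : size w ≤ m * q.eval (size v) := by
      refine (Finset.sum_le_card_nsmul _ _ _ fun k _ => hwl k).trans ?_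
      simp
    have h2 : ∑ i ∈ Finset.range m, (2 * (Function.update (S.setBlock b m (extendFin w)) (.inr o)
        (g w) (.inr (b + i))).length + 1) ≤ m * (2 * q.eval (size v) + 1) := by
      refine (Finset.sum_le_card_nsmul _ _ (2 * q.eval (size v) + 1) fun i hi => ?_).trans
        (by simp)
      have him : i < m := by simpa using hi
      rw [Function.update_of_ne (by simp; omega), S.setBlock_add _ him]
      have := hwl ⟨i, him⟩
      simp only [extendFin, him, dite_true]
      omega
    have h3 := eval_mono_nat p h1
    simp only [Polynomial.eval_add, Polynomial.eval_mul, Polynomial.eval_comp,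
      Polynomial.eval_natCast, Polynomial.eval_ofNat, Polynomial.eval_one, Nat.cast_id]
    omega

theorem FP.reindex {κ : Type} [Fintype κ] (e : ι ≃ κ) (hf : FP f) :
    FP fun v : κ → Word => f fun i => v (e i) := by
  obtain ⟨q, hq⟩ := hf
  refine ⟨q, fun n a o b ha ho hao => ?_⟩
  obtain ⟨c, hc⟩ := hq n (fun i => a (e i)) o b (fun i => ha _) ho (fun i => hao _)
  refine ⟨c, fun S hSo hSb => (hc S hSo hSb).mono (le_of_eq ?_)⟩
  congr 1
  exact e.sum_comp fun i => (S (.inr (a i))).length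

theorem FP.comp {κ : Type} [Fintype κ] {g : (κ → Word) → Word} {f : κ → (ι → Word) → Word}
    (hg : FP g) (hf : ∀ k, FP (f k)) : FP fun v => g fun k => f k v := by
  let e := Fintype.equivFin κ
  have := FP.comp_fin (hg.reindex e) (f := fun k => f (e.symm k)) (fun k => hf _)
  simpa using this

/-- The bound `hB` on all iterates is essential, since a polynomial-time map may double the length
in every round. Register `b` counts the rounds, the current values occupy the block from `b + 1`,
the next ones the block from `b + 1 + m`, and `b + 1 + m + m` is scratch space for copying them
back. -/
theorem FP.iterate_fin {m : ℕ} {G : Fin m → (Fin m → Word) → Word} (hG : ∀ k, FP (G k))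
    (hB : ∃ B : Polynomial ℕ, ∀ w i k,
      ((fun w k => G k w)^[i] w k).length ≤ B.eval (i + size w)) (j : Fin m) :
    FP fun v : Option (Fin m) → Word =>
      ((fun w k => G k w)^[(v none).length] fun k => v (some k)) j := by
  obtain ⟨B, hB⟩ := hB
  obtain ⟨q₁, hq₁⟩ := exec_evalBlock (f := fun (k : Fin m) (v : Option (Fin m) → Word) =>
    v (some k)) fun k => FP.proj (some k)
  obtain ⟨q₂, hq₂⟩ := exec_evalBlock hG
  let M : Polynomial ℕ := m
  refine ⟨(9 * .X + 2) + q₁ + (.X * (5 + q₂.comp (M * B) + M * (13 * B + 4)) + 1) + (9 * B + 2)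
    + (1 + M * (2 * B + 1)), fun n a o b ha ho hao => ?_⟩
  obtain ⟨c₁, hc₁⟩ := hq₁ n a (b + 1) (fun i => (ha i).trans (by omega))
  obtain ⟨c₂, hc₂⟩ := hq₂ n (fun k : Fin m => b + 1 + k) (b + 1 + m) (fun k => by omega)
  refine ⟨.seq (.copy (a none) b (b + 1)) (.seq c₁ (.seq
    (.loop (.inr b) (.seq (.pop (.inr b)) (.seq c₂
      (.seq (Cmd.seqN (fun i => Cmd.clear (b + 1 + i)) m)
      (.seq (Cmd.seqN (fun i => Cmd.copy (b + 1 + m + i) (b + 1 + i) (b + 1 + m + m)) m)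
        (Cmd.seqN (fun i => Cmd.clear (b + 1 + m + i)) m))))))
    (.seq (.copy (b + 1 + j) o (b + 1 + m)) (Cmd.seqN (fun i => Cmd.clear (b + 1 + i)) m)))),
    fun S hSo hSb => ?_⟩
  set v : Option (Fin m) → Word := fun i => S (.inr (a i)) with hv
  set step : (Fin m → Word) → Fin m → Word := fun w k => G k w with hstep
  set w : Fin m → Word := fun k => v (some k) with hw
  set N := size v with hN
  have hNw : (v none).length + size w = N := by
    rw [hN]; simp only [size]; rw [Fintype.sum_option]
  have hβ : ∀ i ≤ (v none).length, ∀ k, (step^[i] w k).length ≤ B.eval N := fun i hi k =>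
    (hB w i k).trans (eval_mono_nat _ (by omega))
  have hsz : ∀ i ≤ (v none).length, size (step^[i] w) ≤ m * B.eval N := fun i hi => by
    refine (Finset.sum_le_card_nsmul _ _ _ fun k _ => hβ i hi k).trans ?_
    simp
  have e₁ := exec_copy (a := a none) (o := b) (b := b + 1) (ha none).ne
    ((ha none).trans (by omega)).ne (by omega) S (hSb _ (by omega)) (hSb _ le_rfl)
  set S₁ : Store n := Function.update S (.inr b) (v none) with hS₁
  have hS₁v : (fun i => S₁ (.inr (a i))) = v := by
    funext i
    rw [hS₁, Function.update_of_ne (by simpa using (ha i).ne)]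
  have hS₁b : ∀ r, b + 1 ≤ r → S₁ (.inr r) = [] := fun r hr => by
    rw [hS₁, Function.update_of_ne (by simp; omega)]; exact hSb r (by omega)
  have e₂ := hc₁ S₁ hS₁b
  rw [hS₁v] at e₂
  -- The store after `i` rounds: what is left of the counter, and the `i`-th iterate.
  set T : ℕ → Store n := fun i =>
    Store.setBlock (Function.update S (.inr b) ((v none).drop i)) (b + 1) m (extendFin (step^[i] w)) with hT
  have hTb : ∀ i, T i (.inr b) = (v none).drop i := fun i => by
    simp only [hT]; rw [Store.setBlock_of_lt _ _ (by omega)]; simp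
  have hTd : ∀ i, ∀ k < m, T i (.inr (b + 1 + k)) = extendFin (step^[i] w) k := fun i k hk => by
    simp only [hT]; rw [Store.setBlock_add _ _ hk]
  have hTe : ∀ i r, b + 1 + m ≤ r → T i (.inr r) = [] := fun i r hr => by
    simp only [hT]
    rw [Store.setBlock_of_ge _ _ hr, Function.update_of_ne (by simp; omega)]
    exact hSb r (by omega)
  have hext : ∀ i ≤ (v none).length, ∀ k, (extendFin (step^[i] w) k).length ≤ B.eval N := by
    intro i hi k
    unfold extendFin
    split_ifs with h
    · exact hβ i hi _
    · simp
  have e₃ := exec_loop (n := n) (r := .inr b) (T := T) (k := (v none).length)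
    (c := (.seq (.pop (.inr b)) (.seq c₂
      (.seq (Cmd.seqN (fun i => Cmd.clear (b + 1 + i)) m)
      (.seq (Cmd.seqN (fun i => Cmd.copy (b + 1 + m + i) (b + 1 + i) (b + 1 + m + m)) m)
        (Cmd.seqN (fun i => Cmd.clear (b + 1 + m + i)) m))))))
    (t := 4 + q₂.eval (m * B.eval N) + m * (13 * B.eval N + 4))
    (fun i hi => by rw [hTb]; simpa using hi) (by rw [hTb]; simp) (fun i hi => by
      set U₁ : Store n := Function.update (T i) (.inr b) (T i (.inr b)).tail with hU₁
      have hU₁e : ∀ r, b + 1 + m ≤ r → U₁ (.inr r) = [] := fun r hr => by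
        rw [hU₁, Function.update_of_ne (by simp; omega)]; exact hTe i r hr
      have hU₁d : ∀ k < m, U₁ (.inr (b + 1 + k)) = extendFin (step^[i] w) k := fun k hk => by
        rw [hU₁, Function.update_of_ne (by simp; omega)]; exact hTd i k hk
      have k₂ := hc₂ U₁ hU₁e
      have hin : (fun k : Fin m => U₁ (.inr (b + 1 + k))) = step^[i] w := by
        funext k
        rw [hU₁d k k.2]; simp [extendFin]
      rw [hin] at k₂
      have hnext : (fun k => G k (step^[i] w)) = step^[i + 1] w := by
        rw [Function.iterate_succ_apply']
      rw [hnext] at k₂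
      set U₂ := U₁.setBlock (b + 1 + m) m (extendFin (step^[i + 1] w)) with hU₂
      have hU₂d : ∀ k < m, U₂ (.inr (b + 1 + k)) = extendFin (step^[i] w) k := fun k hk => by
        rw [hU₂, Store.setBlock_of_lt _ _ (by omega)]; exact hU₁d k hk
      have k₃ := exec_clearBlock (b + 1) m U₂
      set U₃ := U₂.setBlock (b + 1) m fun _ => [] with hU₃
      have hU₃e : ∀ k < m, U₃ (.inr (b + 1 + m + k)) = extendFin (step^[i + 1] w) k :=
        fun k hk => by
          rw [hU₃, Store.setBlock_of_ge _ _ (by omega), hU₂, Store.setBlock_add _ _ hk]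
      have k₄ := exec_copyBlock (e := b + 1 + m) (d := b + 1) (b := b + 1 + m + m) (m := m)
        (by omega) le_rfl (by omega) U₃
        (fun i hi => by rw [hU₃, Store.setBlock_add _ _ hi])
        (by rw [hU₃, Store.setBlock_of_ge _ _ (by omega), hU₂, Store.setBlock_of_ge _ _ le_rfl,
              hU₁e _ (by omega)])
      set U₄ := U₃.setBlock (b + 1) m fun i => U₃ (.inr (b + 1 + m + i)) with hU₄
      have hU₄e : ∀ k < m, U₄ (.inr (b + 1 + m + k)) = extendFin (step^[i + 1] w) k :=
        fun k hk => by
          rw [hU₄, Store.setBlock_of_ge _ _ (by omega), hU₃e k hk]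
      have k₅ := exec_clearBlock (b + 1 + m) m U₄
      refine (((Exec.pop (t := 1) le_rfl).seq (k₂.seq (k₃.seq (k₄.seq k₅ le_rfl) le_rfl) le_rfl)
        le_rfl).of_eq ?_).mono ?_
      · funext s
        rcases s with s | s
        · simp [Store.setBlock, hU₄, hU₃, hU₂, hU₁, hT]
        · by_cases h1 : b + 1 + m ≤ s ∧ s < b + 1 + m + m
          · rw [hTe _ _ h1.1]; simp only [Store.setBlock]; rw [if_pos h1]
          · by_cases h2 : b + 1 ≤ s ∧ s < b + 1 + m
            · obtain ⟨k, rfl⟩ := Nat.exists_eq_add_of_le h2.1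
              rw [hTd _ _ (by omega), Store.setBlock_of_lt _ _ (by omega), hU₄,
                Store.setBlock_add _ _ (by omega), hU₃e _ (by omega)]
            · by_cases h3 : s = b
              · subst h3
                rw [hTb]
                simp only [Store.setBlock, hU₄, hU₃, hU₂, hU₁]
                rw [if_neg h1, if_neg h2, if_neg h2, if_neg h1]
                simp [hTb]
              · have h4 : (Sum.inr s : Reg n) ≠ .inr b := by simpa using h3
                simp only [Store.setBlock, hU₄, hU₃, hU₂, hU₁, hT]
                rw [if_neg h1, if_neg h2, if_neg h2, if_neg h1, Function.update_of_ne h4]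
                simp only [Store.setBlock]
                rw [if_neg h2, if_neg h2, Function.update_of_ne h4, Function.update_of_ne h4]
      · have b₂ := eval_mono_nat q₂ (hsz i hi.le)
        have b₃ : ∑ k ∈ Finset.range m, (2 * (U₂ (.inr (b + 1 + k))).length + 1)
            ≤ m * (2 * B.eval N + 1) := by
          refine (Finset.sum_le_card_nsmul _ _ (2 * B.eval N + 1) fun k hk => ?_).trans (by simp)
          have hk : k < m := by simpa using hk
          rw [hU₂d k hk]
          have := hext i hi.le k
          omega
        have b₄ : ∑ k ∈ Finset.range m, (9 * (U₃ (.inr (b + 1 + m + k))).length + 2)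
            ≤ m * (9 * B.eval N + 2) := by
          refine (Finset.sum_le_card_nsmul _ _ (9 * B.eval N + 2) fun k hk => ?_).trans (by simp)
          have hk : k < m := by simpa using hk
          rw [hU₃e k hk]
          have := hext (i + 1) hi k
          omega
        have b₅ : ∑ k ∈ Finset.range m, (2 * (U₄ (.inr (b + 1 + m + k))).length + 1)
            ≤ m * (2 * B.eval N + 1) := by
          refine (Finset.sum_le_card_nsmul _ _ (2 * B.eval N + 1) fun k hk => ?_).trans (by simp)
          have hk : k < m := by simpa using hk
          rw [hU₄e k hk]
          have := hext (i + 1) hi k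
          omega
        have b₆ : m * (13 * B.eval N + 4) = m * (2 * B.eval N + 1) + m * (9 * B.eval N + 2)
          + m * (2 * B.eval N + 1) := by ring
        omega)
  set k := (v none).length with hk
  have e₄ := exec_copy (n := n) (a := b + 1 + j) (o := o) (b := b + 1 + m) (by omega) (by omega)
    (by omega) (T k) (hTe _ _ le_rfl) (by
      simp only [hT]
      rw [Store.setBlock_of_lt _ _ (by omega), Function.update_of_ne (by simp; omega), hSo])
  have e₅ := exec_clearBlock (b + 1) m (Function.update (T k) (.inr o) (T k (.inr (b + 1 + j))))
  have e₂' : Exec c₁ S₁ (T 0) (q₁.eval N) := e₂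
  refine ((e₁.seq (e₂'.seq (e₃.seq (e₄.seq e₅ le_rfl) le_rfl) le_rfl) le_rfl).of_eq ?_).mono ?_
  · rw [hTd _ _ j.2]
    have hj : extendFin (step^[k] w) j = step^[k] w j := by simp [extendFin]
    rw [hj]
    funext s
    rcases s with s | s
    · simp [Store.setBlock, hT]
    · by_cases h2 : b + 1 ≤ s ∧ s < b + 1 + m
      · rw [Function.update_of_ne (by simp; omega), hSb s (by omega)]
        simp only [Store.setBlock]; rw [if_pos h2]
      · simp only [Store.setBlock]; rw [if_neg h2]
        by_cases h3 : s = o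
        · subst h3; simp only [Function.update_self]; rfl
        · have h4 : (Sum.inr s : Reg n) ≠ .inr o := by simpa using h3
          rw [Function.update_of_ne h4, Function.update_of_ne h4]
          simp only [hT, Store.setBlock]
          rw [if_neg h2]
          by_cases h5 : s = b
          · subst h5; simp [hk, hSb s le_rfl]
          · rw [Function.update_of_ne (by simpa using h5)]
  · have b₁ : (v none).length ≤ N := by omega
    have b₄ : (T k (.inr (b + 1 + j))).length ≤ B.eval N := by
      rw [hTd _ _ j.2]; exact hext k le_rfl j
    have b₅ : ∑ i ∈ Finset.range m, (2 * (Function.update (T k) (.inr o) (T k (.inr (b + 1 + j)))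
        (.inr (b + 1 + i))).length + 1) ≤ m * (2 * B.eval N + 1) := by
      refine (Finset.sum_le_card_nsmul _ _ (2 * B.eval N + 1) fun i hi => ?_).trans (by simp)
      have hi : i < m := by simpa using hi
      rw [Function.update_of_ne (by simp; omega), hTd _ _ hi]
      have := hext k le_rfl i
      omega
    have b₃ : k * (4 + q₂.eval (m * B.eval N) + m * (13 * B.eval N + 4) + 1)
        ≤ N * (5 + q₂.eval (m * B.eval N) + m * (13 * B.eval N + 4)) :=
      Nat.mul_le_mul b₁ (by omega)
    have b₀ : (S (.inr (a none))).length ≤ N := b₁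
    simp only [M, Polynomial.eval_add, Polynomial.eval_mul, Polynomial.eval_comp, Polynomial.eval_X,
      Polynomial.eval_natCast, Polynomial.eval_ofNat, Polynomial.eval_one, Nat.cast_id]
    omega

/-- Simultaneous recursion with polynomially bounded values. -/
theorem FP.iterate {κ : Type} [Fintype κ] {G : κ → (κ → Word) → Word} (hG : ∀ k, FP (G k))
    (hB : ∃ B : Polynomial ℕ, ∀ w i k,
      ((fun w k => G k w)^[i] w k).length ≤ B.eval (i + size w)) (j : κ)
    {u : (ι → Word) → Word} {w : κ → (ι → Word) → Word} (hu : FP u) (hw : ∀ k, FP (w k)) :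
    FP fun v => ((fun w k => G k w)^[(u v).length] fun k => w k v) j := by
  let e := Fintype.equivFin κ
  let G' : Fin (Fintype.card κ) → (Fin (Fintype.card κ) → Word) → Word :=
    fun k w => G (e.symm k) fun i => w (e i)
  have hconj : ∀ i (w : κ → Word), (fun w k => G' k w)^[i] (fun k => w (e.symm k))
      = fun k => (fun w k => G k w)^[i] w (e.symm k) := by
    intro i
    induction i with
    | zero => intro w; rfl
    | succ i ih =>
      intro w
      rw [Function.iterate_succ_apply, Function.iterate_succ_apply, ← ih]
      congr 1
      funext k
      simp [G']
  have hsize : ∀ w : Fin (Fintype.card κ) → Word, size (fun i => w (e i)) = size w := fun w =>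
    e.sum_comp fun i => (w i).length
  have h := FP.iterate_fin (G := G') (fun k => (hG (e.symm k)).reindex e) (by
    obtain ⟨B, hB⟩ := hB
    refine ⟨B, fun w i k => ?_⟩
    have h1 := hconj i (fun k => w (e k))
    simp only [Equiv.apply_symm_apply] at h1
    rw [h1, ← hsize]
    exact hB _ _ _) (e j)
  have := h.comp (f := fun k v => k.elim (u v) fun k => w (e.symm k) v)
    (fun k => by cases k with
      | none => exact hu
      | some k => exact hw _)
  simp only [Option.elim] at this
  refine (congrArg FP ?_).mp this
  funext v
  rw [hconj _ fun k => w k v]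
  simp

end FP

/-! ## A library of polynomial-time functions -/

/-- `f` factors through a polynomial-time function of the words `env`. -/
def FPon {P : Type*} {ι : Type} [Fintype ι] (env : ι → P → Word) (f : P → Word) : Prop :=
  ∃ g : (ι → Word) → Word, FP g ∧ ∀ p, f p = g fun i => env i p

section FPon

variable {P : Type*} {ι : Type} [Fintype ι] {env : ι → P → Word} {f g h k : P → Word}

theorem FPon.var (i : ι) : FPon env (env i) := ⟨_, FP.proj i, fun _ => rfl⟩

theorem FPon.of_eq (hf : FPon env f) (e : ∀ p, f p = g p) : FPon env g :=
  (funext e : f = g) ▸ hf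

theorem FPon.toFP {f : (ι → Word) → Word} (hf : FPon (fun i (v : ι → Word) => v i) f) : FP f := by
  obtain ⟨g, hg, h⟩ := hf
  rwa [show f = g from funext h]

theorem FP.toFPon {f : (ι → Word) → Word} (hf : FP f) : FPon (fun i (v : ι → Word) => v i) f :=
  ⟨f, hf, fun _ => rfl⟩

theorem FPon.nil : FPon env fun _ => [] := ⟨_, FP.nil, fun _ => rfl⟩

theorem FPon.cons (b : Bool) (hf : FPon env f) : FPon env fun p => b :: f p := by
  obtain ⟨f', hf', e⟩ := hf
  exact ⟨_, hf'.cons b, fun p => by simp only [e]⟩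

theorem FPon.tail (hf : FPon env f) : FPon env fun p => (f p).tail := by
  obtain ⟨f', hf', e⟩ := hf
  exact ⟨_, hf'.tail, fun p => by simp only [e]⟩

theorem FPon.caseHead (hf : FPon env f) (hg : FPon env g) (hh : FPon env h) (hk : FPon env k) :
    FPon env fun p => caseHead (f p) (g p) (h p) (k p) := by
  obtain ⟨f', hf', e₁⟩ := hf
  obtain ⟨g', hg', e₂⟩ := hg
  obtain ⟨h', hh', e₃⟩ := hh
  obtain ⟨k', hk', e₄⟩ := hk
  exact ⟨_, hf'.caseHead hg' hh' hk', fun p => by simp only [e₁, e₂, e₃, e₄]⟩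

theorem FPon.comp {κ : Type} [Fintype κ] {F : (κ → Word) → Word} {f : κ → P → Word} (hF : FP F)
    (hf : ∀ k, FPon env (f k)) : FPon env fun p => F fun k => f k p := by
  choose f' hf' e using hf
  exact ⟨_, hF.comp hf', fun p => by simp [e]⟩

theorem FPon.trans {κ : Type} [Fintype κ] {env' : κ → P → Word} (hf : FPon env' f)
    (henv : ∀ k, FPon env (env' k)) : FPon env f := by
  obtain ⟨F, hF, e⟩ := hf
  exact (FPon.comp hF henv).of_eq fun p => (e p).symm

theorem FPon.pullback {Q : Type*} (hf : FPon env f) (φ : Q → P) :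
    FPon (fun i q => env i (φ q)) fun q => f (φ q) := by
  obtain ⟨F, hF, e⟩ := hf
  exact ⟨F, hF, fun q => e _⟩

theorem FPon.const (w : Word) : FPon env fun _ => w := by
  induction w with
  | nil => exact .nil
  | cons b w ih => exact ih.cons b

theorem FPon.iteNil (hf : FPon env f) (hg : FPon env g) (hh : FPon env h) :
    FPon env fun p => if f p = [] then g p else h p :=
  (hf.caseHead hg hh hh).of_eq fun p => by rcases f p with _ | ⟨_ | _, w⟩ <;> simp [PolyEst.caseHead]

/-- Comparison with a fixed word is a finite nest of case distinctions on first bits. -/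
theorem FPon.iteEq (w : Word) (hf : FPon env f) (hg : FPon env g) (hh : FPon env h) :
    FPon env fun p => if f p = w then g p else h p := by
  induction w generalizing f with
  | nil => exact hf.iteNil hg hh
  | cons b w ih =>
    cases b with
    | false =>
      exact (hf.caseHead hh (ih hf.tail) hh).of_eq fun p => by
        rcases f p with _ | ⟨_ | _, x⟩ <;> simp [PolyEst.caseHead]; congr
    | true =>
      exact (hf.caseHead hh hh (ih hf.tail)).of_eq fun p => by
        rcases f p with _ | ⟨_ | _, x⟩ <;> simp [PolyEst.caseHead]; congr

theorem iterate_length_le {κ : Type} [Fintype κ] {G : (κ → Word) → κ → Word} (C : ℕ)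
    (hG : ∀ w k, (G w k).length ≤ (w k).length + C) (w : κ → Word) (i : ℕ) (k : κ) :
    (G^[i] w k).length ≤ (w k).length + C * i := by
  induction i with
  | zero => simp
  | succ i ih =>
    rw [Function.iterate_succ_apply']
    have := hG (G^[i] w) k
    rw [Nat.mul_succ]; omega

theorem FPon.iterate {κ : Type} [Fintype κ] {G : κ → (κ → Word) → Word} (hG : ∀ k, FP (G k))
    (hB : ∃ B : Polynomial ℕ, ∀ w i k,
      ((fun w k => G k w)^[i] w k).length ≤ B.eval (i + size w)) (j : κ)
    {u : P → Word} {w : κ → P → Word} (hu : FPon env u) (hw : ∀ k, FPon env (w k)) :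
    FPon env fun p => ((fun w k => G k w)^[(u p).length] fun k => w k p) j := by
  obtain ⟨u', hu', e⟩ := hu
  choose w' hw' e' using hw
  exact ⟨_, FP.iterate hG hB j hu' hw', fun p => by simp only [e, e']⟩

/-- Each round moves one bit from the front of the first word to the front of the second. -/
theorem FPon.reverse (hf : FPon env f) : FPon env fun p => (f p).reverse := by
  let G : Fin 2 → (Fin 2 → Word) → Word :=
    ![fun w => (w 0).tail, fun w => PolyEst.caseHead (w 0) (w 1) (false :: w 1) (true :: w 1)]
  have hG : ∀ k, FP (G k) := fun k => by
    fin_cases k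
    · exact (FP.proj 0).tail
    · exact (FP.proj 0).caseHead (FP.proj 1) ((FP.proj 1).cons _) ((FP.proj 1).cons _)
  have key : ∀ x y : Word, (fun w k => G k w)^[x.length] ![x, y] = ![[], x.reverse ++ y] := by
    intro x
    induction x with
    | nil => intro y; rfl
    | cons b x ih =>
      intro y
      rw [List.length_cons, Function.iterate_succ_apply]
      have : (fun k => G k ![b :: x, y]) = ![x, b :: y] := by
        funext k; fin_cases k <;> cases b <;> rfl
      rw [this, ih]; simp
  have := FPon.iterate (env := env) hG ⟨2 * .X, fun w i k => by
    refine (iterate_length_le 1 (fun w k => ?_) w i k).trans ?_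
    · fin_cases k
      · simp [G]; omega
      · simp only [G]
        rcases h : w 0 with _ | ⟨_ | _, x⟩ <;> simp [h, PolyEst.caseHead]
    · have := length_le_size w k
      simp only [Polynomial.eval_mul, Polynomial.eval_ofNat, Polynomial.eval_X]; omega⟩ 1
    (w := ![f, fun _ => []]) hf (fun k => by fin_cases k; exacts [hf, .nil])
  refine this.of_eq fun p => ?_
  have e : (fun k => (![f, fun _ => []] : Fin 2 → P → Word) k p) = ![f p, []] := by
    funext k; fin_cases k <;> rfl
  rw [e, key]; simp

/-- Recursion along a word, with parameters. -/
theorem FPon.foldr {κ ι' : Type} [Fintype κ] [Fintype ι'] {G : Bool → κ → (κ ⊕ ι' → Word) → Word}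
    (hG : ∀ b k, FP (G b k)) {w : P → Word} {init : κ → P → Word} {par : ι' → P → Word}
    (hB : ∃ B : Polynomial ℕ, ∀ (w : Word) (init : κ → Word) (par : ι' → Word) k,
      (w.foldr (fun b acc k => G b k (Sum.elim acc par)) init k).length
        ≤ B.eval (w.length + size init + size par))
    (hw : FPon env w) (hi : ∀ k, FPon env (init k)) (hp : ∀ i, FPon env (par i)) (j : κ) :
    FPon env fun p => (w p).foldr (fun b acc k => G b k (Sum.elim acc fun i => par i p))
      (fun k => init k p) j := by
  obtain ⟨B, hB⟩ := hB
  -- One round. The word at `none` is what is left of the reversed word, because `foldr` starts at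
  -- the far end; the accumulators are frozen once nothing is left, and the parameters never change.
  let H : Option (κ ⊕ ι') → (Option (κ ⊕ ι') → Word) → Word
    | none => fun v => (v none).tail
    | some (.inl k) => fun v => PolyEst.caseHead (v none) (v (some (.inl k)))
        (G false k fun x => v (some x)) (G true k fun x => v (some x))
    | some (.inr i) => fun v => v (some (.inr i))
  have hH : ∀ x, FP (H x) := fun x => by
    rcases x with _ | k | i
    · exact (FP.proj none).tail
    · exact (FP.proj none).caseHead (FP.proj _) ((hG _ _).comp fun x => FP.proj (some x))
        ((hG _ _).comp fun x => FP.proj (some x))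
    · exact FP.proj _
  let mk (r : Word) (acc : κ → Word) (par : ι' → Word) : Option (κ ⊕ ι') → Word :=
    fun x => x.elim r (Sum.elim acc par)
  have key : ∀ (i : ℕ) (r : Word) (acc : κ → Word) (par : ι' → Word),
      (fun w k => H k w)^[i] (mk r acc par) = mk (r.drop i)
        ((r.take i).reverse.foldr (fun b acc k => G b k (Sum.elim acc par)) acc) par := by
    intro i r acc par
    induction i with
    | zero => simp
    | succ i ih =>
      rw [Function.iterate_succ_apply', ih]
      funext x
      rcases x with _ | k | i'
      · simp [H, mk]
      · simp only [H, mk, Option.elim, Sum.elim_inl]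
        rcases lt_or_ge i r.length with hi | hi
        · rw [List.take_succ_eq_append_getElem hi, List.drop_eq_getElem_cons hi]
          cases r[i] <;>
            · simp only [PolyEst.caseHead, List.reverse_append, List.reverse_cons,
                List.reverse_nil, List.nil_append, List.cons_append, List.foldr_cons]
        · rw [List.drop_eq_nil_of_le hi, List.take_of_length_le hi,
            List.take_of_length_le (by omega)]
          rfl
      · rfl
  have hmk : ∀ v : Option (κ ⊕ ι') → Word, mk (v none) (fun k => v (some (.inl k)))
      (fun i => v (some (.inr i))) = v := fun v => by
    funext x
    rcases x with _ | k | i' <;> rfl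
  have := FPon.iterate (env := env) hH ⟨B + .X, fun v i x => by
    have hsz : size v = (v none).length + size (fun k => v (some (.inl k)))
        + size (fun i => v (some (.inr i))) := by
      simp only [size, Fintype.sum_option, Fintype.sum_sum_type]; ring
    rw [← hmk v, key, hmk v, hsz]
    simp only [Polynomial.eval_add, Polynomial.eval_X]
    rcases x with _ | k | i'
    · simp only [mk, Option.elim, List.length_drop]; omega
    · simp only [mk, Option.elim, Sum.elim_inl]
      -- Every iterate is itself a fold, over a reversed prefix, so the bound for folds controls it.
      have h1 := hB ((v none).take i).reverse (fun k => v (some (.inl k)))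
        (fun i => v (some (.inr i))) k
      refine h1.trans (le_trans (eval_mono_nat B ?_) (Nat.le_add_right _ _))
      have : ((v none).take i).reverse.length ≤ i := by simp
      omega
    · simp only [mk, Option.elim, Sum.elim_inr]
      have := length_le_size (fun i => v (some (.inr i))) i'
      omega⟩ (some (.inl j)) (u := w) (w := fun x p => mk (w p).reverse (fun k => init k p)
        (fun i => par i p) x) hw (fun x => by
          rcases x with _ | k | i'
          · exact hw.reverse
          · exact hi k
          · exact hp i')
  refine this.of_eq fun p => ?_
  have e := key (w p).length (w p).reverse (fun k => init k p) (fun i => par i p)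
  refine (congrFun e _).trans ?_
  simp only [mk, Option.elim, Sum.elim_inl]
  rw [List.take_of_length_le (by simp), List.reverse_reverse]

theorem FPon.foldr₁ {ι' : Type} [Fintype ι'] {G : Bool → (Unit ⊕ ι' → Word) → Word}
    (hG : ∀ b, FP (G b)) {w init : P → Word} {par : ι' → P → Word}
    (hB : ∃ B : Polynomial ℕ, ∀ (w init : Word) (par : ι' → Word),
      (w.foldr (fun b acc => G b (Sum.elim (fun _ => acc) par)) init).length
        ≤ B.eval (w.length + init.length + size par))
    (hw : FPon env w) (hi : FPon env init) (hp : ∀ i, FPon env (par i)) :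
    FPon env fun p => (w p).foldr (fun b acc => G b (Sum.elim (fun _ => acc) fun i => par i p))
      (init p) := by
  have key : ∀ (w : Word) (init : Unit → Word) (par : ι' → Word),
      w.foldr (fun b acc (_ : Unit) => G b (Sum.elim acc par)) init
        = fun _ => w.foldr (fun b acc => G b (Sum.elim (fun _ => acc) par)) (init ()) := by
    intro w init par
    induction w with
    | nil => rfl
    | cons b w ih => rw [List.foldr_cons, ih]; rfl
  obtain ⟨B, hB⟩ := hB
  have := FPon.foldr (env := env) (κ := Unit) (G := fun b _ => G b) (fun b _ => hG b)
    ⟨B, fun w init par k => by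
      rw [key]
      have := hB w (init ()) par
      rwa [show size init = (init ()).length by simp [size]]⟩ hw (fun _ => hi) hp ()
  exact this.of_eq fun p => by rw [key]

theorem FPon.append (hf : FPon env f) (hg : FPon env g) : FPon env fun p => f p ++ g p := by
  have key : ∀ w init : Word, w.foldr (fun b acc => b :: acc) init = w ++ init := by simp
  have := FPon.foldr₁ (env := env) (ι' := Empty) (G := fun b v => b :: v (.inl ()))
    (fun b => (FP.proj _).cons b) (par := fun i => i.elim) ⟨.X, fun w init par => by
      simp only [Sum.elim_inl, key, Polynomial.eval_X, List.length_append]; omega⟩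
    hf hg (fun i => i.elim)
  exact this.of_eq fun p => key _ _

theorem FPon.drop (hf : FPon env f) (hg : FPon env g) :
    FPon env fun p => (g p).drop (f p).length := by
  have key : ∀ w init : Word, w.foldr (fun _ acc => acc.tail) init = init.drop w.length := by
    intro w init
    induction w with
    | nil => rfl
    | cons b w ih => rw [List.foldr_cons, ih]; simp
  have := FPon.foldr₁ (env := env) (ι' := Empty) (G := fun b v => (v (.inl ())).tail)
    (fun b => (FP.proj _).tail) (par := fun i => i.elim) ⟨.X, fun w init par => by
      simp only [Sum.elim_inl, key, Polynomial.eval_X, List.length_drop]; omega⟩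
    hf hg (fun i => i.elim)
  exact this.of_eq fun p => key _ _

/-- Two accumulators: the part still to be read (`true`) and the bits taken so far in reverse order
(`false`). -/
theorem FPon.take (hf : FPon env f) (hg : FPon env g) :
    FPon env fun p => (g p).take (f p).length := by
  let G : Bool → Bool → (Bool ⊕ Empty → Word) → Word := fun b k v =>
    bif k then (v (.inl true)).tail else PolyEst.caseHead (v (.inl true)) (v (.inl false))
      (false :: v (.inl false)) (true :: v (.inl false))
  have key : ∀ (w : Word) (init : Bool → Word) (par : Empty → Word),
      w.foldr (fun b acc k => G b k (Sum.elim acc par)) init =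
        fun k => bif k then (init true).drop w.length
          else ((init true).take w.length).reverse ++ init false := by
    intro w init par
    induction w with
    | nil => funext k; cases k <;> rfl
    | cons b w ih =>
      rw [List.foldr_cons, ih]
      funext k
      cases k
      · simp only [G, Sum.elim_inl, cond_true, cond_false, List.length_cons]
        rcases lt_or_ge w.length (init true).length with hi | hi
        · rw [List.take_succ_eq_append_getElem hi, List.drop_eq_getElem_cons hi]
          cases (init true)[w.length] <;> simp [PolyEst.caseHead]
        · rw [List.drop_eq_nil_of_le hi, List.take_of_length_le hi,
            List.take_of_length_le (by omega)]
          rfl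
      · simp [G]
  have := FPon.foldr (env := env) (G := G) (fun b k => by
      cases k
      · exact (FP.proj _).caseHead (FP.proj _) ((FP.proj _).cons _) ((FP.proj _).cons _)
      · exact (FP.proj _).tail) (init := fun k => bif k then g else fun _ => [])
    (par := fun i => i.elim) ⟨.X, fun w init par k => by
      rw [key, Polynomial.eval_X]
      have h1 := length_le_size init true
      have h2 := length_le_size init false
      have h3 : size init = (init true).length + (init false).length := by simp [size]
      cases k
      · simp; omega
      · simp; omega⟩ hf (fun k => by cases k; exacts [.nil, hg]) (fun i => i.elim) false
  refine this.reverse.of_eq fun p => ?_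
  rw [key]; simp

/-! ### Numbers in unary -/

/-- The function `a` is computable in polynomial time from `env`, in unary notation. -/
def FPN {P : Type*} {ι : Type} [Fintype ι] (env : ι → P → Word) (a : P → ℕ) : Prop :=
  FPon env fun p => List.replicate (a p) true

variable {a b : P → ℕ}

theorem FPN.of_eq (ha : FPN env a) (e : ∀ p, a p = b p) : FPN env b :=
  (funext e : a = b) ▸ ha

theorem FPon.length (hf : FPon env f) : FPN env fun p => (f p).length := by
  have key : ∀ w init : Word, w.foldr (fun _ acc => true :: acc) init
      = List.replicate w.length true ++ init := by
    intro w init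
    induction w with
    | nil => rfl
    | cons b w ih => rw [List.foldr_cons, ih]; rfl
  have := FPon.foldr₁ (env := env) (ι' := Empty) (G := fun b v => true :: v (.inl ()))
    (fun b => (FP.proj _).cons _) (par := fun i => i.elim) ⟨.X, fun w init par => by
      simp only [Sum.elim_inl, key, Polynomial.eval_X, List.length_append, List.length_replicate]
      omega⟩
    hf .nil (fun i => i.elim)
  exact this.of_eq fun p => (key _ _).trans (List.append_nil _)

theorem FPon.takeN (ha : FPN env a) (hg : FPon env g) : FPon env fun p => (g p).take (a p) :=
  (FPon.take ha hg).of_eq fun p => by simp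

theorem FPon.dropN (ha : FPN env a) (hg : FPon env g) : FPon env fun p => (g p).drop (a p) :=
  (FPon.drop ha hg).of_eq fun p => by simp

theorem FPN.const (c : ℕ) : FPN env fun _ => c := FPon.const _

theorem FPN.add (ha : FPN env a) (hb : FPN env b) : FPN env fun p => a p + b p :=
  (FPon.append ha hb).of_eq fun p => by simp

theorem FPN.sub (ha : FPN env a) (hb : FPN env b) : FPN env fun p => a p - b p :=
  (FPon.drop hb ha).of_eq fun p => by simp

theorem FPN.mul (ha : FPN env a) (hb : FPN env b) : FPN env fun p => a p * b p := by
  have key : ∀ w init par : Word, (w.foldr (fun _ acc => acc ++ par) init).length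
      = init.length + w.length * par.length := by
    intro w init par
    induction w with
    | nil => simp
    | cons b w ih => rw [List.foldr_cons, List.length_append, ih, List.length_cons]; ring
  have := FPon.foldr₁ (env := env) (ι' := Unit) (G := fun b v => v (.inl ()) ++ v (.inr ()))
    (fun b => ((FP.proj _).toFPon.append (FP.proj _).toFPon).toFP)
    (init := fun _ => []) (par := fun _ p => List.replicate (b p) true)
    ⟨.X + .X * .X, fun w init par => by
      simp only [Sum.elim_inl, Sum.elim_inr, key, Polynomial.eval_add, Polynomial.eval_mul,
        Polynomial.eval_X]
      have h2 := length_le_size par ()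
      have := Nat.mul_le_mul (show w.length ≤ w.length + init.length + size par by omega)
        (show (par ()).length ≤ w.length + init.length + size par by omega)
      omega⟩ ha .nil (fun _ => hb)
  exact this.length.of_eq fun p => by
    simp only [Sum.elim_inl, Sum.elim_inr, key]; simp

theorem FPN.sum {κ : Type*} (s : Finset κ) {a : κ → P → ℕ} (ha : ∀ k ∈ s, FPN env (a k)) :
    FPN env fun p => ∑ k ∈ s, a k p := by
  classical
  induction s using Finset.induction_on with
  | empty => exact FPN.const 0
  | insert k s hk ih =>
    exact ((ha k (by simp)).add (ih fun i hi => ha i (by simp [hi]))).of_eq fun p => by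
      rw [Finset.sum_insert hk]

theorem FPN.mvPolynomial {m : ℕ} (q : MvPolynomial (Fin m) ℕ) {a : Fin m → P → ℕ}
    (ha : ∀ i, FPN env (a i)) : FPN env fun p => MvPolynomial.eval (fun i => a i p) q := by
  induction q using MvPolynomial.induction_on with
  | C c => exact (FPN.const c).of_eq fun p => by simp
  | add q₁ q₂ h₁ h₂ => exact (h₁.add h₂).of_eq fun p => by simp
  | mul_X q i h => exact (h.mul (ha i)).of_eq fun p => by simp

/-! ### Binary notation -/

/-- The number with binary digits `w`, least significant digit first. -/
def val : Word → ℕ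
  | [] => 0
  | b :: w => b.toNat + 2 * val w

theorem val_bits (n : ℕ) : val (Nat.bits n) = n := by
  induction n using Nat.binaryRec' with
  | zero => simp [val]
  | bit b n h ih => rw [Nat.bits_append_bit _ _ h, val, ih, Nat.bit_val]; ring

/-- Increment in binary notation. -/
def inc : Word → Word
  | [] => [true]
  | false :: w => true :: w
  | true :: w => false :: inc w

theorem inc_bits (n : ℕ) : inc (Nat.bits n) = Nat.bits (n + 1) := by
  induction n using Nat.binaryRec' with
  | zero => simp [inc]
  | bit b n h ih =>
    rw [Nat.bits_append_bit _ _ h]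
    cases b with
    | false =>
      rw [inc, ← Nat.bits_append_bit n true (fun _ => rfl)]
      congr 1
    | true =>
      rw [inc, ih, ← Nat.bits_append_bit (n + 1) false (fun h => by omega)]
      congr 1

/-- A carry stops at the first `false`, beyond which the digits are unchanged. Since a fold sees
only its accumulators, `true` keeps a copy of the digits already processed, beside their increment
in `false`. -/
theorem FPon.inc (hf : FPon env f) : FPon env fun p => inc (f p) := by
  let G : Bool → Bool → (Bool ⊕ Empty → Word) → Word := fun b k v =>
    bif k then b :: v (.inl true)
      else bif b then false :: v (.inl false) else true :: v (.inl true)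
  have key : ∀ (w : Word) (init : Bool → Word) (par : Empty → Word),
      (w.foldr (fun b acc k => G b k (Sum.elim acc par)) init true = w ++ init true) ∧
      (init = (fun k => bif k then [] else [true]) →
        w.foldr (fun b acc k => G b k (Sum.elim acc par)) init false = PolyEst.inc w) ∧
      (w.foldr (fun b acc k => G b k (Sum.elim acc par)) init false).length ≤
        w.length + size init := by
    intro w init par
    have h3 : size init = (init true).length + (init false).length := by simp [size]
    induction w with
    | nil => refine ⟨rfl, fun h => by subst h; rfl, ?_⟩; simp; omega
    | cons b w ih =>
      simp only [List.foldr_cons]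
      obtain ⟨h1, h2, h4⟩ := ih
      generalize w.foldr (fun b acc k => G b k (Sum.elim acc par)) init = F at *
      refine ⟨?_, fun h => ?_, ?_⟩
      · simp [G, h1]
      · cases b
        · simp [G, h1, h, PolyEst.inc]
        · simp [G, h2 h, PolyEst.inc]
      · cases b
        · simp [G, h1]; omega
        · simp [G]; omega
  have := FPon.foldr (env := env) (G := G) (fun b k => by
      cases k
      · cases b
        · exact (FP.proj _).cons _
        · exact (FP.proj _).cons _
      · exact (FP.proj _).cons _) (init := fun k _ => bif k then [] else [true])
    (par := fun i => i.elim) ⟨.X, fun w init par k => by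
      rw [Polynomial.eval_X]
      have h2 := length_le_size init true
      cases k
      · have := (key w init par).2.2; omega
      · rw [(key w init par).1]; simp; omega⟩ hf
      (fun k => by cases k; exacts [.const _, .nil]) (fun i => i.elim) false
  exact this.of_eq fun p => (key _ _ _).2.1 rfl

theorem length_inc_le (w : Word) : (inc w).length ≤ w.length + 1 := by
  induction w with
  | nil => simp [inc]
  | cons b w ih => cases b <;> simp [inc]; omega

/-- Conversion from unary to binary notation. -/
theorem FPN.bits (ha : FPN env a) : FPon env fun p => Nat.bits (a p) := by
  have h₁ : ∀ w init : Word, (w.foldr (fun _ acc => PolyEst.inc acc) init).length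
      ≤ w.length + init.length := by
    intro w init
    induction w with
    | nil => simp
    | cons b w ih =>
      rw [List.foldr_cons]
      have := length_inc_le (w.foldr (fun _ acc => PolyEst.inc acc) init)
      simp only [List.length_cons]
      omega
  have h₂ : ∀ n : ℕ, (List.replicate n true).foldr (fun _ acc => PolyEst.inc acc) []
      = Nat.bits n := by
    intro n
    induction n with
    | zero => simp
    | succ n ih => rw [List.replicate_succ, List.foldr_cons, ih, inc_bits]
  have := FPon.foldr₁ (env := env) (ι' := Empty) (G := fun b v => PolyEst.inc (v (.inl ())))
    (fun b => (FPon.inc (FP.proj (Sum.inl ())).toFPon).toFP)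
    (init := fun _ => []) (par := fun i => i.elim)
    ⟨.X, fun w init par => by
      rw [Polynomial.eval_X]
      have := h₁ w init
      simp only [Sum.elim_inl]; omega⟩ ha .nil (fun i => i.elim)
  exact this.of_eq fun p => h₂ _

/-- Conversion from binary to unary notation, cut off at `a`. -/
theorem FPon.valMin (ha : FPN env a) (hf : FPon env f) :
    FPN env fun p => min (a p) (val (f p)) := by
  -- Horner's scheme with a cut after every digit. Without the cut the unary accumulator could
  -- become exponentially long; the cut does no harm, because a value that has reached the limit
  -- stays there under doubling.
  have key : ∀ w init par : Word,
      (w.foldr (fun b acc => (acc ++ (acc ++ bif b then [true] else [])).take par.length)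
        init).length ≤ par.length + init.length ∧
      (init.length = 0 →
        (w.foldr (fun b acc => (acc ++ (acc ++ bif b then [true] else [])).take par.length)
          init).length = min par.length (val w)) := by
    intro w init par
    induction w with
    | nil => simp +contextual [val]
    | cons b w ih =>
      refine ⟨?_, fun h0 => ?_⟩
      · rw [List.foldr_cons]; simp only [List.length_take]; omega
      · rw [List.foldr_cons]
        have := ih.2 h0
        simp only [List.length_take, List.length_append, val]
        rw [this]
        cases b <;> simp <;> omega
  have := FPon.foldr₁ (env := env) (ι' := Unit)
    (G := fun b v => (v (.inl ()) ++ (v (.inl ()) ++ bif b then [true] else [])).take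
      (v (.inr ())).length)
    (fun b => (FPon.take (FP.proj _).toFPon ((FP.proj _).toFPon.append
      ((FP.proj _).toFPon.append (FPon.const _)))).toFP)
    (init := fun _ => []) (par := fun _ p => List.replicate (a p) true)
    ⟨.X, fun w init par => by
      rw [Polynomial.eval_X]
      have h2 := length_le_size par ()
      exact (key w init (par ())).1.trans (by omega)⟩ hf .nil (fun _ => ha)
  exact this.length.of_eq fun p => by
    have := (key (f p) [] (List.replicate (a p) true)).2 rfl
    simpa using this

end FPon

/-! ### Encoding and decoding of tuples -/

section Tuples

variable {P : Type*} {ι : Type} [Fintype ι] {env : ι → P → Word} {f g : P → Word} {a : P → ℕ}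

theorem length_double (w : Word) : (double w).length = 2 * w.length := by
  induction w with
  | nil => rfl
  | cons b w ih => simp only [double, List.length_cons, ih]; ring

theorem FPon.double (hf : FPon env f) : FPon env fun p => double (f p) := by
  have key : ∀ w init : Word, w.foldr (fun b acc => b :: b :: acc) init
      = PolyEst.double w ++ init := by
    intro w init
    induction w with
    | nil => rfl
    | cons b w ih => rw [List.foldr_cons, ih]; rfl
  have := FPon.foldr₁ (env := env) (ι' := Empty) (G := fun b v => b :: b :: v (.inl ()))
    (fun b => ((FP.proj _).cons _).cons _) (init := fun _ => []) (par := fun i => i.elim)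
    ⟨2 * .X, fun w init par => by
      simp only [Sum.elim_inl, key, Polynomial.eval_X, List.length_append, Polynomial.eval_mul,
        Polynomial.eval_ofNat, length_double]; omega⟩
    hf .nil (fun i => i.elim)
  exact this.of_eq fun p => (key _ _).trans (List.append_nil _)

theorem FPon.tuple (l : List (P → Word)) (hl : ∀ f ∈ l, FPon env f) :
    FPon env fun p => tuple (l.map fun f => f p) := by
  induction l with
  | nil => exact .nil
  | cons f l ih =>
    cases l with
    | nil => exact (hl f (by simp)).double
    | cons g l =>
      exact ((hl f (by simp)).double.append
        (((ih fun f hf => hl f (by simp [hf])).cons true).cons false))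

theorem FPon.tuple_ofFn {m : ℕ} {f : Fin m → P → Word} (hf : ∀ i, FPon env (f i)) :
    FPon env fun p => PolyEst.tuple (List.ofFn fun i => f i p) :=
  (FPon.tuple (List.ofFn f) (by simpa [List.forall_mem_ofFn_iff] using hf)).of_eq fun p => by
    rw [List.map_ofFn]; rfl

/-- The first component of a tuple (for `true`) and the tuple of the other ones (for `false`). -/
def splitC (k : Bool) : Word → Word
  | b :: c :: w =>
    if b = c then bif k then b :: splitC k w else splitC k w else bif k then [] else w
  | _ => []

theorem splitC_true_append (w u : Word) : splitC true (double w ++ false :: true :: u) = w := by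
  induction w with
  | nil => simp [double, splitC]
  | cons b w ih => simp [double, splitC, ih]

theorem splitC_false_append (w u : Word) : splitC false (double w ++ false :: true :: u) = u := by
  induction w with
  | nil => simp [double, splitC]
  | cons b w ih => simp [double, splitC, ih]

theorem splitC_true_double (w : Word) : splitC true (double w) = w := by
  induction w with
  | nil => simp [double, splitC]
  | cons b w ih => simp [double, splitC, ih]

theorem splitC_cons (k b : Bool) (w : Word) : splitC k (b :: w) = caseHead w []
    (bif b then bif k then [] else w.tail else bif k then b :: splitC k w.tail
      else splitC k w.tail)
    (bif b then bif k then b :: splitC k w.tail else splitC k w.tail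
      else bif k then [] else w.tail) := by
  rcases w with _ | ⟨_ | _, w⟩ <;> cases b <;> cases k <;> simp [splitC, caseHead]

/-- The recursion of `splitC` advances by two letters and a fold by one. The three accumulators hold
the current suffix, the value at this suffix and the value at its tail. -/
theorem FPon.splitC (k : Bool) (hf : FPon env f) : FPon env fun p => splitC k (f p) := by
  let G : Bool → Fin 3 → (Fin 3 ⊕ Empty → Word) → Word := fun b =>
    ![fun v => b :: v (.inl 0), fun v => PolyEst.caseHead (v (.inl 0)) []
      (bif b then bif k then [] else (v (.inl 0)).tail else
        bif k then b :: v (.inl 2) else v (.inl 2))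
      (bif b then bif k then b :: v (.inl 2) else v (.inl 2)
        else bif k then [] else (v (.inl 0)).tail), fun v => v (.inl 1)]
  have hG : ∀ b i, FP (G b i) := fun b i => by
    fin_cases i
    · exact (FP.proj _).cons b
    · refine (FP.proj _).caseHead .nil ?_ ?_
      · cases b <;> cases k <;>
          first | exact .nil | exact (FP.proj _).tail | exact (FP.proj _).cons _ | exact FP.proj _
      · cases b <;> cases k <;>
          first | exact .nil | exact (FP.proj _).tail | exact (FP.proj _).cons _ | exact FP.proj _
    · exact FP.proj _
  have h₁ : ∀ (w : Word) (par : Empty → Word),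
      w.foldr (fun b acc k => G b k (Sum.elim acc par)) (fun _ => [])
        = ![w, PolyEst.splitC k w, PolyEst.splitC k w.tail] := by
    intro w par
    induction w with
    | nil => funext i; fin_cases i <;> simp [PolyEst.splitC]
    | cons b w ih =>
      rw [List.foldr_cons, ih]
      funext i
      fin_cases i
      · rfl
      · exact (splitC_cons k b w).symm
      · rfl
  have h₂ : ∀ (w : Word) (init : Fin 3 → Word) (par : Empty → Word) i,
      (w.foldr (fun b acc k => G b k (Sum.elim acc par)) init i).length
        ≤ w.length + size init := by
    intro w init par i
    induction w generalizing i with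
    | nil => simpa using length_le_size init i
    | cons b w ih =>
      rw [List.foldr_cons]
      generalize w.foldr (fun b acc k => G b k (Sum.elim acc par)) init = F at *
      have h0 := ih 0
      have h1 := ih 1
      have h2 := ih 2
      rw [List.length_cons]
      fin_cases i
      · simp [G]; omega
      · simp only [G, Sum.elim_inl, Fin.isValue, Fin.mk_one, Matrix.cons_val_one,
          Matrix.cons_val_zero]
        generalize F 0 = y at *
        rcases y with _ | ⟨_ | _, x⟩ <;> cases b <;> cases k <;>
          simp [PolyEst.caseHead] at * <;> omega
      · simp [G]; omega
  have := FPon.foldr (env := env) (G := G) hG (init := fun _ _ => []) (par := fun i => i.elim)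
    ⟨.X, fun w init par i => by
      rw [Polynomial.eval_X]
      exact (h₂ w init par i).trans (by omega)⟩ hf (fun _ => .nil) (fun i => i.elim) 1
  exact this.of_eq fun p => by rw [h₁]; rfl

/-- The component number `i` of a tuple. -/
def component (i : ℕ) (w : Word) : Word := splitC true ((splitC false)^[i] w)

theorem component_tuple (l : List Word) (i : ℕ) (hi : i < l.length) :
    component i (tuple l) = l[i] := by
  induction l generalizing i with
  | nil => simp at hi
  | cons w l ih =>
    cases l with
    | nil =>
      have : i = 0 := by simpa using hi
      subst this
      exact splitC_true_double w
    | cons v l =>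
      cases i with
      | zero => exact splitC_true_append _ _
      | succ i =>
        have := ih i (by simpa using hi)
        unfold component at *
        rw [Function.iterate_succ_apply, PolyEst.tuple, splitC_false_append, this]
        simp

theorem FPon.component (i : ℕ) (hf : FPon env f) : FPon env fun p => component i (f p) := by
  refine FPon.splitC true ?_
  induction i with
  | zero => exact hf
  | succ i ih => simpa only [Function.iterate_succ_apply'] using ih.splitC false

theorem component_enc {m : ℕ} (K : Fin m → ℕ) (i : Fin m) :
    component i (Coded.enc K) = Nat.bits (K i) := by
  refine (component_tuple _ i (by simp)).trans ?_
  simp [Coded.enc]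

/-! ### Division with a unary divisor -/

/-- Long division starts at the most significant digit, the last one of the list. The minimum with
`d` is void for `d ≥ 1`; for `d = 0` it keeps the unary remainder from growing exponentially. -/
def remN (d : ℕ) : Word → ℕ
  | [] => 0
  | b :: w => min d (if d ≤ 2 * remN d w + b.toNat then 2 * remN d w + b.toNat - d
      else 2 * remN d w + b.toNat)

def quotW (d : ℕ) : Word → Word
  | [] => []
  | b :: w => decide (d ≤ 2 * remN d w + b.toNat) :: quotW d w

/-- Leading zeros are kept, so that repeated division has an evident length bound. -/
theorem length_quotW (d : ℕ) (w : Word) : (quotW d w).length = w.length := by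
  induction w with
  | nil => rfl
  | cons b w ih => simp [quotW, ih]

theorem remN_add_val_quotW {d : ℕ} (hd : 1 ≤ d) (w : Word) :
    remN d w < d ∧ val w = d * val (quotW d w) + remN d w := by
  induction w with
  | nil => simp [remN, val, quotW]; omega
  | cons b w ih =>
    obtain ⟨h1, h2⟩ := ih
    have hb : b.toNat ≤ 1 := Bool.toNat_le b
    simp only [remN, quotW, val]
    by_cases h : d ≤ 2 * remN d w + b.toNat
    · simp only [h, if_true, decide_true, Bool.toNat_true, h2]
      refine ⟨by omega, ?_⟩
      rw [min_eq_right (by omega), mul_add, mul_add, mul_one, mul_left_comm]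
      omega
    · simp only [h, if_false, decide_false, Bool.toNat_false, h2]
      refine ⟨by omega, ?_⟩
      rw [min_eq_right (by omega), mul_add, mul_add, mul_zero, mul_left_comm]
      omega

theorem val_quotW {d : ℕ} (hd : 1 ≤ d) (w : Word) : val (quotW d w) = val w / d := by
  obtain ⟨h1, h2⟩ := remN_add_val_quotW hd w
  rw [h2, Nat.mul_add_div (by omega), Nat.div_eq_of_lt h1, add_zero]

theorem FPon.quotW (ha : FPN env a) (hf : FPon env f) : FPon env fun p => quotW (a p) (f p) := by
  -- `X` is, in unary, twice the remainder plus the next digit. Dropping `|X|` letters from the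
  -- divisor leaves nothing iff the divisor is at most `|X|`, which decides the digit of the
  -- quotient. Accumulator `true` is the remainder, `false` the quotient.
  let X : Bool → (Bool ⊕ Unit → Word) → Word := fun b v =>
    v (.inl true) ++ (v (.inl true) ++ bif b then [true] else [])
  let G : Bool → Bool → (Bool ⊕ Unit → Word) → Word := fun b k v =>
    bif k then (if (v (.inr ())).drop (X b v).length = [] then (X b v).drop (v (.inr ())).length
      else X b v).take (v (.inr ())).length
    else if (v (.inr ())).drop (X b v).length = [] then true :: v (.inl false)
      else false :: v (.inl false)
  have hX : ∀ b, FPon (fun i (v : Bool ⊕ Unit → Word) => v i) (X b) := fun b =>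
    (FP.proj _).toFPon.append ((FP.proj _).toFPon.append (FPon.const _))
  have hG : ∀ b k, FP (G b k) := fun b k => by
    have h0 := (hX b).drop (FP.proj (Sum.inr ())).toFPon
    cases k
    · exact (h0.iteNil ((FP.proj _).toFPon.cons _) ((FP.proj _).toFPon.cons _)).toFP
    · exact ((FP.proj _).toFPon.take (h0.iteNil ((FP.proj _).toFPon.drop (hX b)) (hX b))).toFP
  have key : ∀ (w : Word) (init : Bool → Word) (par : Unit → Word),
      (w.foldr (fun b acc k => G b k (Sum.elim acc par)) init true).length
        ≤ (init true).length + (par ()).length ∧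
      (w.foldr (fun b acc k => G b k (Sum.elim acc par)) init false).length
        ≤ w.length + (init false).length ∧
      (init true = [] → (w.foldr (fun b acc k => G b k (Sum.elim acc par)) init true).length
        = remN (par ()).length w) ∧
      (init true = [] → init false = [] →
        w.foldr (fun b acc k => G b k (Sum.elim acc par)) init false
          = PolyEst.quotW (par ()).length w) := by
    intro w init par
    induction w with
    | nil => simp +contextual [remN, PolyEst.quotW]
    | cons b w ih =>
      rw [List.foldr_cons]
      generalize w.foldr (fun b acc k => G b k (Sum.elim acc par)) init = F at *
      obtain ⟨h1, h2, h3, h4⟩ := ih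
      have hXl : (X b (Sum.elim F par)).length = 2 * (F true).length + b.toNat := by
        cases b <;> simp [X] <;> ring
      refine ⟨?_, ?_, fun h0 => ?_, fun h0 h0' => ?_⟩
      · simp only [G, cond_true, Sum.elim_inr, List.length_take]; omega
      · simp only [G, cond_false, Sum.elim_inl, List.length_cons]
        split_ifs <;> simp <;> omega
      · simp only [G, cond_true, Sum.elim_inr, List.length_take, List.drop_eq_nil_iff, remN, hXl,
          ← h3 h0]
        split_ifs <;> simp [hXl]
      · simp only [G, cond_false, Sum.elim_inr, Sum.elim_inl, List.drop_eq_nil_iff,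
          PolyEst.quotW, hXl, ← h3 h0, h4 h0 h0']
        split_ifs with h <;> simp [h]
  have := FPon.foldr (env := env) (G := G) hG (init := fun _ _ => [])
    (par := fun _ p => List.replicate (a p) true)
    ⟨.X, fun w init par i => by
      rw [Polynomial.eval_X]
      have h1 := length_le_size init true
      have h2 := length_le_size init false
      have h3 := length_le_size par ()
      cases i
      · exact (key w init par).2.1.trans (by omega)
      · exact (key w init par).1.trans (by omega)⟩ hf (fun _ => .nil) (fun _ => ha) false
  exact this.of_eq fun p => by rw [(key _ _ _).2.2.2 rfl rfl]; simp

/-- The number of trailing zeros of a number in binary notation. -/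
def trailing : Word → ℕ
  | false :: w => trailing w + 1
  | _ => 0

theorem FPon.trailing (hf : FPon env f) : FPN env fun p => trailing (f p) := by
  have key : ∀ w init : Word, (init = [] → w.foldr (fun b acc => bif b then [] else true :: acc) init
      = List.replicate (PolyEst.trailing w) true) ∧
      (w.foldr (fun b acc => bif b then [] else true :: acc) init).length
        ≤ w.length + init.length := by
    intro w init
    induction w with
    | nil => simp [PolyEst.trailing]
    | cons b w ih =>
      rw [List.foldr_cons]
      refine ⟨fun h => ?_, ?_⟩
      · rw [ih.1 h]
        cases b <;> simp [PolyEst.trailing, List.replicate_succ]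
      · cases b
        · have := ih.2; simp only [cond_false, List.length_cons]; omega
        · simp
  have := FPon.foldr₁ (env := env) (ι' := Empty)
    (G := fun b v => bif b then [] else true :: v (.inl ()))
    (fun b => by cases b; exacts [(FP.proj _).cons _, .nil])
    (init := fun _ => []) (par := fun i => i.elim)
    ⟨.X, fun w init par => by
      rw [Polynomial.eval_X]
      exact (key w init).2.trans (by omega)⟩ hf .nil (fun i => i.elim)
  exact this.of_eq fun p => (key _ _).1 rfl

theorem FPon.iterate_quotW {b : P → ℕ} (ha : FPN env a) (hb : FPN env b) (hf : FPon env f) :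
    FPon env fun p => (PolyEst.quotW (a p))^[b p] (f p) := by
  have key : ∀ (w init : Word) (d : ℕ), w.foldr (fun _ acc => PolyEst.quotW d acc) init
      = (PolyEst.quotW d)^[w.length] init := by
    intro w init d
    induction w with
    | nil => rfl
    | cons b w ih => rw [List.foldr_cons, ih, List.length_cons, Function.iterate_succ_apply']
  have hlen : ∀ (d n : ℕ) (w : Word), ((PolyEst.quotW d)^[n] w).length = w.length := by
    intro d n w
    induction n with
    | zero => rfl
    | succ n ih => rw [Function.iterate_succ_apply', length_quotW, ih]
  have := FPon.foldr₁ (env := env) (ι' := Unit)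
    (G := fun b v => PolyEst.quotW (v (.inr ())).length (v (.inl ())))
    (fun b => (FPon.quotW (FP.proj _).toFPon.length (FP.proj _).toFPon).toFP)
    (par := fun _ p => List.replicate (a p) true)
    ⟨.X, fun w init par => by
      rw [Polynomial.eval_X]
      simp only [Sum.elim_inl, Sum.elim_inr, key, hlen]
      omega⟩ hb hf (fun _ => ha)
  exact this.of_eq fun p => by
    simp only [Sum.elim_inl, Sum.elim_inr, key]; simp

theorem val_iterate_quotW {d : ℕ} (hd : 1 ≤ d) (n : ℕ) (w : Word) :
    val ((quotW d)^[n] w) = val w / d ^ n := by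
  induction n with
  | zero => simp
  | succ n ih => rw [Function.iterate_succ_apply', val_quotW hd, ih, Nat.div_div_eq_div_mul, pow_succ]

/-- A number that may carry leading zeros is zero iff it has no digit `true`. Filtering turns this
test into a test for the empty word, the form in which `exists_machine` expects its search
condition. -/
theorem FPon.filterId (hf : FPon env f) : FPon env fun p => (f p).filter id := by
  have key : ∀ w init : Word, w.foldr (fun b acc => bif b then true :: acc else acc) init
      = w.filter id ++ init := by
    intro w init
    induction w with
    | nil => rfl
    | cons b w ih => rw [List.foldr_cons, ih]; cases b <;> rfl
  have := FPon.foldr₁ (env := env) (ι' := Empty)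
    (G := fun b v => bif b then true :: v (.inl ()) else v (.inl ()))
    (fun b => by cases b; exacts [FP.proj _, (FP.proj _).cons _])
    (init := fun _ => []) (par := fun i => i.elim)
    ⟨.X, fun w init par => by
      rw [Polynomial.eval_X]
      simp only [Sum.elim_inl, key, List.length_append]
      have := List.length_filter_le id w
      exact Nat.add_le_add_right this _ |>.trans (by omega)⟩ hf .nil (fun i => i.elim)
  exact this.of_eq fun p => (key _ _).trans (List.append_nil _)

theorem filter_id_eq_nil_iff (w : Word) : w.filter id = [] ↔ val w = 0 := by
  induction w with
  | nil => simp [val]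
  | cons b w ih => cases b <;> simp_all [val]

end Tuples

/-! ## Simulation of Turing machines by polynomial-time functions -/

section Zipper

/-- The symbols to the left and to the right of a head, nearest symbol first. -/
abbrev Zipper := List (Option Bool) × List (Option Bool)

def Zipper.move (z : Zipper) (s : Option Bool) : Move → Zipper
  | .left => (z.1.tail, z.1.headD none :: s :: z.2.tail)
  | .stay => (z.1, s :: z.2.tail)
  | .right => (s :: z.1, z.2.tail)

/-- The zipper `z` shows the given cells from the given head position. -/
def Zipper.Shows (z : Zipper) (cells : ℤ → Option Bool) (head : ℤ) : Prop :=
  (∀ i : ℕ, cells (head + i) = z.2.getD i none) ∧ ∀ i : ℕ, cells (head - 1 - i) = z.1.getD i none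

theorem Zipper.Shows.read {z : Zipper} {cells : ℤ → Option Bool} {head : ℤ}
    (h : z.Shows cells head) : cells head = z.2.headD none := by
  have := h.1 0
  rcases z with ⟨l, _ | ⟨s, r⟩⟩ <;> simpa using this

theorem Zipper.Shows.move {z : Zipper} {cells : ℤ → Option Bool} {head : ℤ}
    (h : z.Shows cells head) (s : Option Bool) (mv : Move) :
    (z.move s mv).Shows (Function.update cells head s) (head + mv.offset) := by
  obtain ⟨h1, h2⟩ := h
  obtain ⟨l, r⟩ := z
  have hr : ∀ i : ℕ, Function.update cells head s (head + 1 + i) = r.tail.getD i none := by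
    intro i
    rw [Function.update_of_ne (by omega)]
    have := h1 (i + 1)
    push_cast at this
    rw [show head + 1 + (i : ℤ) = head + (i + 1) by ring, this]
    cases r <;> simp
  have hl : ∀ i : ℕ, Function.update cells head s (head - 1 - i) = l.getD i none := by
    intro i
    rw [Function.update_of_ne (by omega)]
    exact h2 i
  cases mv with
  | left =>
    refine ⟨fun i => ?_, fun i => ?_⟩
    · rcases i with _ | _ | i
      · have := hl 0
        simp only [Move.offset, Zipper.move] at *
        rw [show head + -1 + ((0 : ℕ) : ℤ) = head - 1 - (0 : ℕ) by simp; ring, this]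
        cases l <;> simp
      · simp [Move.offset, Zipper.move]
      · have := hr i
        simp only [Move.offset, Zipper.move] at *
        rw [show head + -1 + ((i + 1 + 1 : ℕ) : ℤ) = head + 1 + i by push_cast; ring, this]
        simp
    · have := hl (i + 1)
      simp only [Move.offset, Zipper.move] at *
      rw [show head + -1 - 1 - (i : ℤ) = head - 1 - (i + 1 : ℕ) by push_cast; ring, this]
      cases l <;> simp
  | stay =>
    refine ⟨fun i => ?_, fun i => ?_⟩
    · rcases i with _ | i
      · simp [Move.offset, Zipper.move]
      · have := hr i
        simp only [Move.offset, Zipper.move] at *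
        rw [show head + 0 + ((i + 1 : ℕ) : ℤ) = head + 1 + i by push_cast; ring, this]
        simp
    · simpa [Move.offset, Zipper.move] using hl i
  | right =>
    refine ⟨fun i => hr i, fun i => ?_⟩
    rcases i with _ | i
    · simp [Move.offset, Zipper.move]
    · have := hl i
      simp only [Move.offset, Zipper.move] at *
      rw [show head + 1 - 1 - ((i + 1 : ℕ) : ℤ) = head - 1 - i by push_cast; ring, this]
      simp

/-- Encoding of a symbol by two bits. -/
def symW : Option Bool → Word
  | none => [false, true]
  | some b => [b, b]

def symsW (l : List (Option Bool)) : Word := l.flatMap symW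

theorem symsW_cons (s : Option Bool) (l : List (Option Bool)) :
    symsW (s :: l) = symW s ++ symsW l := by simp [symsW]

theorem symsW_tail (l : List (Option Bool)) : (symsW l).tail.tail = symsW l.tail := by
  rcases l with _ | ⟨_ | _, l⟩ <;> simp [symsW, symW]

/-- The first symbol of an encoded list of symbols. -/
def headSym (w : Word) : Word :=
  caseHead w [false, true] (caseHead w.tail [false, true] [false, false] [false, true])
    (caseHead w.tail [false, true] [false, true] [true, true])

theorem headSym_symsW (l : List (Option Bool)) : headSym (symsW l) = symW (l.headD none) := by
  rcases l with _ | ⟨_ | _ | _, l⟩ <;> simp [symsW, symW, headSym, caseHead]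

theorem length_headSym (w : Word) : (headSym w).length = 2 := by
  rcases w with _ | ⟨_ | _, _ | ⟨_ | _, w⟩⟩ <;> simp [headSym, caseHead]

theorem symsW_map_some (w : Word) : symsW (w.map some) = double w := by
  induction w with
  | nil => rfl
  | cons b w ih => simp [symsW_cons, ih, double, symW]

/-- The bits before the first blank. -/
def bitsBefore : List (Option Bool) → Word
  | some b :: l => b :: bitsBefore l
  | _ => []

/-- The code `01` of the blank is also the separator of tuples, so reading up to the first blank is
the extraction of a first component. -/
theorem splitC_symsW (l : List (Option Bool)) : splitC true (symsW l) = bitsBefore l := by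
  induction l with
  | nil => rfl
  | cons s l ih => rcases s with _ | _ | _ <;> simp [symsW_cons, symW, splitC, bitsBefore, ih]

theorem getD_bitsBefore (l : List (Option Bool)) :
    (∀ i < (bitsBefore l).length, l.getD i none = (bitsBefore l)[i]?) ∧
      l.getD (bitsBefore l).length none = none := by
  induction l with
  | nil => simp [bitsBefore]
  | cons s l ih =>
    rcases s with _ | b
    · simp [bitsBefore]
    · refine ⟨fun i hi => ?_, ?_⟩
      · rcases i with _ | i
        · simp [bitsBefore]
        · simpa [bitsBefore] using ih.1 i (by simpa [bitsBefore] using hi)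
      · simpa [bitsBefore] using ih.2

end Zipper

/-! ### Look-up tables for finite functions -/

section Table

variable {P : Type*} {ι : Type} [Fintype ι] {env : ι → P → Word} {f : P → Word}

theorem FPon.headSym (hf : FPon env f) : FPon env fun p => headSym (f p) :=
  hf.caseHead (.const _) (hf.tail.caseHead (.const _) (.const _) (.const _))
    (hf.tail.caseHead (.const _) (.const _) (.const _))

/-- Functions with finitely many relevant arguments. -/
theorem exists_table {A : Type*} [Finite A] {key : A → Word} (hkey : Function.Injective key)
    (res : A → Word) : ∃ T : Word → Word, (∀ a, T (key a) = res a) ∧ (∃ C, ∀ w, (T w).length ≤ C) ∧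
      FP fun v : Unit → Word => T (v ()) := by
  classical
  have : Fintype A := Fintype.ofFinite A
  have h : ∀ s : Finset A, ∃ T : Word → Word, (∀ a ∈ s, T (key a) = res a) ∧
      (∃ C, ∀ w, (T w).length ≤ C) ∧ FP fun v : Unit → Word => T (v ()) := by
    intro s
    induction s using Finset.induction_on with
    | empty => exact ⟨fun _ => [], by simp, ⟨0, by simp⟩, FP.nil⟩
    | insert a s ha ih =>
      obtain ⟨T, h1, ⟨C, h2⟩, h3⟩ := ih
      refine ⟨fun w => if w = key a then res a else T w, fun b hb => ?_,
        ⟨max (res a).length C, fun w => ?_⟩,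
        (FPon.iteEq (key a) (FP.proj _).toFPon (.const (res a)) h3.toFPon).toFP⟩
      · by_cases hba : b = a
        · subst hba; simp
        · simp [hkey.ne hba, h1 b (by simpa [hba] using hb)]
      · dsimp only
        split_ifs
        · exact le_max_left _ _
        · exact (h2 w).trans (le_max_right _ _)
  obtain ⟨T, h1, h2⟩ := h Finset.univ
  exact ⟨T, fun a => h1 a (by simp), h2⟩

theorem FPon.flatMap {α : Type*} (l : List α) {f : α → P → Word} (hf : ∀ a, FPon env (f a)) :
    FPon env fun p => l.flatMap fun a => f a p := by
  induction l with
  | nil => exact .nil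
  | cons a l ih => simpa using (hf a).append ih

theorem FPon.table {T : Word → Word} (hT : FP fun v : Unit → Word => T (v ())) (hf : FPon env f) :
    FPon env fun p => T (f p) := FPon.comp hT (f := fun _ => f) fun _ => hf

end Table

/-! ### Configurations with zippers in place of tapes -/

namespace TM

variable {n : ℕ} (M : TM n)

/-- All tapes of a machine. -/
abbrev Tape := Fin n ⊕ Fin (M.work + 1)

/-- The transition function on all tapes; a halted machine stays in its configuration. -/
def total (q : M.State) (s : M.Tape → Option Bool) : M.State × (M.Tape → Option Bool × Move) :=
  match M.δ q (fun i => s (.inl i)) (fun j => s (.inr j)) with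
  | none => (q, fun t => (s t, .stay))
  | some d => (d.1, Sum.elim (fun i => (s (.inl i), d.2.1 i)) d.2.2)

/-- Configurations with zippers; the numbers count the moves of the head of the output tape
to the right (`true`) and to the left (`false`). -/
structure ZCfg where
  state : M.State
  zip : M.Tape → Zipper
  moves : Bool → ℕ

variable {M}

def moveCount (b : Bool) : Move → ℕ
  | .left => bif b then 0 else 1
  | .stay => 0
  | .right => bif b then 1 else 0

def ZCfg.step (c : M.ZCfg) : M.ZCfg :=
  let d := M.total c.state fun t => (c.zip t).2.headD none
  ⟨d.1, fun t => (c.zip t).move (d.2 t).1 (d.2 t).2,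
    fun b => c.moves b + moveCount b (d.2 (.inr 0)).2⟩

structure ZCfg.Shows (inp : Fin n → ℤ → Option Bool) (c : M.ZCfg) (d : M.Cfg) : Prop where
  state : c.state = d.state
  inp : ∀ i, (c.zip (.inl i)).Shows (inp i) (d.inHead i)
  cells : ∀ j, (c.zip (.inr j)).Shows (d.cells j) (d.head j)
  moves : (c.moves true : ℤ) - c.moves false = d.head 0

theorem ZCfg.Shows.step {inp : Fin n → ℤ → Option Bool} {c : M.ZCfg} {d : M.Cfg}
    (h : c.Shows inp d) : c.step.Shows inp ((M.step inp d).getD d) := by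
  have hi : ∀ i, (c.zip (.inl i)).2.headD none = inp i (d.inHead i) := fun i =>
    (h.inp i).read.symm
  have hj : ∀ j, (c.zip (.inr j)).2.headD none = d.cells j (d.head j) := fun j =>
    (h.cells j).read.symm
  unfold ZCfg.step TM.step TM.total
  simp only [hi, hj, h.state]
  cases hδ : M.δ d.state (fun i => inp i (d.inHead i)) (fun j => d.cells j (d.head j)) with
  | none =>
    refine ⟨rfl, fun i => ?_, fun j => ?_, ?_⟩
    · have := (h.inp i).move (inp i (d.inHead i)) .stay
      simp only [Move.offset, Function.update_eq_self] at this
      simpa only [Option.map_none, Option.getD_none, Move.offset, hi, add_zero] using this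
    · have := (h.cells j).move (d.cells j (d.head j)) .stay
      simp only [Move.offset, Function.update_eq_self] at this
      simpa only [Option.map_none, Option.getD_none, Move.offset, hj, add_zero] using this
    · simpa [moveCount] using h.moves
  | some a =>
    refine ⟨rfl, fun i => ?_, fun j => ?_, ?_⟩
    · have := (h.inp i).move (inp i (d.inHead i)) (a.2.1 i)
      simpa [hi] using this
    · exact (h.cells j).move _ _
    · have := h.moves
      simp only [Option.map_some, Option.getD_some, Sum.elim_inr]
      rcases (a.2.2 0).2 <;> simp [moveCount, Move.offset] <;> omega

theorem ZCfg.Shows.iterate {inp : Fin n → ℤ → Option Bool} {c : M.ZCfg}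
    (h : c.Shows inp M.init) (t : ℕ) : (ZCfg.step^[t] c).Shows inp (M.run inp t) := by
  induction t with
  | zero => exact h
  | succ t ih =>
    rw [Function.iterate_succ_apply', TM.run_succ]
    exact ih.step

variable (M) in
/-- The initial configuration with the words `x` on the input tapes. -/
def zinit (x : Fin n → Word) : M.ZCfg :=
  ⟨M.start, Sum.elim (fun i => ([], (x i).map some)) fun _ => ([], []), fun _ => 0⟩

theorem zinit_shows (x : Fin n → Word) :
    (M.zinit x).Shows (fun i => wordTape (x i)) M.init := by
  refine ⟨rfl, fun i => ⟨fun k => ?_, fun k => ?_⟩, fun j => ⟨fun k => ?_, fun k => ?_⟩, rfl⟩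
  · simp only [TM.init, zero_add, wordTape_natCast, zinit, Sum.elim_inl]
    rw [List.getD_eq_getElem?_getD, List.getElem?_map]
    cases (x i)[k]? <;> rfl
  · refine (if_neg ?_).trans (by simp [zinit])
    simp only [TM.init]; omega
  · simp [TM.init, zinit]
  · simp [TM.init, zinit]

/-- Moves the head without writing. -/
def shiftZ (b : Bool) (z : Zipper) : Zipper :=
  bif b then (z.2.headD none :: z.1, z.2.tail) else (z.1.tail, z.1.headD none :: z.2)

theorem Zipper.Shows.shift {z : Zipper} {cells : ℤ → Option Bool} {head : ℤ}
    (h : z.Shows cells head) (b : Bool) :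
    (shiftZ b z).Shows cells (head + bif b then 1 else -1) := by
  have := h.read
  cases b
  · obtain ⟨h1, h2⟩ := h
    refine ⟨fun i => ?_, fun i => ?_⟩
    · rcases i with _ | i
      · have := h2 0
        simp only [cond_false, shiftZ]
        rw [show head + -1 + ((0 : ℕ) : ℤ) = head - 1 - (0 : ℕ) by simp; ring, this]
        rcases z with ⟨_ | _, r⟩ <;> simp
      · have := h1 i
        simp only [cond_false, shiftZ]
        rw [show head + -1 + ((i + 1 : ℕ) : ℤ) = head + i by push_cast; ring, this]
        simp
    · have := h2 (i + 1)
      simp only [cond_false, shiftZ]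
      rw [show head + -1 - 1 - (i : ℤ) = head - 1 - (i + 1 : ℕ) by push_cast; ring, this]
      rcases z with ⟨_ | _, r⟩ <;> simp
  · have h3 := h.move (cells head) .right
    rw [Function.update_eq_self] at h3
    rw [this] at h3
    exact h3

theorem Zipper.Shows.shift_iterate {z : Zipper} {cells : ℤ → Option Bool} {head : ℤ}
    (h : z.Shows cells head) (b : Bool) (k : ℕ) :
    ((shiftZ b)^[k] z).Shows cells (head + k * bif b then 1 else -1) := by
  induction k with
  | zero => simpa using h
  | succ k ih =>
    rw [Function.iterate_succ_apply']
    have := Zipper.Shows.shift ih b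
    push_cast
    rwa [show ∀ x y : ℤ, head + (x + 1) * y = head + x * y + y by intro x y; ring]

/-- The content of the output tape. -/
def ZCfg.output (c : M.ZCfg) : Word :=
  bitsBefore ((shiftZ true)^[c.moves false] ((shiftZ false)^[c.moves true] (c.zip (.inr 0)))).2

/-- The recorded moves of the output head are undone: left as often as it went right, then right as
often as it went left. The zipper then stands at cell `0`, where the output begins. -/
theorem ZCfg.Shows.output {inp : Fin n → ℤ → Option Bool} {c : M.ZCfg} {d : M.Cfg}
    (h : c.Shows inp d) : d.output = c.output := by
  have h1 := Zipper.Shows.shift_iterate (Zipper.Shows.shift_iterate (h.cells 0) false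
    (c.moves true)) true (c.moves false)
  have h2 : d.head 0 + (c.moves true * bif false then 1 else -1 : ℤ)
      + (c.moves false * bif true then 1 else -1 : ℤ) = 0 := by
    rw [← h.moves]; simp only [cond_false, cond_true]; ring
  rw [h2] at h1
  obtain ⟨h3, h4⟩ := getD_bitsBefore
    ((shiftZ true)^[c.moves false] ((shiftZ false)^[c.moves true] (c.zip (.inr 0)))).2
  refine d.output_eq _ (fun i hi => ?_) ?_
  · unfold ZCfg.output at hi ⊢
    rw [← h3 i hi, ← h1.1 i, zero_add]
  · rw [← h4, ← h1.1, zero_add]; rfl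

end TM

/-! ### Machine steps as polynomial-time functions -/

section Simulation

variable {P : Type*} {ι : Type} [Fintype ι] {env : ι → P → Word} {n : ℕ}

/-- All codes of symbols have length 2, so their concatenation is cut at known places. This makes
the keys of the look-up tables in `exists_simulation` injective. -/
theorem flatMap_symW_append_injective {α : Type*} (l : List α) {s s' : α → Option Bool}
    {u u' : Word} (h : (l.flatMap fun t => symW (s t)) ++ u = (l.flatMap fun t => symW (s' t)) ++ u') :
    (∀ t ∈ l, s t = s' t) ∧ u = u' := by
  induction l with
  | nil => simpa using h
  | cons a l ih =>
    simp only [List.flatMap_cons, List.append_assoc] at h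
    have hl : ∀ o : Option Bool, (symW o).length = 2 := by rintro (_ | _) <;> rfl
    obtain ⟨h1, h2⟩ := List.append_inj h (by rw [hl, hl])
    obtain ⟨h3, h4⟩ := ih h2
    refine ⟨fun t ht => ?_, h4⟩
    rcases List.mem_cons.1 ht with rfl | ht
    · revert h1
      rcases s t with _ | _ | _ <;> rcases s' t with _ | _ | _ <;> simp [symW]
    · exact h3 t ht

theorem FPon.shiftZ {z : P → Zipper} (h₁ : FPon env fun p => symsW (z p).1)
    (h₂ : FPon env fun p => symsW (z p).2) {k : P → ℕ} (hk : FPN env k) (b c : Bool) :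
    FPon env fun p => symsW (bif c then ((TM.shiftZ b)^[k p] (z p)).2
      else ((TM.shiftZ b)^[k p] (z p)).1) := by
  let G : Bool → Bool → (Bool ⊕ Empty → Word) → Word := fun _ c v =>
    bif b == c then (v (.inl c)).tail.tail else PolyEst.headSym (v (.inl !c)) ++ v (.inl c)
  have hG : ∀ a c, FP (G a c) := fun a c => by
    by_cases h : b = c
    · subst h; simpa [G] using (FP.proj (ι := Bool ⊕ Empty) (.inl b)).tail.tail
    · have : (b == c) = false := by simpa using h
      simp only [G, this, cond_false]
      exact ((FP.proj _).toFPon.headSym.append (FP.proj _).toFPon).toFP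
  have key : ∀ (w : Word) (z : Zipper) (par : Empty → Word),
      w.foldr (fun a acc k => G a k (Sum.elim acc par))
        (fun c => symsW (bif c then z.2 else z.1))
        = fun c => symsW (bif c then ((TM.shiftZ b)^[w.length] z).2
          else ((TM.shiftZ b)^[w.length] z).1) := by
    intro w z par
    induction w with
    | nil => rfl
    | cons a w ih =>
      rw [List.foldr_cons, ih, List.length_cons, Function.iterate_succ_apply']
      generalize (TM.shiftZ b)^[w.length] z = y
      funext c
      cases b <;> cases c <;>
        simp only [G, TM.shiftZ, Sum.elim_inl, beq_self_eq_true, cond_true, cond_false,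
          symsW_tail, symsW_cons, headSym_symsW, Bool.not_true, Bool.not_false] <;> rfl
  have hlen : ∀ (w : Word) (init : Bool → Word) (par : Empty → Word) c,
      (w.foldr (fun a acc k => G a k (Sum.elim acc par)) init c).length
        ≤ (init c).length + 2 * w.length := by
    intro w init par c
    induction w generalizing c with
    | nil => simp
    | cons a w ih =>
      rw [List.foldr_cons]
      generalize w.foldr (fun a acc k => G a k (Sum.elim acc par)) init = F at *
      have := ih c
      rw [List.length_cons]
      simp only [G, Sum.elim_inl]
      cases (b == c)
      · simp only [cond_false, List.length_append, length_headSym]; omega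
      · simp only [cond_true, List.length_tail]; omega
  have := FPon.foldr (env := env) hG (init := fun c p => symsW (bif c then (z p).2 else (z p).1))
    (par := fun i => i.elim) ⟨2 * .X, fun w init par c => by
      simp only [Polynomial.eval_mul, Polynomial.eval_ofNat, Polynomial.eval_X]
      have h1 := length_le_size init c
      exact (hlen w init par c).trans (by omega)⟩ hk
    (fun c => by cases c; exacts [h₁, h₂]) (fun i => i.elim) c
  exact this.of_eq fun p => by rw [key]; simp

def moveW : Move → Word
  | .stay => []
  | .left => [false]
  | .right => [true]

/-- A configuration becomes a fixed finite family of words: both halves of every tape, the state,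
and the move counters of the output head. What a step writes and how the heads move depends only on
the state and the scanned symbols, hence is read from finite tables. Every word grows by at most a
constant, as iteration requires. That the state word depends on nothing else shows that it is
constant in initial configurations. -/
theorem TM.exists_simulation (M : TM n) :
    ∃ (e : M.ZCfg → (M.Tape × Bool) ⊕ Option Bool → Word)
      (G : (M.Tape × Bool) ⊕ Option Bool → ((M.Tape × Bool) ⊕ Option Bool → Word) → Word),
      (∀ c t, e c (.inl (t, true)) = symsW (c.zip t).2) ∧
      (∀ c t, e c (.inl (t, false)) = symsW (c.zip t).1) ∧
      (∀ c b, e c (.inr (some b)) = List.replicate (c.moves b) true) ∧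
      (∀ c c', c.state = c'.state → e c (.inr none) = e c' (.inr none)) ∧
      (∀ k, FP (G k)) ∧ (∀ c, (fun k => G k (e c)) = e c.step) ∧
      ∃ C, ∀ v k, (G k v).length ≤ (v k).length + C := by
  have := M.finite
  obtain ⟨N, ⟨eq⟩⟩ := Finite.exists_equiv_fin M.State
  let code : M.State → Word := fun q => List.replicate (eq q) true
  have hcode : Function.Injective code := fun q q' h => by
    have := congrArg List.length h
    simp only [code, List.length_replicate] at this
    exact eq.injective (Fin.ext this)
  let L : List M.Tape := Finset.univ.toList
  let key : M.State × (M.Tape → Option Bool) → Word :=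
    fun a => (L.flatMap fun t => symW (a.2 t)) ++ code a.1
  have hkey : Function.Injective key := fun a a' h => by
    obtain ⟨h1, h2⟩ := flatMap_symW_append_injective L h
    exact Prod.ext (hcode h2) (funext fun t => h1 t (by simp [L]))
  obtain ⟨T, hT, ⟨C, hC⟩, hTF⟩ := exists_table hkey fun a => code (M.total a.1 a.2).1
  choose S hS hS' hSF using fun t => exists_table hkey fun a => symW ((M.total a.1 a.2).2 t).1
  choose Cs hCs using hS'
  choose V hV _ hVF using fun t => exists_table hkey fun a => moveW ((M.total a.1 a.2).2 t).2
  let keyv : ((M.Tape × Bool) ⊕ Option Bool → Word) → Word :=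
    fun v => (L.flatMap fun t => headSym (v (.inl (t, true)))) ++ v (.inr none)
  have hkeyv : FPon (fun i (v : (M.Tape × Bool) ⊕ Option Bool → Word) => v i) keyv :=
    (FPon.flatMap L fun t => (FP.proj _).toFPon.headSym).append (FP.proj _).toFPon
  let G : (M.Tape × Bool) ⊕ Option Bool → ((M.Tape × Bool) ⊕ Option Bool → Word) → Word
    | .inl (t, true) => fun v => caseHead (V t (keyv v))
        (S t (keyv v) ++ (v (.inl (t, true))).tail.tail)
        (headSym (v (.inl (t, false))) ++ (S t (keyv v) ++ (v (.inl (t, true))).tail.tail))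
        (v (.inl (t, true))).tail.tail
    | .inl (t, false) => fun v => caseHead (V t (keyv v)) (v (.inl (t, false)))
        (v (.inl (t, false))).tail.tail (S t (keyv v) ++ v (.inl (t, false)))
    | .inr none => fun v => T (keyv v)
    | .inr (some true) => fun v => caseHead (V (.inr 0) (keyv v)) (v (.inr (some true)))
        (v (.inr (some true))) (true :: v (.inr (some true)))
    | .inr (some false) => fun v => caseHead (V (.inr 0) (keyv v)) (v (.inr (some false)))
        (true :: v (.inr (some false))) (v (.inr (some false)))
  let e : M.ZCfg → (M.Tape × Bool) ⊕ Option Bool → Word := fun c x => match x with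
    | .inl (t, true) => symsW (c.zip t).2
    | .inl (t, false) => symsW (c.zip t).1
    | .inr none => code c.state
    | .inr (some b) => List.replicate (c.moves b) true
  have hke : ∀ c, keyv (e c) = key (c.state, fun t => (c.zip t).2.headD none) := fun c => by
    simp only [keyv, key, e, headSym_symsW]
  have hfst : ∀ c : M.ZCfg, (M.total c.state fun t => (c.zip t).2.headD none).1 = c.step.state :=
    fun c => rfl
  refine ⟨e, G, fun _ _ => rfl, fun _ _ => rfl, fun _ _ => rfl, fun c c' h => by simp only [e, h],
    ?_, ?_, C + ∑ t, Cs t + 2, ?_⟩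
  · rintro (⟨t, _ | _⟩ | _ | _ | _)
    · exact ((FPon.table (hVF t) hkeyv).caseHead (FP.proj _).toFPon (FP.proj _).toFPon.tail.tail
        ((FPon.table (hSF t) hkeyv).append (FP.proj _).toFPon)).toFP
    · exact ((FPon.table (hVF t) hkeyv).caseHead
        ((FPon.table (hSF t) hkeyv).append (FP.proj _).toFPon.tail.tail)
        ((FP.proj _).toFPon.headSym.append
          ((FPon.table (hSF t) hkeyv).append (FP.proj _).toFPon.tail.tail))
        (FP.proj _).toFPon.tail.tail).toFP
    · exact (FPon.table hTF hkeyv).toFP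
    · exact ((FPon.table (hVF _) hkeyv).caseHead (FP.proj _).toFPon ((FP.proj _).toFPon.cons _)
        (FP.proj _).toFPon).toFP
    · exact ((FPon.table (hVF _) hkeyv).caseHead (FP.proj _).toFPon (FP.proj _).toFPon
        ((FP.proj _).toFPon.cons _)).toFP
  · intro c
    funext x
    rcases x with ⟨t, _ | _⟩ | _ | _ | _
    · simp only [G, hke, hV, hS, e, TM.ZCfg.step, Zipper.move]
      cases ((M.total c.state fun t => (c.zip t).2.headD none).2 t).2 <;>
        simp only [moveW, caseHead, symsW_cons, symsW_tail]
    · simp only [G, hke, hV, hS, e, TM.ZCfg.step, Zipper.move]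
      cases ((M.total c.state fun t => (c.zip t).2.headD none).2 t).2 <;>
        simp only [moveW, caseHead, symsW_cons, symsW_tail, headSym_symsW]
    · simp only [G, hke, hT, e, TM.ZCfg.step]
    · simp only [G, hke, hV, e, TM.ZCfg.step]
      cases ((M.total c.state fun t => (c.zip t).2.headD none).2 (.inr 0)).2 <;>
        simp [moveW, caseHead, TM.moveCount, List.replicate_succ]
    · simp only [G, hke, hV, e, TM.ZCfg.step]
      cases ((M.total c.state fun t => (c.zip t).2.headD none).2 (.inr 0)).2 <;>
        simp [moveW, caseHead, TM.moveCount, List.replicate_succ]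
  · intro v x
    have hsum : ∀ t, Cs t ≤ ∑ t, Cs t := fun t =>
      Finset.single_le_sum (fun _ _ => Nat.zero_le _) (Finset.mem_univ t)
    generalize ∑ t, Cs t = B at *
    rcases x with ⟨t, _ | _⟩ | _ | _ | _
    · have h1 := hsum t
      have h2 := hCs t (keyv v)
      simp only [G]
      rcases V t (keyv v) with _ | ⟨_ | _, y⟩ <;> simp [caseHead] <;> omega
    · have h1 := hsum t
      have h2 := hCs t (keyv v)
      simp only [G]
      rcases V t (keyv v) with _ | ⟨_ | _, y⟩ <;> simp [caseHead, length_headSym] <;> omega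
    · have h2 := hC (keyv v)
      simp only [G]
      omega
    · simp only [G]
      rcases V (.inr 0) (keyv v) with _ | ⟨_ | _, y⟩ <;> simp [caseHead]
    · simp only [G]
      rcases V (.inr 0) (keyv v) with _ | ⟨_ | _, y⟩ <;> simp [caseHead]

/-- The output of a machine after a number of steps that is given in unary. -/
theorem FPon.run (M : TM n) {u : P → ℕ} {x : Fin n → P → Word} (hu : FPN env u)
    (hx : ∀ i, FPon env (x i)) :
    FPon env fun p => (M.run (fun i => wordTape (x i p)) (u p)).output := by
  obtain ⟨e, G, e₁, e₂, e₃, e₄, hG, hstep, C, hC⟩ := M.exists_simulation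
  have hit : ∀ k c, (fun v k => G k v)^[k] (e c) = e (TM.ZCfg.step^[k] c) := by
    intro k c
    induction k with
    | zero => rfl
    | succ k ih => rw [Function.iterate_succ_apply', Function.iterate_succ_apply', ih, hstep]
  have hinit : ∀ k, FPon env fun p => e (M.zinit fun i => x i p) k := by
    rintro (⟨t, _ | _⟩ | _ | _)
    · simp only [e₂]
      rcases t with t | t <;> exact .const _
    · simp only [e₁]
      rcases t with t | t
      · exact (hx t).double.of_eq fun p => (symsW_map_some _).symm
      · exact .const _
    · exact (FPon.const (e (M.zinit fun _ => []) (.inr none))).of_eq fun p => e₄ _ _ rfl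
    · simp only [e₃]; exact .const _
  have hk : ∀ k, FPon env fun p => e (TM.ZCfg.step^[u p] (M.zinit fun i => x i p)) k := fun k => by
    have := FPon.iterate (env := env) hG ⟨(C + 1 : ℕ) * .X, fun w i k => by
      refine (iterate_length_le C hC w i k).trans ?_
      have h1 := length_le_size w k
      have h2 : (C + 1) * (i + size w) = C * i + C * size w + (i + size w) := by ring
      simp only [Polynomial.eval_mul, Polynomial.eval_natCast, Polynomial.eval_X, Nat.cast_id]
      rw [h2]; nlinarith [Nat.zero_le (C * size w)]⟩ k hu hinit
    exact this.of_eq fun p => by rw [List.length_replicate, hit]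
  have k₁ := hk (.inl (.inr 0, false))
  have k₂ := hk (.inl (.inr 0, true))
  have k₃ := hk (.inr (some true))
  have k₄ := hk (.inr (some false))
  simp only [e₁, e₂, e₃] at k₁ k₂ k₃ k₄
  have s := FPon.shiftZ k₁ k₂ k₃ false
  have s' := FPon.shiftZ (s false) (s true) k₄ true true
  refine (s'.splitC true).of_eq fun p => ?_
  rw [splitC_symsW]
  exact (TM.ZCfg.Shows.output ((TM.zinit_shows fun i => x i p).iterate (u p))).symm

end Simulation

/-! ## Turing machines for polynomial-time functions of clocked inputs -/

section Machine

variable {n : ℕ}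

/-- Reads at most `|k|` bits from the input tape `i` to the register `o`. -/
def Cmd.fetch (i : Fin n) (k t u o : ℕ) : Cmd n :=
  .seq (.copy k t u) (.seq (.loop (.inr t) (.seq (.pop (.inr t)) (.case (.inl i) .skip
    (.seq (.push u false) (.pop (.inl i))) (.seq (.push u true) (.pop (.inl i))))))
    (.moveRev (.inr u) o))

/-- The clock `k` is copied to `t`, where it is used up, so that it remains available for the next
input. The bits arrive in `u` in reverse order, and the move to `o` restores it. -/
theorem exec_fetch (i : Fin n) {k t u o : ℕ} (hkt : k ≠ t) (hku : k ≠ u) (htu : t ≠ u)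
    (hto : t ≠ o) (huo : u ≠ o) (S : Store n) (ht : S (.inr t) = []) (hu : S (.inr u) = [])
    (ho : S (.inr o) = []) :
    Exec (Cmd.fetch i k t u o) S
      (Function.update (Function.update S (.inl i) ((S (.inl i)).drop (S (.inr k)).length))
        (.inr o) ((S (.inl i)).take (S (.inr k)).length)) (18 * (S (.inr k)).length + 4) := by
  set c := S (.inr k) with hc
  set x := S (.inl i) with hx
  set T : ℕ → Store n := fun j => Function.update (Function.update (Function.update S (.inr t)
    (c.drop j)) (.inl i) (x.drop j)) (.inr u) (x.take j).reverse with hT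
  have hut : (.inr t : Reg n) ≠ .inr u := by simpa using htu
  have hTt : ∀ j, T j (.inr t) = c.drop j := fun j => by simp [hT, hut]
  have hTu : ∀ j, T j (.inr u) = (x.take j).reverse := fun j => by simp [hT]
  have hTi : ∀ j, T j (.inl i) = x.drop j := fun j => by simp [hT]
  have e₁ := exec_copy hkt hku htu S hu ht
  have e₂ := exec_loop (n := n) (r := .inr t) (c := (.seq (.pop (.inr t)) (.case (.inl i) .skip
    (.seq (.push u false) (.pop (.inl i))) (.seq (.push u true) (.pop (.inl i)))))) (T := T)
    (k := c.length) (t := 4) (fun j hj => by rw [hTt]; simpa using hj) (by rw [hTt]; simp)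
    (fun j _ => by
      have hi : Function.update (T j) (.inr t) (T j (.inr t)).tail (.inl i) = x.drop j := by
        rw [Function.update_of_ne (by simp)]; exact hTi j
      have htk : ∀ j, T (j + 1) = Function.update (Function.update (Function.update (T j) (.inr t)
          (T j (.inr t)).tail) (.inl i) (x.drop (j + 1))) (.inr u) (x.take (j + 1)).reverse := by
        intro j
        funext s
        by_cases h1 : s = .inr u
        · subst h1; simp [hTu]
        · by_cases h2 : s = .inl i
          · subst h2; simp [hTi]
          · by_cases h3 : s = .inr t
            · subst h3; simp [hTt, hut]
            · simp [h1, h2, h3, hT]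
      refine Exec.seq (t₁ := 1) (t₂ := 3) (.pop le_rfl) ?_ le_rfl
      rw [htk]
      rcases lt_or_ge j x.length with hj | hj
      · rw [List.drop_eq_getElem_cons hj] at hi
        rw [List.take_succ_eq_append_getElem hj]
        cases hb : x[j] with
        | false =>
          rw [hb] at hi
          refine .case_false hi ((Exec.seq (.push le_rfl) (.pop le_rfl) le_rfl).of_eq ?_) le_rfl
          rw [Function.update_comm (by simp)]
          congr 1
          · congr 1
            rw [Function.update_of_ne (by simp), hi]; rfl
          · rw [Function.update_of_ne hut.symm, hTu]; simp
        | true =>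
          rw [hb] at hi
          refine .case_true hi ((Exec.seq (.push le_rfl) (.pop le_rfl) le_rfl).of_eq ?_) le_rfl
          rw [Function.update_comm (by simp)]
          congr 1
          · congr 1
            rw [Function.update_of_ne (by simp), hi]; rfl
          · rw [Function.update_of_ne hut.symm, hTu]; simp
      · rw [List.drop_eq_nil_of_le hj] at hi
        refine .case_nil (t₁ := 2) hi ((Exec.skip (by omega)).of_eq ?_) le_rfl
        rw [List.drop_eq_nil_of_le (by omega), List.take_of_length_le (by omega), ← hi,
          Function.update_eq_self]
        symm
        rw [Function.update_eq_self_iff, Function.update_of_ne hut.symm, hTu,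
          List.take_of_length_le hj])
  have e₃ := exec_moveRev (n := n) (r := .inr u) (o := o) (by simpa using huo) (T c.length)
  have hT0 : T 0 = Function.update S (.inr t) c := by
    simp only [hT, List.drop_zero, List.take_zero, List.reverse_nil]
    rw [hx, show (Function.update (Function.update S (.inr t) c) (.inl i) (S (.inl i)) : Store n)
      = Function.update S (.inr t) c from Function.update_eq_self_iff.2 (by simp)]
    exact Function.update_eq_self_iff.2 (by rw [Function.update_of_ne hut.symm, hu])
  rw [hT0] at e₂
  refine ((e₁.seq (e₂.seq e₃ le_rfl) le_rfl).of_eq ?_).mono ?_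
  · rw [hTu]
    funext s
    by_cases h1 : s = .inr o
    · subst h1
      have h2 : (.inr o : Reg n) ≠ .inr t := by simpa using hto.symm
      have h3 : (.inr o : Reg n) ≠ .inr u := by simpa using huo.symm
      simp [hT, h2, h3, ho]
    · by_cases h2 : s = .inr u
      · subst h2; simp [h1, hu]
      · by_cases h3 : s = .inl i
        · subst h3; simp [hT]
        · by_cases h4 : s = .inr t
          · subst h4; simp [hT, h1, h2, ht]
          · simp [hT, h1, h2, h3, h4]
  · rw [hTu]
    simp only [List.length_reverse, List.length_take, ← hc]
    have := min_le_left c.length x.length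
    omega

/-- Stores in the course of a computation of `exists_machine`. -/
def stage (x : Fin (n + 1) → Word) (w₁ w₂ w₃ w₄ : Word) (f : ℕ → Word) : Store (n + 1)
  | .inl i => x i
  | .inr 0 => []
  | .inr 1 => w₁
  | .inr 2 => w₂
  | .inr 3 => w₃
  | .inr 4 => w₄
  | .inr (k + 5) => if k ≤ n then f k else []

theorem stage_of_ge (x : Fin (n + 1) → Word) (w₁ w₂ w₃ w₄ : Word) (f : ℕ → Word) {r : ℕ}
    (hr : n + 6 ≤ r) : stage x w₁ w₂ w₃ w₄ f (.inr r) = [] := by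
  obtain ⟨k, rfl⟩ := Nat.exists_eq_add_of_le' (show 5 ≤ r by omega)
  simp only [stage]; rw [if_neg (by omega)]

theorem stage_block (x : Fin (n + 1) → Word) (w₁ w₂ w₃ w₄ : Word) (f : ℕ → Word) {k : ℕ}
    (hk : k ≤ n) : stage x w₁ w₂ w₃ w₄ f (.inr (k + 5)) = f k := by
  simp only [stage]; rw [if_pos hk]

theorem update_stage_block (x : Fin (n + 1) → Word) (w₁ w₂ w₃ w₄ : Word) (f : ℕ → Word) {k : ℕ}
    (hk : k ≤ n) (w : Word) : Function.update (stage x w₁ w₂ w₃ w₄ f) (.inr (k + 5)) w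
      = stage x w₁ w₂ w₃ w₄ (Function.update f k w) := by
  funext s
  by_cases h : s = .inr (k + 5)
  · subst h; rw [stage_block _ _ _ _ _ _ hk]; simp
  · rw [Function.update_of_ne h]
    match s, h with
    | .inl i, _ => rfl
    | .inr 0, _ => rfl
    | .inr 1, _ => rfl
    | .inr 2, _ => rfl
    | .inr 3, _ => rfl
    | .inr 4, _ => rfl
    | .inr (j + 5), h =>
      have : j ≠ k := by rintro rfl; exact h rfl
      simp only [stage, Function.update_of_ne this]

theorem update_stage_inl (x : Fin (n + 1) → Word) (w₁ w₂ w₃ w₄ : Word) (f : ℕ → Word)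
    (i : Fin (n + 1)) (w : Word) : Function.update (stage x w₁ w₂ w₃ w₄ f) (.inl i) w
      = stage (Function.update x i w) w₁ w₂ w₃ w₄ f := by
  funext s
  match s with
  | .inl j =>
    by_cases h : j = i
    · subst h; simp [stage]
    · rw [Function.update_of_ne (by simpa using h)]; simp [stage, h]
  | .inr 0 => simp [stage]
  | .inr 1 => simp [stage]
  | .inr 2 => simp [stage]
  | .inr 3 => simp [stage]
  | .inr 4 => simp [stage]
  | .inr (j + 5) => simp [stage]

theorem update_stage (x : Fin (n + 1) → Word) (w₁ w₂ w₃ w₄ : Word) (f : ℕ → Word) (w : Word) :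
    Function.update (stage x w₁ w₂ w₃ w₄ f) (.inr 1) w = stage x w w₂ w₃ w₄ f ∧
    Function.update (stage x w₁ w₂ w₃ w₄ f) (.inr 2) w = stage x w₁ w w₃ w₄ f ∧
    Function.update (stage x w₁ w₂ w₃ w₄ f) (.inr 3) w = stage x w₁ w₂ w w₄ f ∧
    Function.update (stage x w₁ w₂ w₃ w₄ f) (.inr 4) w = stage x w₁ w₂ w₃ w f := by
  refine ⟨?_, ?_, ?_, ?_⟩ <;>
  · funext s
    match s with
    | .inl j => simp [stage]
    | .inr 0 => simp [stage]
    | .inr 1 => simp [stage]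
    | .inr 2 => simp [stage]
    | .inr 3 => simp [stage]
    | .inr 4 => simp [stage]
    | .inr (j + 5) => simp [stage]

/-- The words available to a machine with first input `x₀`, further inputs `x`, a number `j` that
has been found by unbounded search, and the clock `B`. -/
def clocked {P : Type*} (j B : P → ℕ) (x₀ : P → Word) (x : Fin n → P → Word) :
    Option (Option (Fin n)) → P → Word
  | none => fun p => List.replicate (j p) true
  | some none => x₀
  | some (some i) => fun p => (x i p).take (B p)

/-- The first input is read completely, the others only up to the clock `B`, so that the time does
not depend on their lengths. The number `j` is the first one at which `search` yields the empty
word. Search is needed because indices come in binary, whereas time may be polynomial in their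
values: `j` supplies in unary what cannot be computed in time polynomial in `|x₀|`. -/
theorem exists_machine {P : Type*} {x₀ : P → Word} {x : Fin n → P → Word} {j : P → ℕ}
    {search : ℕ → P → Word}
    (hs : FPon (fun (i : Bool) (q : ℕ × P) => bif i then List.replicate q.1 true else x₀ q.2)
      fun q => search q.1 q.2)
    (hs₀ : ∀ p, search (j p) p = []) (hs₁ : ∀ p, ∀ i < j p, search i p ≠ [])
    {B : P → ℕ} (hB : FPN (fun (i : Bool) p => bif i then List.replicate (j p) true else x₀ p) B)
    {H : P → Word} (hH : FPon (clocked j B x₀ x) H) :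
    ∃ (M : TM (n + 1)) (q : Polynomial ℕ), ∀ p,
      M.OutputsWithin (Fin.cons (wordTape (x₀ p)) fun i => wordTape (x i p)) (H p)
        (q.eval (j p + (x₀ p).length)) := by
  obtain ⟨g, ⟨qg, hg⟩, eg⟩ := hs
  obtain ⟨b, hbF, eb⟩ := hB
  obtain ⟨lb, hlb⟩ := hbF.length_le
  obtain ⟨qb, hb⟩ := hbF
  obtain ⟨h, hhF, eh⟩ := hH
  obtain ⟨lh, hlh⟩ := hhF.length_le
  obtain ⟨qh, hh⟩ := hhF
  obtain ⟨cg, hcg⟩ := hg (n + 1) (fun i => bif i then 2 else 1) 3 (n + 6)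
    (fun i => by cases i <;> simp) (by omega) (fun i => by cases i <;> simp)
  obtain ⟨cb, hcb⟩ := hb (n + 1) (fun i => bif i then 2 else 1) 4 (n + 6)
    (fun i => by cases i <;> simp) (by omega) (fun i => by cases i <;> simp)
  obtain ⟨ch, hch⟩ := hh (n + 1)
    (fun i => match i with | none => 2 | some none => 1 | some (some i) => i + 5) (n + 5) (n + 6)
    (fun i => by rcases i with _ | _ | i <;> simp) (by omega)
    (fun i => by rcases i with _ | _ | i <;> simp; omega)
  -- Registers: `1` the first input, `2` the search index in unary, `3` the current value of the
  -- search, `4` the clock, from `5` on the prefixes of the other inputs, `n + 5` the result, from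
  -- `n + 6` on scratch space.
  let c : Cmd (n + 1) := .seq (.seq (.moveRev (.inl 0) (n + 6)) (.moveRev (.inr (n + 6)) 1))
    (.seq cg (.seq (.loop (.inr 3) (.seq (.clear 3) (.seq (.push 2 true) cg)))
    (.seq cb (.seq (Cmd.seqN (fun i => if h : i < n then
        Cmd.fetch (Fin.succ ⟨i, h⟩) 4 (n + 6) (n + 7) (i + 5) else .skip) n)
    (.seq ch (.moveRev (.inr (n + 5)) 0))))))
  let qt : Polynomial ℕ := (8 * .X + 2) + qg + (.X * (3 * qg + 3) + 1) + qb
    + (1 + (n : Polynomial ℕ) * (18 * lb + 4)) + qh.comp (.X + (n : Polynomial ℕ) * lb)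
    + (4 * lh.comp (.X + (n : Polynomial ℕ) * lb) + 1)
  refine ⟨c.toTM c.bound, 2 * qt + 1, fun p => ?_⟩
  set N := j p + (x₀ p).length with hN
  set X : Fin (n + 1) → Word := Fin.cons (x₀ p) fun i => x i p with hX
  have hinp : (Fin.cons (wordTape (x₀ p)) fun i => wordTape (x i p) : Fin (n + 1) → ℤ → Option Bool)
      = fun i => wordTape (X i) := by
    funext i
    refine Fin.cases ?_ (fun i => ?_) i <;> simp [hX]
  have hstart : (Sum.elim X fun _ => [] : Store (n + 1)) = stage X [] [] [] [] fun _ => [] := by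
    funext s
    match s with
    | .inl j => simp [stage]
    | .inr 0 => simp [stage]
    | .inr 1 => simp [stage]
    | .inr 2 => simp [stage]
    | .inr 3 => simp [stage]
    | .inr 4 => simp [stage]
    | .inr (j + 5) => simp [stage]
  set X₀ : Fin (n + 1) → Word := Function.update X 0 [] with hX₀
  have hsz : ∀ i, size (fun k : Bool => bif k then List.replicate i true else x₀ p)
      = i + (x₀ p).length := fun i => by simp [size]
  -- reading the first input
  have e₁ := (exec_moveRev (n := n + 1) (r := .inl 0) (o := n + 6) (by simp)
    (stage X [] [] [] [] fun _ => [])).seq (exec_moveRev (n := n + 1) (r := .inr (n + 6)) (o := 1)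
      (by simp) _) le_rfl
  have e₁' : Function.update (Function.update (Function.update (Function.update
      (stage X [] [] [] [] fun _ => []) (.inl 0) []) (.inr (n + 6))
      ((stage X [] [] [] [] fun _ => []) (.inl 0)).reverse) (.inr (n + 6)) []) (.inr 1) (x₀ p)
      = stage X₀ (x₀ p) [] [] [] fun _ => [] := by
    rw [Function.update_idem, update_stage_inl, ← (update_stage X₀ [] [] [] [] _ (x₀ p)).1]
    congr 1
    exact Function.update_eq_self_iff.2 (stage_of_ge _ _ _ _ _ _ le_rfl).symm
  have e₁X : stage X [] [] [] [] (fun _ => []) (.inl 0) = x₀ p := by simp [stage, hX]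
  simp only [Function.update_self, stage_of_ge _ _ _ _ _ _ (le_refl (n + 6)), List.append_nil,
    e₁X, List.reverse_reverse] at e₁ e₁'
  rw [Function.update_of_ne (by simp), Function.update_of_ne (by simp),
    show stage X [] [] [] [] (fun _ => []) (.inr 1) = [] from rfl, List.append_nil, e₁'] at e₁
  -- the search
  have hgl : ∀ i ≤ j p, (search i p).length ≤ qg.eval N := by
    intro i hi
    have := hcg (stage X₀ (x₀ p) (List.replicate i true) [] [] fun _ => []) rfl
      (fun r hr => stage_of_ge _ _ _ _ _ _ hr)
    have hv : (fun k : Bool => stage X₀ (x₀ p) (List.replicate i true) [] [] (fun _ => [])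
        (.inr (bif k then 2 else 1))) = fun k => bif k then List.replicate i true else x₀ p := by
      funext k; cases k <;> rfl
    rw [hv, hsz, (update_stage _ _ _ _ _ _ _).2.2.1] at this
    have h2 := this.length_le (.inr 3)
    have h3 := eg (i, p)
    dsimp only at h3
    simp only [stage, List.length_nil, zero_add, ← h3] at h2
    exact h2.trans (eval_mono_nat _ (by omega))
  have eg' : ∀ i ≤ j p, Exec cg (stage X₀ (x₀ p) (List.replicate i true) [] [] fun _ => [])
      (stage X₀ (x₀ p) (List.replicate i true) (search i p) [] fun _ => []) (qg.eval N) := by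
    intro i hi
    have := hcg (stage X₀ (x₀ p) (List.replicate i true) [] [] fun _ => []) rfl
      (fun r hr => stage_of_ge _ _ _ _ _ _ hr)
    have hv : (fun k : Bool => stage X₀ (x₀ p) (List.replicate i true) [] [] (fun _ => [])
        (.inr (bif k then 2 else 1))) = fun k => bif k then List.replicate i true else x₀ p := by
      funext k; cases k <;> rfl
    rw [hv, hsz, (update_stage _ _ _ _ _ _ _).2.2.1] at this
    have h3 := eg (i, p)
    dsimp only at h3
    rw [← h3] at this
    exact this.mono (eval_mono_nat _ (by omega))
  have e₂ := eg' 0 (Nat.zero_le _)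
  have e₃ := exec_loop (n := n + 1) (r := .inr 3)
    (c := .seq (.clear 3) (.seq (.push 2 true) cg))
    (T := fun i => stage X₀ (x₀ p) (List.replicate i true) (search i p) [] fun _ => [])
    (k := j p) (t := 3 * qg.eval N + 2) (fun i hi => hs₁ p i hi) (hs₀ p) (fun i hi => by
      have k₁ := exec_clear 3 (stage X₀ (x₀ p) (List.replicate i true) (search i p) [] fun _ => [])
      rw [(update_stage _ _ _ _ _ _ _).2.2.1] at k₁
      have k₂ : Exec (.push 2 true)
          (stage X₀ (x₀ p) (List.replicate i true) [] [] fun _ => [])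
          (stage X₀ (x₀ p) (List.replicate (i + 1) true) [] [] fun _ => []) 1 := by
        refine (Exec.push le_rfl).of_eq ?_
        rw [(update_stage _ _ _ _ _ _ _).2.1]
        rfl
      have := hgl i hi.le
      refine k₁.seq (k₂.seq (eg' (i + 1) hi) le_rfl) ?_
      simp only [stage]
      omega)
  simp only [hs₀] at e₃
  -- the clock
  have e₄ : Exec cb (stage X₀ (x₀ p) (List.replicate (j p) true) [] [] fun _ => [])
      (stage X₀ (x₀ p) (List.replicate (j p) true) [] (List.replicate (B p) true) fun _ => [])
      (qb.eval N) := by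
    have := hcb (stage X₀ (x₀ p) (List.replicate (j p) true) [] [] fun _ => []) rfl
      (fun r hr => stage_of_ge _ _ _ _ _ _ hr)
    have hv : (fun k : Bool => stage X₀ (x₀ p) (List.replicate (j p) true) [] [] (fun _ => [])
        (.inr (bif k then 2 else 1))) = fun k => bif k then List.replicate (j p) true else x₀ p := by
      funext k; cases k <;> rfl
    rwa [hv, hsz, (update_stage _ _ _ _ _ _ _).2.2.2, ← eb] at this
  have hBN : B p ≤ lb.eval N := by
    have := hlb fun k => bif k then List.replicate (j p) true else x₀ p
    rwa [← eb, hsz, List.length_replicate] at this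
  -- reading the other inputs
  set Y : ℕ → Store (n + 1) := fun k => stage
    (fun i => if i = 0 then [] else if i.val ≤ k then (X i).drop (B p) else X i) (x₀ p)
    (List.replicate (j p) true) [] (List.replicate (B p) true)
    (fun i => if h : i < n then if i < k then (x ⟨i, h⟩ p).take (B p) else [] else []) with hY
  have e₅ := exec_seqN (n := n + 1) (c := fun i => if h : i < n then
      Cmd.fetch (Fin.succ ⟨i, h⟩) 4 (n + 6) (n + 7) (i + 5) else .skip) (k := n) (T := Y)
      (t := fun _ => 18 * lb.eval N + 4) (fun i hi => by
        simp only [hi, dite_true]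
        have hYi : Y i (.inl (Fin.succ ⟨i, hi⟩)) = x ⟨i, hi⟩ p := by
          simp [hY, stage, hX]
          rfl
        have hYc : (Y i (.inr 4)).length = B p := by simp [hY, stage]
        have := exec_fetch (Fin.succ ⟨i, hi⟩) (k := 4) (t := n + 6) (u := n + 7) (o := i + 5)
          (by omega) (by omega) (by omega) (by omega) (by omega) (Y i)
          (stage_of_ge _ _ _ _ _ _ (by omega)) (stage_of_ge _ _ _ _ _ _ (by omega))
          ((stage_block _ _ _ _ _ _ hi.le).trans (by simp))
        rw [hYi, hYc] at this
        refine (this.of_eq ?_).mono (by omega)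
        rw [hY, update_stage_inl, update_stage_block _ _ _ _ _ _ hi.le]
        congr 1
        · funext k
          by_cases hk : k = Fin.succ ⟨i, hi⟩
          · subst hk; simp [hX]; rfl
          · rw [Function.update_of_ne hk]
            have hk' : k.val ≠ i + 1 := fun h => hk (Fin.ext h)
            have : k.val ≤ i + 1 ↔ k.val ≤ i := by omega
            simp [this]
        · funext k
          by_cases hk : k = i
          · subst hk; simp [hi]
          · rw [Function.update_of_ne hk]
            have : k < i + 1 ↔ k < i := by omega
            simp [this])
  have hY0 : Y 0 = stage X₀ (x₀ p) (List.replicate (j p) true) [] (List.replicate (B p) true)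
      fun _ => [] := by
    simp only [hY]
    congr 1
    · funext i
      by_cases hi : i = 0
      · subst hi; simp [hX₀]
      · have : i.val ≠ 0 := fun h => hi (Fin.ext h)
        simp [hX₀, hi, this]
    · funext i; simp
  rw [hY0] at e₅
  -- the main computation
  set v : Option (Option (Fin n)) → Word := fun i => clocked j B x₀ x i p with hv
  have hYv : (fun i : Option (Option (Fin n)) => Y n (.inr (match i with
      | none => 2 | some none => 1 | some (some i) => i + 5))) = v := by
    funext i
    rcases i with _ | _ | i
    · rfl
    · rfl
    · refine (stage_block _ _ _ _ _ _ i.2.le).trans ?_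
      simp [hv, clocked]
  have hvs : size v ≤ N + n * lb.eval N := by
    have h1 : size v = j p + ((x₀ p).length + ∑ i : Fin n, ((x i p).take (B p)).length) := by
      simp only [size, Fintype.sum_option, hv, clocked, List.length_replicate]
    have h2 : ∑ i : Fin n, ((x i p).take (B p)).length ≤ n * lb.eval N := by
      refine (Finset.sum_le_card_nsmul _ _ (lb.eval N) fun i _ => ?_).trans (by simp)
      exact (List.length_take_le _ _).trans hBN
    omega
  have e₆ := hch (Y n) ((stage_block _ _ _ _ _ _ le_rfl).trans (by simp))
    (fun r hr => stage_of_ge _ _ _ _ _ _ hr)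
  rw [hYv, ← eh] at e₆
  have e₇ := exec_moveRev (n := n + 1) (r := .inr (n + 5)) (o := 0) (by simp)
    (Function.update (Y n) (.inr (n + 5)) (H p))
  have etot := e₁.seq (e₂.seq (e₃.seq (e₄.seq (e₅.seq (e₆.seq e₇ le_rfl) le_rfl) le_rfl) le_rfl)
    le_rfl) le_rfl
  have hlen := hlh v
  rw [← eh] at hlen
  rw [hinp]
  have hfin : Function.update (Function.update (Function.update (Y n) (.inr (n + 5)) (H p))
      (.inr (n + 5)) []) (.inr 0) ((H p).reverse ++ Y n (.inr 0)) (.inr 0) = (H p).reverse := by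
    rw [Function.update_self]; exact List.append_nil _
  have hout := exec_outputsWithin (x := X) (hstart ▸ etot)
  simp only [Function.update_self, Function.update_of_ne (show (.inr 0 : Reg (n + 1)) ≠ .inr (n + 5)
    by simp)] at hout
  rw [show Y n (.inr 0) = [] from rfl, List.append_nil, List.reverse_reverse] at hout
  refine hout.mono ?_
  have h1 : qh.eval (size v) ≤ qh.eval (N + n * lb.eval N) := eval_mono_nat _ hvs
  have h2 : (H p).length ≤ lh.eval (N + n * lb.eval N) := hlen.trans (eval_mono_nat _ hvs)
  have h3 : j p * (3 * qg.eval N + 2 + 1) ≤ N * (3 * qg.eval N + 3) :=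
    Nat.mul_le_mul_right _ (by omega)
  have h4 : qg.eval 0 ≤ qg.eval N := eval_mono_nat _ (Nat.zero_le _)
  simp only [qt, Polynomial.eval_add, Polynomial.eval_mul, Polynomial.eval_comp,
    Polynomial.eval_X, Polynomial.eval_one, Polynomial.eval_ofNat, Polynomial.eval_natCast,
    List.length_reverse, Finset.sum_const, Finset.card_range, smul_eq_mul, Nat.cast_id]
  omega

end Machine

/-! ## Polynomial time in the index -/

theorem exists_mvPolynomial_comp {m : ℕ} (q : Polynomial ℕ) (g : MvPolynomial (Fin m) ℕ) :
    ∃ q' : MvPolynomial (Fin m) ℕ, ∀ K,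
      MvPolynomial.eval K q' = q.eval (MvPolynomial.eval K g) := by
  induction q using Polynomial.induction_on' with
  | add p q hp hq =>
    obtain ⟨p', hp⟩ := hp
    obtain ⟨q', hq⟩ := hq
    exact ⟨p' + q', fun K => by simp [hp, hq]⟩
  | monomial k a => exact ⟨MvPolynomial.C a * g ^ k, fun K => by simp⟩

theorem length_bits_le (k : ℕ) : (Nat.bits k).length ≤ k := by
  rw [Nat.size_eq_bits_len]
  exact Nat.size_le.2 Nat.lt_two_pow_self

theorem length_tuple_le (l : List Word) :
    (tuple l).length ≤ 2 * (l.map List.length).sum + 2 * l.length := by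
  induction l with
  | nil => simp [tuple]
  | cons w l ih =>
    cases l with
    | nil => simp [tuple, length_double]
    | cons v l =>
      simp only [tuple, List.length_append, List.length_cons, length_double, List.map_cons,
        List.sum_cons] at ih ⊢
      omega

theorem length_enc_le {m : ℕ} (K : Fin m → ℕ) :
    (Coded.enc K).length ≤ 2 * ∑ i, K i + 2 * m := by
  refine (length_tuple_le _).trans ?_
  rw [List.map_ofFn, List.sum_ofFn, List.length_ofFn]
  have : ∑ i, (List.length ∘ fun i => (Coded.enc (K i) : Word)) i ≤ ∑ i, K i :=
    Finset.sum_le_sum fun i _ => length_bits_le _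
  omega

/-- The components of `K` in unary. -/
def unary {m : ℕ} {P : Type*} (K : P → Fin m → ℕ) (i : Fin m) (p : P) : Word :=
  List.replicate (K p i) true

section

variable {m n : ℕ} {P : Type*} {K : P → Fin m → ℕ} {ι : Type} [Fintype ι] {env : ι → P → Word}

theorem FPon.enc_index (h : ∀ i, FPN env fun p => K p i) :
    FPon env fun p => (Coded.enc (K p) : Word) :=
  FPon.tuple_ofFn fun i => (h i).bits

theorem FPN.unary (i : Fin m) : FPN (unary K) fun p => K p i := FPon.var i

theorem FPN.min_component (hx : FPon env fun p => (Coded.enc (K p) : Word)) {b : P → ℕ}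
    (hb : FPN env b) (i : Fin m) : FPN env fun p => min (b p) (K p i) :=
  (FPon.valMin hb (hx.component i)).of_eq fun p => by rw [component_enc, val_bits]

/-- Machines that compute in time polynomial in `K`: they may use the components of `K` in unary,
and prefixes of their other inputs of length polynomial in `K`. -/
theorem exists_machine_index {x : Fin n → P → Word} (T : MvPolynomial (Fin m) ℕ) {H : P → Word}
    (hH : FPon (Sum.elim (PolyEst.unary K) fun i p => (x i p).take (MvPolynomial.eval (K p) T)) H) :
    ∃ (M : TM (n + 1)) (q : MvPolynomial (Fin m) ℕ), ∀ p,
      M.OutputsWithin (Fin.cons (wordTape (Coded.enc (K p))) fun i => wordTape (x i p)) (H p)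
        (MvPolynomial.eval (K p) q) := by
  -- Once the sum is known in unary, it serves as a cut-off for the conversion of every component.
  have hK : ∀ {κ : Type} [Fintype κ] {env : κ → P → Word},
      FPN env (fun p => ∑ i, K p i) → FPon env (fun p => (Coded.enc (K p) : Word)) →
      ∀ i, FPN env fun p => K p i := fun h h' i =>
    (FPN.min_component h' h i).of_eq fun p =>
      min_eq_right (Finset.single_le_sum (fun _ _ => Nat.zero_le _) (Finset.mem_univ i))
  -- The search finds the sum of the components as the first `i` with `∑ l, min (i + 1) (K l) ≤ i`;
  -- the cut at `i + 1` makes this computable in unary. For smaller `i`, either some component is at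
  -- least `i + 1`, or nothing is cut and the sum exceeds `i`; both ways the test fails.
  obtain ⟨M, q, hM⟩ := exists_machine (x₀ := fun p => Coded.enc (K p)) (x := x)
    (j := fun p => ∑ i, K p i)
    (search := fun i p => List.replicate ((∑ l, min (i + 1) (K p l)) - i) true)
    (FPN.sub (a := fun q : ℕ × P => ∑ l, min (q.1 + 1) (K q.2 l)) (FPN.sum _ fun l _ => FPN.min_component (K := fun q : ℕ × P => K q.2)
      (FPon.var false) (((FPon.var true).length.of_eq (b := fun q : ℕ × P => q.1) fun q => by simp).add
        (FPN.const 1)) l) ((FPon.var true).length.of_eq (b := fun q : ℕ × P => q.1) fun q => by simp))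
    (fun p => by
      rw [List.replicate_eq_nil_iff]
      exact Nat.sub_eq_zero_of_le (Finset.sum_le_sum fun i _ => min_le_right _ _))
    (fun p i hi => by
      rw [Ne, List.replicate_eq_nil_iff, Nat.sub_eq_zero_iff_le, not_le]
      by_cases h : ∃ l, i + 1 ≤ K p l
      · obtain ⟨l, hl⟩ := h
        refine lt_of_lt_of_le (Nat.lt_succ_self i) ?_
        refine le_trans ?_ (Finset.single_le_sum (f := fun l => min (i + 1) (K p l))
          (fun _ _ => Nat.zero_le _) (Finset.mem_univ l))
        simpa using hl
      · push Not at h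
        refine lt_of_lt_of_eq hi (Finset.sum_congr rfl fun l _ => ?_)
        have := h l
        omega)
    (B := fun p => MvPolynomial.eval (K p) T)
    (FPN.mvPolynomial T (hK ((FPon.var true).length.of_eq fun p => by simp) (FPon.var false)))
    (H := H) (hH.trans fun i => by
      have h₁ := hK (env := clocked (fun p => ∑ i, K p i) (fun p => MvPolynomial.eval (K p) T)
        (fun p => Coded.enc (K p)) x) (FPon.var none) (FPon.var (some none))
      rcases i with i | i
      · exact h₁ i
      · exact FPon.var (some (some i)))
  -- The search index contributes the sum once; the length of the encoded index contributes twice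
  -- the sum and `2 * m`.
  obtain ⟨q', hq'⟩ := exists_mvPolynomial_comp q (3 * ∑ i, MvPolynomial.X i + MvPolynomial.C (2 * m))
  refine ⟨M, q', fun p => (hM p).mono ?_⟩
  rw [hq']
  refine eval_mono_nat _ ?_
  have := length_enc_le (K p)
  simp only [map_add, map_mul, map_sum, MvPolynomial.eval_X, map_ofNat, MvPolynomial.eval_C]
  omega

end

/-- The index in unary and prefixes of polynomial length of the other inputs of a scheme. -/
noncomputable def schemeEnv {m : ℕ} {X : Type*} [Coded X] (T : MvPolynomial (Fin m) ℕ) :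
    Fin m ⊕ Fin 3 → (Fin m → ℕ) × X × Word × Word → Word :=
  Sum.elim (unary Prod.fst) fun i p =>
    (![Coded.enc p.2.1, p.2.2.1, p.2.2.2] i).take (MvPolynomial.eval p.1 T)

theorem polyTime_of_FPon {m : ℕ} {Y : Type*} [Coded Y] {α : (Fin m → ℕ) → Y}
    (h : FPon (unary id) fun K => Coded.enc (α K)) : PolyTime α := by
  obtain ⟨M, q, hM⟩ := exists_machine_index (n := 0) (K := (id : (Fin m → ℕ) → _))
    (x := fun i => i.elim0) (H := fun K => Coded.enc (α K)) 0 (h.trans fun i => FPon.var (Sum.inl i))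
  refine ⟨M, q, fun L => ?_⟩
  convert hM L using 1
  · funext i
    fin_cases i; rfl
  · rfl

/-- The time has to be bounded uniformly in input, random word and advice. This is met by algorithms
that depend only on prefixes of these whose length `T` is polynomial in the index. -/
theorem schemeTime_of_FPon {m : ℕ} {X Y : Type*} [Coded X] [Coded Y]
    {S : (Fin m → ℕ) → X → Word → Word → Y} {R : (Fin m → ℕ) → ℕ} (T : MvPolynomial (Fin m) ℕ)
    (hS : FPon (schemeEnv T) fun p : (Fin m → ℕ) × X × Word × Word =>
      Coded.enc (S p.1 p.2.1 p.2.2.1 p.2.2.2))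
    (hR : FPon (unary id) fun K => Coded.enc (R K)) : SchemeTime S fun K _ => R K := by
  constructor
  · obtain ⟨M, q, hM⟩ := exists_machine_index (n := 3)
      (K := fun p : (Fin m → ℕ) × X × Word × Word => p.1)
      (x := fun i p => ![Coded.enc p.2.1, p.2.2.1, p.2.2.2] i) T hS
    refine ⟨M, q, fun K x y z => ?_⟩
    convert hM (K, x, y, z) using 1
    funext i
    fin_cases i <;> rfl
  · obtain ⟨M, q, hM⟩ := exists_machine_index (n := 1)
      (K := fun p : (Fin m → ℕ) × Word => p.1)
      (x := fun i p => p.2) (H := fun p => Coded.enc (R p.1)) 0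
      ((hR.pullback Prod.fst).trans fun i => FPon.var (Sum.inl i))
    refine ⟨M, q, fun K z => ?_⟩
    convert hM (K, z) using 1
    funext i
    fin_cases i <;> rfl

theorem TM.OutputsWithin.run_eq {n : ℕ} {M : TM n} {inp : Fin n → ℤ → Option Bool} {y : Word}
    {t u : ℕ} (h : M.OutputsWithin inp y t) (hu : t ≤ u) : (M.run inp u).output = y :=
  (h.mono hu).2

/-- Clocked simulation of a machine with a time bound. -/
theorem FPon.of_outputsWithin {n : ℕ} {P : Type*} {ι : Type} [Fintype ι] {env : ι → P → Word}
    {M : TM n} {x : Fin n → P → Word} {H : P → Word} {t : P → ℕ} (ht : FPN env t)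
    (hx : ∀ i, FPon env (x i))
    (h : ∀ p, M.OutputsWithin (fun i => wordTape (x i p)) (H p) (t p)) : FPon env H :=
  (FPon.run M ht hx).of_eq fun p => (h p).2

theorem PolyTime.FPon {m : ℕ} {P : Type*} {ι : Type} [Fintype ι] {env : ι → P → Word}
    {Y : Type*} [Coded Y] {α : (Fin m → ℕ) → Y} (h : PolyTime α) {K : P → Fin m → ℕ}
    (hK : ∀ i, FPN env fun p => K p i) : FPon env fun p => Coded.enc (α (K p)) := by
  obtain ⟨M, q, hM⟩ := h
  refine FPon.of_outputsWithin (M := M) (x := fun _ p => Coded.enc (K p)) (FPN.mvPolynomial q hK)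
    (fun _ => FPon.enc_index hK) fun p => ?_
  convert hM (K p) using 1
  funext i
  fin_cases i; rfl

/-- The polynomial bound on the values is the cut-off that turns binary output into unary. -/
theorem PolyTime.FPN {m : ℕ} {P : Type*} {ι : Type} [Fintype ι] {env : ι → P → Word}
    {α : (Fin m → ℕ) → ℕ} (h : PolyTime α) (hα : α ∈ GammaPoly m) {K : P → Fin m → ℕ}
    (hK : ∀ i, FPN env fun p => K p i) : FPN env fun p => α (K p) := by
  obtain ⟨b, hb⟩ := hα
  refine (FPon.valMin (FPN.mvPolynomial b hK) (h.FPon hK)).of_eq fun p => ?_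
  rw [show (Coded.enc (α (K p)) : Word) = Nat.bits (α (K p)) from rfl, val_bits]
  exact min_eq_right (hb _)

/-! ## Recovering an index from its image under a fast-growing `alphaP` -/

theorem trailing_bits_two_pow_mul (c k : ℕ) : trailing (Nat.bits (2 ^ c * (2 * k + 1))) = c := by
  induction c with
  | zero => simp [trailing]
  | succ c ih =>
    rw [pow_succ', mul_assoc, Nat.bit0_bits _ (by positivity), trailing, ih]

/-- The index whose last component has been replaced by a power that allows to recover it. -/
def powIndex {n : ℕ} (c : ℕ) (L : Fin (n + 1) → ℕ) : Fin (n + 1) → ℕ :=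
  Function.update L (Fin.last n) ((4 * ∑ i, L i + 2) ^ (c + 1))

section

variable {n : ℕ}

theorem trailing_powIndex (c : ℕ) (L : Fin (n + 1) → ℕ) :
    trailing (component n (Coded.enc (powIndex c L))) = c + 1 := by
  have h := component_enc (powIndex c L) (Fin.last n)
  rw [Fin.val_last] at h
  obtain ⟨k, hk⟩ : Odd ((2 * ∑ i, L i + 1) ^ (c + 1)) := Odd.pow ⟨_, rfl⟩
  rw [h, powIndex, Function.update_self, show 4 * ∑ i, L i + 2 = 2 * (2 * ∑ i, L i + 1) by ring,
    mul_pow, hk, trailing_bits_two_pow_mul]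

/-- All components but the last are present unchanged; the last is the sum minus the others. The
hypothesis has `+ 1` because that is where the search of `exists_machine_powIndex` stops. -/
theorem FPon.index_of_powIndex {P : Type*} {ι : Type} [Fintype ι] {env : ι → P → Word}
    {c : P → ℕ} {L : P → Fin (n + 1) → ℕ} (hg : FPN env fun p => ∑ i, L p i + 1)
    (hx : FPon env fun p => (Coded.enc (powIndex (c p) (L p)) : Word)) (i : Fin (n + 1)) :
    FPN env fun p => L p i := by
  have hg' : FPN env fun p => ∑ i, L p i := (hg.sub (FPN.const 1)).of_eq fun p => by simp
  have h : ∀ i : Fin n, FPN env fun p => L p i.castSucc := fun i => by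
    refine (FPN.min_component hx hg' i.castSucc).of_eq fun p => ?_
    rw [powIndex, Function.update_of_ne (Fin.castSucc_lt_last i).ne]
    exact min_eq_right (Finset.single_le_sum (fun _ _ => Nat.zero_le _) (Finset.mem_univ _))
  refine Fin.lastCases ?_ (fun i => h i) i
  refine (hg'.sub (FPN.sum Finset.univ fun i _ => h i)).of_eq fun p => ?_
  rw [Fin.sum_univ_castSucc]; omega

/-- The point is that `N` and `q` do not depend on `c`. The last component is 2^(c+1) times an odd
number, so its trailing zeros reveal `c + 1`. The search then looks for the first `i` such that `c +
1` divisions of this component by `4 * i + 2` give zero. This means that `(4 * i + 2) ^ (c + 1)`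
exceeds `(4 * ∑ L + 2) ^ (c + 1)`, hence happens first at `∑ L + 1`, and then `L` is available in
unary. -/
theorem exists_machine_powIndex (T : MvPolynomial (Fin (n + 1)) ℕ)
    {H : (Fin (n + 1) → ℕ) × Word → Word}
    (hH : FPon (fun i : Fin (n + 1) ⊕ Unit => Sum.elim (unary Prod.fst)
      (fun _ p => p.2.take (MvPolynomial.eval p.1 T)) i) H) :
    ∃ (N : TM 2) (q : Polynomial ℕ), ∀ c L w,
      N.OutputsWithin (fun i => wordTape (![Coded.enc (powIndex c L), w] i)) (H (L, w))
        (q.eval (∑ i, L i + 1 + (Coded.enc (powIndex c L)).length)) := by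
  let P := ℕ × (Fin (n + 1) → ℕ) × Word
  have hlt : ∀ (p : P) (i : ℕ), powIndex p.1 p.2.1 (Fin.last n) / (4 * i + 2) ^ (p.1 + 1) = 0 ↔
      ∑ l, p.2.1 l < i := fun p i => by
    rw [Nat.div_eq_zero_iff_lt (by positivity), powIndex, Function.update_self,
      Nat.pow_lt_pow_iff_left (by omega)]
    omega
  have hval : ∀ (p : P) (i : ℕ), ((quotW (4 * i + 2))^[p.1 + 1] (component n
      (Coded.enc (powIndex p.1 p.2.1)))).filter id = [] ↔ ∑ l, p.2.1 l < i := fun p i => by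
    have h := component_enc (powIndex p.1 p.2.1) (Fin.last n)
    rw [Fin.val_last] at h
    rw [filter_id_eq_nil_iff, val_iterate_quotW (by omega), h, val_bits, hlt]
  obtain ⟨M, q, hM⟩ := exists_machine (P := P) (n := 1) (x₀ := fun p => Coded.enc (powIndex p.1 p.2.1))
    (x := fun _ p => p.2.2) (j := fun p => ∑ i, p.2.1 i + 1)
    (search := fun i p => ((quotW (4 * i + 2))^[p.1 + 1] (component n
      (Coded.enc (powIndex p.1 p.2.1)))).filter id)
    (by
      have hi : FPN (fun (i : Bool) (q : ℕ × P) => bif i then List.replicate q.1 true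
          else Coded.enc (powIndex q.2.1 q.2.2.1)) fun q => q.1 :=
        (FPon.var true).length.of_eq fun q => by simp
      refine FPon.filterId (FPon.iterate_quotW (((FPN.const 4).mul hi).add (FPN.const 2)) ?_
        ((FPon.var false).component n))
      exact ((FPon.var false).component n).trailing.of_eq fun q => trailing_powIndex q.2.1 q.2.2.1)
    (fun p => (hval p _).2 (Nat.lt_succ_self _)) (fun p i hi h => by
      have := (hval p _).1 h
      omega)
    (B := fun p => MvPolynomial.eval p.2.1 T)
    (FPN.mvPolynomial T (FPon.index_of_powIndex ((FPon.var true).length.of_eq fun p => by simp)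
      (FPon.var false)))
    (H := fun p => H p.2)
    ((hH.pullback (Prod.snd : P → _)).trans fun i => by
      rcases i with i | i
      · have h : FPN (clocked (fun p : P => ∑ i, p.2.1 i + 1) (fun p => MvPolynomial.eval p.2.1 T)
            (fun p => Coded.enc (powIndex p.1 p.2.1)) fun (_ : Fin 1) p => p.2.2)
            (fun p => ∑ i, p.2.1 i + 1) := FPon.var none
        exact FPon.index_of_powIndex h (FPon.var (some none)) i
      · exact FPon.var (some (some 0)))
  refine ⟨M, q, fun c L w => ?_⟩
  convert hM (c, L, w) using 1
  funext i
  fin_cases i <;> rfl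

end

/-! ## Polynomials in a changed index -/

section

variable {n : ℕ}

theorem exists_mvPolynomial_alphaP (b t : MvPolynomial (Fin (n + 1)) ℕ) :
    ∃ b' : MvPolynomial (Fin (n + 1)) ℕ, ∀ K,
      MvPolynomial.eval K b' = MvPolynomial.eval (alphaP t K) b := by
  refine ⟨MvPolynomial.bind₁ (Function.update MvPolynomial.X (Fin.last n) t) b, fun K => ?_⟩
  rw [← MvPolynomial.coe_aeval_eq_eval, ← MvPolynomial.coe_aeval_eq_eval]
  simp only [RingHom.coe_coe, MvPolynomial.aeval_bind₁]
  congr 2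
  funext i
  by_cases hi : i = Fin.last n
  · subst hi; simp [alphaP]
  · simp [alphaP, hi]

theorem GammaOf.poly {s : (Fin (n + 1) → ℕ) → ℕ} (hs : s ∈ GammaPoly (n + 1))
    {γ : (Fin (n + 1) → ℕ) → ℕ} (hγ : γ ∈ GammaOf s) : γ ∈ GammaPoly (n + 1) := by
  obtain ⟨b, hb⟩ := hs
  obtain ⟨t, ht⟩ := hγ
  obtain ⟨b', hb'⟩ := exists_mvPolynomial_alphaP b t
  exact ⟨b', fun K => by rw [hb']; exact (ht K).trans (hb _)⟩

/-! ## The machine that samples -/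

variable {ΓR : Set ((Fin (n + 1) → ℕ) → ℕ)}

theorem Scheme.adv_eq_nil {m : ℕ} {X Y : Type*} [Coded X] [Coded Y]
    {ΓR : Set ((Fin m → ℕ) → ℕ)} (σ : Scheme m ΓR (GammaZero m) X Y) (K : Fin m → ℕ) :
    σ.adv K = [] := List.length_eq_zero_iff.1 (σ.adv_mem K)

/-- After decoding `L`, the machine simulates the algorithm of `σ` for as long as its time bound
allows. The number of bits to be used from `w` comes from a simulation of `σ.rnd`, made unary by
means of the bound `b`; the advice is empty. -/
theorem exists_sampling_machine (σ : Scheme (n + 1) ΓR (GammaZero (n + 1)) Unit Word)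
    {b : MvPolynomial (Fin (n + 1)) ℕ} (hb : ∀ K, σ.rnd K [] ≤ MvPolynomial.eval K b) :
    ∃ (N : TM 2) (q : Polynomial ℕ), ∀ c L w,
      N.OutputsWithin (fun i => wordTape (![Coded.enc (powIndex c L), w] i))
        (σ.alg L () (w.take (σ.rnd L [])) [])
        (q.eval (∑ i, L i + 1 + (Coded.enc (powIndex c L)).length)) := by
  obtain ⟨M₄, t₄, h₄⟩ := σ.time.alg
  obtain ⟨M₂, t₂, h₂⟩ := σ.time.rnd
  refine exists_machine_powIndex b (H := fun p => σ.alg p.1 () (p.2.take (σ.rnd p.1 [])) []) ?_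
  set env : Fin (n + 1) ⊕ Unit → (Fin (n + 1) → ℕ) × Word → Word := fun i =>
    Sum.elim (unary Prod.fst) (fun _ p => p.2.take (MvPolynomial.eval p.1 b)) i with henv
  have hL : ∀ i, FPN env fun p => p.1 i := fun i => FPon.var (Sum.inl i)
  have hR : FPN env fun p => σ.rnd p.1 [] := by
    have h := FPon.of_outputsWithin (env := env) (M := M₂)
      (x := ![fun p => Coded.enc p.1, fun _ => []]) (H := fun p => Coded.enc (σ.rnd p.1 []))
      (FPN.mvPolynomial t₂ hL) (fun i => by
        fin_cases i
        · exact FPon.enc_index hL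
        · exact FPon.nil) (fun p => by
        convert h₂ p.1 [] using 1
        funext i
        fin_cases i <;> rfl)
    refine (FPon.valMin (FPN.mvPolynomial b hL) h).of_eq fun p => ?_
    rw [show (Coded.enc (σ.rnd p.1 []) : Word) = Nat.bits (σ.rnd p.1 []) from rfl, val_bits]
    exact min_eq_right (hb _)
  refine FPon.of_outputsWithin (env := env) (M := M₄)
    (x := ![fun p => Coded.enc p.1, fun _ => [], fun p => p.2.take (σ.rnd p.1 []), fun _ => []])
    (FPN.mvPolynomial t₄ hL) (fun i => by
      fin_cases i
      · exact FPon.enc_index hL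
      · exact FPon.nil
      · refine (FPon.takeN hR (FPon.var (env := env) (Sum.inr ()))).of_eq fun p => ?_
        simp only [henv, Sum.elim_inr, List.take_take]
        rw [min_eq_left (hb _)]; rfl
      · exact FPon.nil) (fun p => by
      convert h₄ p.1 () (p.2.take (σ.rnd p.1 [])) [] using 1
      · funext i
        fin_cases i <;> rfl
      · rfl)

end

/-! ## Clocked evaluation of the universal machine -/

theorem TM.inHead_run_le {n : ℕ} (M : TM n) (inp : Fin n → ℤ → Option Bool) (t : ℕ) (i : Fin n) :
    (M.run inp t).inHead i ≤ t := by
  induction t with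
  | zero => simp [TM.run, TM.init]
  | succ t ih =>
    rw [TM.run_succ]
    unfold TM.step
    cases M.δ (M.run inp t).state (fun i => inp i ((M.run inp t).inHead i))
      (fun j => (M.run inp t).cells j ((M.run inp t).head j)) with
    | none => simp; omega
    | some d =>
      have : (d.2.1 i).offset ≤ 1 := by cases d.2.1 i <;> simp [Move.offset]
      simp; omega

/-- A head starts at cell `0` and moves right by at most one cell per step, so `t` steps read no
cell from number `t` on. -/
theorem TM.run_congr {n : ℕ} (M : TM n) {inp inp' : Fin n → ℤ → Option Bool} {t : ℕ}
    (h : ∀ i, ∀ j : ℤ, j < t → inp i j = inp' i j) : M.run inp t = M.run inp' t := by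
  induction t with
  | zero => rfl
  | succ t ih =>
    have ih := ih fun i j hj => h i j (by push_cast; omega)
    rw [TM.run_succ, TM.run_succ, ← ih]
    unfold TM.step
    have : (fun i => inp i ((M.run inp t).inHead i)) = fun i => inp' i ((M.run inp t).inHead i) :=
      funext fun i => h i _ (by have := M.inHead_run_le inp t i; push_cast; omega)
    rw [this]

/-- In `k` steps only the first `k` cells of the program tape matter, so `k` zeros can replace the
infinite tail. The program thereby becomes a word, to which `FPon.run` applies. -/
theorem TM.ev_eq_run {n : ℕ} (U : TM (n + 1)) (k : ℕ) (a : Word) (x : Fin n → Word) :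
    U.ev k a x = (U.run (fun i => wordTape ((Fin.cons (a ++ List.replicate k false) x :
      Fin (n + 1) → Word) i)) k).output := by
  unfold TM.ev
  rw [U.run_congr]
  refine Fin.cases ?_ fun i => ?_
  · intro j hj
    simp only [Fin.cons_zero, programTape, wordTape]
    split_ifs with h0
    · lift j to ℕ using h0
      rw [Nat.cast_lt] at hj
      rw [Int.toNat_natCast, List.getElem?_eq_getElem (by simp; omega), List.getD_eq_getElem?_getD]
      rcases lt_or_ge j a.length with h | h
      · rw [List.getElem_append_left h, List.getElem?_eq_getElem h]; rfl
      · rw [List.getElem_append_right h, List.getElem?_eq_none h]; simp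
    · rfl
  · intro j _
    simp

theorem FPN.replicate_false {P : Type*} {ι : Type} [Fintype ι] {env : ι → P → Word} {a : P → ℕ}
    (ha : FPN env a) : FPon env fun p => List.replicate (a p) false := by
  have key : ∀ w init : Word, w.foldr (fun _ acc => false :: acc) init
      = List.replicate w.length false ++ init := by
    intro w init
    induction w with
    | nil => rfl
    | cons b w ih => rw [List.foldr_cons, ih]; rfl
  have := FPon.foldr₁ (env := env) (ι' := Empty) (G := fun _ v => false :: v (.inl ()))
    (fun b => (FP.proj _).cons false) (par := fun i => i.elim) ⟨.X, fun w init par => by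
      simp only [Sum.elim_inl, key, Polynomial.eval_X, List.length_append, List.length_replicate]
      omega⟩ ha FPon.nil (fun i => i.elim)
  exact this.of_eq fun p => by simp only [Sum.elim_inl, key]; simp

theorem FPon.ev {n : ℕ} {P : Type*} {ι : Type} [Fintype ι] {env : ι → P → Word}
    (U : TM (n + 1)) {k : P → ℕ} {a : P → Word} {x : Fin n → P → Word} (hk : FPN env k)
    (ha : FPon env a) (hx : ∀ i, FPon env (x i)) :
    FPon env fun p => U.ev (k p) (a p) fun i => x i p := by
  have hy : ∀ i, FPon env ((Fin.cons (fun p => a p ++ List.replicate (k p) false) x :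
      Fin (n + 1) → P → Word) i) := Fin.cases (ha.append hk.replicate_false) hx
  refine (FPon.run U hk hy).of_eq fun p => ?_
  rw [TM.ev_eq_run]
  congr 2
  funext i
  congr 1
  refine Fin.cases ?_ (fun i => ?_) i <;> rfl

/-! ## Growth -/

section

variable {n : ℕ}

theorem alphaP_alphaP (p t : MvPolynomial (Fin (n + 1)) ℕ) :
    ∃ p' : MvPolynomial (Fin (n + 1)) ℕ, ∀ K, alphaP p (alphaP t K) = alphaP p' K := by
  obtain ⟨p', hp'⟩ := exists_mvPolynomial_alphaP p t
  exact ⟨p', fun K => by rw [alphaP, ← hp']; simp [alphaP]⟩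

/-- The doubling condition is iterated `i` times, and the substitutions compose to a single
polynomial. Hence constant factors are absorbed by the growth space. -/
theorem SteadilyGrowing.exists_two_pow_mul_le {γ : (Fin (n + 1) → ℕ) → ℕ} (h : SteadilyGrowing γ)
    (i : ℕ) : ∃ t : MvPolynomial (Fin (n + 1)) ℕ, ∀ K, 2 ^ i * γ K ≤ γ (alphaP t K) := by
  induction i with
  | zero =>
    exact ⟨.X (Fin.last n), fun K => by simp [alphaP]⟩
  | succ i ih =>
    obtain ⟨t, ht⟩ := ih
    obtain ⟨u, hu⟩ := h.doubling
    obtain ⟨t', ht'⟩ := alphaP_alphaP u t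
    refine ⟨t', fun K => ?_⟩
    have h1 := hu (alphaP t K)
    rw [ht'] at h1
    have h2 : 2 * γ (alphaP t K) ≤ γ (alphaP t' K) := by
      have : (2 * γ (alphaP t K) : ℝ) ≤ γ (alphaP t' K) := by linarith
      exact_mod_cast this
    calc 2 ^ (i + 1) * γ K = 2 * (2 ^ i * γ K) := by ring
      _ ≤ _ := (Nat.mul_le_mul_left 2 (ht K)).trans h2

theorem SteadilyGrowing.mem_gammaOf {γ γ' : (Fin (n + 1) → ℕ) → ℕ} (h : SteadilyGrowing γ) {i : ℕ}
    (h' : ∀ K, γ' K ≤ 2 ^ i * γ K) : γ' ∈ GammaOf γ := by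
  obtain ⟨t, ht⟩ := h.exists_two_pow_mul_le i
  exact ⟨t, fun K => (h' K).trans (ht K)⟩

theorem FPN.alphaP {P : Type*} {ι : Type} [Fintype ι] {env : ι → P → Word}
    (p : MvPolynomial (Fin (n + 1)) ℕ) {K : P → Fin (n + 1) → ℕ}
    (hK : ∀ i, FPN env fun q => K q i) (i : Fin (n + 1)) :
    FPN env fun q => PolyEst.alphaP p (K q) i := by
  by_cases hi : i = Fin.last n
  · subst hi
    exact (FPN.mvPolynomial p hK).of_eq fun q => by simp [PolyEst.alphaP]
  · exact (hK i).of_eq fun q => by simp [PolyEst.alphaP, hi]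

theorem polyTime_alphaP (p : MvPolynomial (Fin (n + 1)) ℕ) : PolyTime (alphaP p) :=
  polyTime_of_FPon (FPon.enc_index (FPN.alphaP p fun i => FPN.unary (K := id) i))

end

/-! ## The algorithms -/

section

variable {n : ℕ}

/-- The cut falls into the last component. So the prefixes that the weight inspects can be read from
a truncation, however long the output component may be. -/
theorem splitC_iterate_tuple (b c a x : Word) (T : ℕ)
    (hT : 2 * b.length + 2 * c.length + 2 * a.length + 6 ≤ T) :
    component 0 ((tuple [b, c, a, x]).take T) = b ∧ component 2 ((tuple [b, c, a, x]).take T) = a := by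
  have h : (tuple [b, c, a, x]).take T = double b ++ false :: true :: (double c ++ false :: true ::
      (double a ++ false :: true ::
        (double x).take (T - (2 * b.length + 2 * c.length + 2 * a.length + 6)))) := by
    have h1 : tuple [b, c, a, x] = (double b ++ false :: true :: (double c ++ false :: true ::
        (double a ++ [false, true]))) ++ double x := by simp [tuple]
    rw [h1, List.take_append, List.take_of_length_le]
    · simp only [List.length_append, List.length_cons, length_double, List.append_assoc,
        List.cons_append, List.nil_append, List.length_nil]
      congr 10
      omega
    · simp only [List.length_append, List.length_cons, length_double, List.length_nil]
      omega
  rw [h]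
  refine ⟨splitC_true_append _ _, ?_⟩
  simp only [component, Function.iterate_succ, Function.iterate_zero, Function.comp_apply, id,
    splitC_false_append, splitC_true_append]

variable {X : Type*} [Coded X] (T : MvPolynomial (Fin (n + 1)) ℕ)

theorem schemeEnv_index (i : Fin (n + 1)) :
    FPN (schemeEnv (X := X) T) fun p => p.1 i := FPon.var (Sum.inl i)

theorem schemeEnv_input : FPon (schemeEnv (X := X) T) fun p =>
    (Coded.enc p.2.1 : Word).take (MvPolynomial.eval p.1 T) := FPon.var (Sum.inr 0)

theorem schemeEnv_random : FPon (schemeEnv (X := X) T) fun p =>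
    p.2.2.1.take (MvPolynomial.eval p.1 T) := FPon.var (Sum.inr 1)

/-- The algorithm of the reduction to the universal problem. -/
noncomputable def reduceAlg (ρ : (Fin (n + 1) → ℕ) → ℕ) (p t : MvPolynomial (Fin (n + 1)) ℕ)
    (φ a : Word) (L : Fin (n + 1) → ℕ) (x y : Word) : Word :=
  -- The fixed prefixes overwrite random bits, so the components have length `ρ L` as in the
  -- universal ensemble, provided that the prefixes fit. The input is cut only to make the time
  -- independent of its length.
  tuple [φ ++ (y.take (ρ L)).drop φ.length, Nat.bits (MvPolynomial.eval L p),
    a ++ ((y.drop (ρ L)).take (ρ L)).drop a.length, x.take (MvPolynomial.eval L t)]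

theorem schemeTime_reduceAlg {ρ : (Fin (n + 1) → ℕ) → ℕ} (hρ : PolyTime ρ)
    (hρ' : ρ ∈ GammaPoly (n + 1)) (p t : MvPolynomial (Fin (n + 1)) ℕ) (φ a : Word) :
    SchemeTime (fun L x y (_ : Word) => reduceAlg ρ p t φ a L x y) fun L _ => ρ L + ρ L := by
  obtain ⟨b, hb⟩ := hρ'
  refine schemeTime_of_FPon (X := Word) (Y := Word) (R := fun L => ρ L + ρ L) (2 * b + t) ?_ ?_
  · have hL := schemeEnv_index (X := Word) (2 * b + t)
    have hρL := hρ.FPN ⟨b, hb⟩ hL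
    have hx := schemeEnv_input (X := Word) (2 * b + t)
    have hy := schemeEnv_random (X := Word) (2 * b + t)
    refine (FPon.tuple [_, _, _, _] (by
      simp only [List.mem_cons, List.not_mem_nil, or_false, forall_eq_or_imp, forall_eq]
      exact ⟨(FPon.const φ).append (FPon.drop (FPon.const φ) (FPon.takeN hρL hy)),
        (FPN.mvPolynomial p hL).bits,
        (FPon.const a).append (FPon.drop (FPon.const a) (FPon.takeN hρL (FPon.dropN hρL hy))),
        FPon.takeN (FPN.mvPolynomial t hL) hx⟩)).of_eq fun q => ?_
    have h1 := hb q.1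
    have h2 : MvPolynomial.eval q.1 (2 * b + t) = 2 * MvPolynomial.eval q.1 b
      + MvPolynomial.eval q.1 t := by simp
    have h3 : MvPolynomial.eval (fun i => q.1 i) t = MvPolynomial.eval q.1 t := rfl
    simp only [List.map_cons, List.map_nil, reduceAlg, h3, h2, List.take_take, List.drop_take]
    rw [min_eq_left (by omega), min_eq_left (by omega), min_eq_left (by omega)]
    rfl
  · exact ((hρ.FPN ⟨b, hb⟩ fun i => FPN.unary (K := id) i).add
      (hρ.FPN ⟨b, hb⟩ fun i => FPN.unary (K := id) i)).bits

open Classical in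
/-- The weight that dominates the image of the reduction. -/
noncomputable def weightAlg (T : MvPolynomial (Fin (n + 1)) ℕ) (φ a : Word)
    (L : Fin (n + 1) → ℕ) (x : Word) : ℚ≥0 :=
  if (component 0 (x.take (MvPolynomial.eval L T))).take φ.length = φ then
    if (component 2 (x.take (MvPolynomial.eval L T))).take a.length = a then
      2 ^ (φ.length + a.length) else 0 else 0

theorem schemeTime_weightAlg (φ a : Word) :
    SchemeTime (fun L x (_ _ : Word) => weightAlg T φ a L x) fun _ _ => 0 := by
  refine schemeTime_of_FPon (X := Word) (R := fun _ => 0) T ?_ (FPon.const _)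
  have hx := schemeEnv_input (X := Word) T
  refine (FPon.iteEq φ (FPon.takeN (FPN.const φ.length) (hx.component 0))
    (FPon.iteEq a (FPon.takeN (FPN.const a.length) (hx.component 2))
      (FPon.const (Coded.enc ((2 : ℚ≥0) ^ (φ.length + a.length)))) (FPon.const (Coded.enc (0 : ℚ≥0))))
    (FPon.const (Coded.enc (0 : ℚ≥0)))).of_eq fun q => ?_
  unfold weightAlg
  simp only [show ∀ w : Word, (Coded.enc w : Word) = w from fun _ => rfl]
  split_ifs <;> rfl

theorem schemeTime_component :
    SchemeTime (fun L x (_ _ : Word) => component 3 (List.take (MvPolynomial.eval L T) x))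
      fun _ _ => 0 :=
  schemeTime_of_FPon (X := Word) (Y := Word) (R := fun _ => 0) T
    ((schemeEnv_input (X := Word) T).component 3) (FPon.const _)

/-- The sampling algorithm of the universal ensemble. -/
noncomputable def universalAlg (r s : (Fin (n + 1) → ℕ) → ℕ) (U : TM 3) (K : Fin (n + 1) → ℕ)
    (y : Word) : Word :=
  tuple [y.take (r K), Coded.enc (K (Fin.last n)), (y.drop (r K)).take (r K),
    U.ev (K (Fin.last n)) ((y.drop (r K)).take (r K))
      ![Coded.enc K, (y.drop (r K + r K)).take (s K)]]

theorem schemeTime_universalAlg {r s : (Fin (n + 1) → ℕ) → ℕ} (hr : PolyTime r) (hs : PolyTime s)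
    (hr' : r ∈ GammaPoly (n + 1)) (hs' : s ∈ GammaPoly (n + 1)) (U : TM 3) :
    SchemeTime (fun K (_ : Unit) y (_ : Word) => universalAlg r s U K y)
      fun K _ => r K + r K + s K := by
  obtain ⟨b, hb⟩ := hr'
  obtain ⟨c, hc⟩ := hs'
  refine schemeTime_of_FPon (X := Unit) (Y := Word) (R := fun K => r K + r K + s K) (2 * b + c) ?_ ?_
  · have hL := schemeEnv_index (X := Unit) (2 * b + c)
    have hrL := hr.FPN ⟨b, hb⟩ hL
    have hsL := hs.FPN ⟨c, hc⟩ hL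
    have hy := schemeEnv_random (X := Unit) (2 * b + c)
    have ha := FPon.takeN hrL (FPon.dropN hrL hy)
    have hev := FPon.ev U (x := ![fun q => Coded.enc q.1, _]) (hL (Fin.last n)) ha (fun i => by
      fin_cases i
      · exact FPon.enc_index hL
      · exact FPon.takeN hsL (FPon.dropN (hrL.add hrL) hy))
    refine (FPon.tuple [_, _, _, _] (by
      simp only [List.mem_cons, List.not_mem_nil, or_false, forall_eq_or_imp, forall_eq]
      exact ⟨FPon.takeN hrL hy, (hL (Fin.last n)).bits, ha, hev⟩)).of_eq fun q => ?_
    have h1 := hb q.1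
    have h3 := hc q.1
    have h2 : MvPolynomial.eval q.1 (2 * b + c) = 2 * MvPolynomial.eval q.1 b
      + MvPolynomial.eval q.1 c := by simp
    have e1 : (q.2.2.1.take (MvPolynomial.eval q.1 (2 * b + c))).take (r q.1) = q.2.2.1.take (r q.1) := by
      rw [List.take_take, min_eq_left (by omega)]
    have e2 : ((q.2.2.1.take (MvPolynomial.eval q.1 (2 * b + c))).drop (r q.1)).take (r q.1)
        = (q.2.2.1.drop (r q.1)).take (r q.1) := by
      rw [List.drop_take, List.take_take, min_eq_left (by omega)]
    have e3 : ((q.2.2.1.take (MvPolynomial.eval q.1 (2 * b + c))).drop (r q.1 + r q.1)).take (s q.1)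
        = (q.2.2.1.drop (r q.1 + r q.1)).take (s q.1) := by
      rw [List.drop_take, List.take_take, min_eq_left (by omega)]
    have e4 : (fun i : Fin 2 => (![fun q => Coded.enc q.1, fun q => ((q.2.2.1.take
        (MvPolynomial.eval q.1 (2 * b + c))).drop (r q.1 + r q.1)).take (s q.1)] :
          Fin 2 → (Fin (n + 1) → ℕ) × Unit × Word × Word → Word) i q)
        = ![Coded.enc q.1, (q.2.2.1.drop (r q.1 + r q.1)).take (s q.1)] := by
      funext i
      fin_cases i
      · rfl
      · exact e3
    simp only [List.map_cons, List.map_nil, universalAlg, e1, e2, e4]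
    rfl
  · have hL := fun i => FPN.unary (K := (id : (Fin (n + 1) → ℕ) → _)) i
    exact (((hr.FPN ⟨b, hb⟩ hL).add (hr.FPN ⟨b, hb⟩ hL)).add (hs.FPN ⟨c, hc⟩ hL)).bits

end

/-! ## Probability -/

section

open scoped ENNReal

variable {X Y : Type*}

theorem PMF.bind_congr_support (μ : PMF X) {f g : X → PMF Y} (h : ∀ a ∈ μ.support, f a = g a) :
    μ.bind f = μ.bind g := by
  ext y
  rw [PMF.bind_apply, PMF.bind_apply]
  refine tsum_congr fun a => ?_
  by_cases ha : μ a = 0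
  · simp [ha]
  · rw [h a ((PMF.mem_support_iff _ _).2 ha)]

theorem PMF.map_congr_support (μ : PMF X) {f g : X → Y} (h : ∀ a ∈ μ.support, f a = g a) :
    μ.map f = μ.map g := by
  unfold PMF.map
  exact PMF.bind_congr_support μ fun a ha => by simp [h a ha]

theorem unif_apply (l : ℕ) (w : Word) : unif l w = if w.length = l then (2 ^ l : ℝ≥0∞)⁻¹ else 0 := by
  classical
  rw [unif, PMF.map_apply]
  split_ifs with h
  · subst h
    refine (tsum_eq_single w.get fun v hv => if_neg fun e => hv ?_).trans ?_
    · exact List.ofFn_injective (e.symm.trans (List.ofFn_get w).symm)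
    · rw [if_pos (List.ofFn_get w).symm]
      simp
  · simp only [ENNReal.tsum_eq_zero]
    intro v
    rw [if_neg]
    rintro rfl
    simp at h

theorem mem_support_unif {l : ℕ} {w : Word} : w ∈ (unif l).support ↔ w.length = l := by
  rw [PMF.mem_support_iff, unif_apply]
  split_ifs with h <;> simp [h]

theorem unif_zero : unif 0 = PMF.pure [] := by
  ext w
  rw [unif_apply]
  by_cases h : w = [] <;> simp [h, List.length_eq_zero_iff, PMF.pure_apply]

theorem map_append_apply (μ : PMF Word) (u w : Word) :
    (μ.map (u ++ ·)) w = if w.take u.length = u then μ (w.drop u.length) else 0 := by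
  classical
  rw [PMF.map_apply]
  split_ifs with h
  · have h1 : ∀ v, w = u ++ v ↔ v = w.drop u.length := fun v =>
      ⟨fun e => by simp [e], fun e => by
        conv_lhs => rw [← List.take_append_drop u.length w, h, ← e]⟩
    simp only [h1, tsum_ite_eq]
  · simp only [ENNReal.tsum_eq_zero]
    intro v
    rw [if_neg]
    rintro rfl
    simp at h

theorem unif_add (k l : ℕ) : unif (k + l) = (unif k).bind fun u => (unif l).map (u ++ ·) := by
  ext w
  rw [PMF.bind_apply, tsum_eq_single (w.take k)]
  · rw [map_append_apply, unif_apply, unif_apply, unif_apply, List.length_drop, List.length_take]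
    by_cases h : w.length = k + l
    · have hk : min k w.length = k := by omega
      rw [if_pos h, if_pos hk, hk, if_pos rfl, if_pos (by omega), pow_add,
        ENNReal.mul_inv (by simp) (by simp)]
    · rw [if_neg h]
      split_ifs <;> first | (exfalso; omega) | simp
  · intro u hu
    rw [map_append_apply, unif_apply]
    split_ifs with h1 h2
    · rw [h1] at h2; exact absurd h2.symm hu
    all_goals simp

theorem unif_map_take {k l : ℕ} (h : k ≤ l) : (unif l).map (List.take k) = unif k := by
  obtain ⟨m, rfl⟩ := Nat.exists_eq_add_of_le h
  rw [unif_add, PMF.map_bind]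
  refine (PMF.bind_congr_support _ fun u hu => ?_).trans (PMF.bind_pure _)
  rw [PMF.map_comp, PMF.map_congr_support (g := Function.const _ u), PMF.map_const]
  intro v _
  simp [← mem_support_unif.1 hu]

/-- Overwriting the first bits by `u` amounts to conditioning on the prefix `u`, an event of
probability `2 ^ (-|u|)`. -/
theorem unif_map_prefix (u : Word) {l : ℕ} (h : u.length ≤ l) (w : Word) :
    (unif l).map (fun y => u ++ y.drop u.length) w
      = unif l w * if w.take u.length = u then 2 ^ u.length else 0 := by
  obtain ⟨m, rfl⟩ := Nat.exists_eq_add_of_le h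
  have h1 : (unif (u.length + m)).map (fun y => u ++ y.drop u.length) = (unif m).map (u ++ ·) := by
    rw [unif_add, PMF.map_bind]
    refine (PMF.bind_congr_support (g := fun _ => (unif m).map (u ++ ·)) _ fun v hv => ?_).trans
      (PMF.bind_const _ _)
    rw [PMF.map_comp]
    refine PMF.map_congr_support _ fun y _ => ?_
    simp [← mem_support_unif.1 hv]
  rw [h1, map_append_apply]
  split_ifs with h2
  · have h3 : u.length ≤ w.length := by
      have := congrArg List.length h2
      simp at this; omega
    rw [unif_apply, unif_apply, List.length_drop]
    by_cases h4 : w.length = u.length + m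
    · rw [if_pos h4, if_pos (by omega), pow_add, ENNReal.mul_inv (by simp) (by simp), mul_right_comm,
        ENNReal.inv_mul_cancel (by simp) (by simp), one_mul]
    · rw [if_neg h4, if_neg (by omega), zero_mul]
  · simp

/-- Carries a change of density from the components of a mixture to the mixture. -/
theorem bind_apply_mul {μ ν : PMF X} {f f' : X → PMF Y} {u : Y} {W c : ℝ≥0∞}
    (h : ∀ a, μ a * (f a u * W) = c * (ν a * f' a u)) : μ.bind f u * W = c * ν.bind f' u := by
  rw [PMF.bind_apply, PMF.bind_apply, ← ENNReal.tsum_mul_right, ← ENNReal.tsum_mul_left]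
  exact tsum_congr fun a => by rw [mul_assoc, h]

/-! ### Distances -/

theorem summable_toReal (μ : PMF X) : Summable fun x => (μ x).toReal :=
  ENNReal.summable_toReal μ.tsum_coe_ne_top

theorem summable_abs_sub (μ ν : PMF X) : Summable fun x => |(μ x).toReal - (ν x).toReal| :=
  ((summable_toReal μ).sub (summable_toReal ν)).abs

theorem toReal_tsub_add_tsub {a b : ℝ≥0∞} (ha : a ≠ ∞) (hb : b ≠ ∞) :
    ((a - b) + (b - a)).toReal = |a.toReal - b.toReal| := by
  rcases le_total a b with h | h
  · rw [tsub_eq_zero_of_le h, zero_add, ENNReal.toReal_sub_of_le h hb, abs_sub_comm,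
      abs_of_nonneg (sub_nonneg.2 (ENNReal.toReal_mono hb h))]
  · rw [tsub_eq_zero_of_le h, add_zero, ENNReal.toReal_sub_of_le h ha,
      abs_of_nonneg (sub_nonneg.2 (ENNReal.toReal_mono ha h))]

/-- Distances are handled as sums of two truncated differences in `ℝ≥0∞`, where sums may be
exchanged without questions of summability. -/
theorem tsum_abs_sub_eq {a b : X → ℝ≥0∞} (ha : ∀ x, a x ≠ ∞) (hb : ∀ x, b x ≠ ∞) :
    ∑' x, |(a x).toReal - (b x).toReal| = (∑' x, ((a x - b x) + (b x - a x))).toReal := by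
  rw [ENNReal.tsum_toReal_eq fun x => ENNReal.add_ne_top.2
    ⟨ENNReal.sub_ne_top (ha x), ENNReal.sub_ne_top (hb x)⟩]
  exact tsum_congr fun x => (toReal_tsub_add_tsub (ha x) (hb x)).symm

theorem tsum_tsub_add_tsub_ne_top (μ ν : PMF X) : ∑' x, ((μ x - ν x) + (ν x - μ x)) ≠ ∞ := by
  rw [ENNReal.tsum_add]
  exact ENNReal.add_ne_top.2
    ⟨ne_top_of_le_ne_top μ.tsum_coe_ne_top (ENNReal.tsum_le_tsum fun x => tsub_le_self),
      ne_top_of_le_ne_top ν.tsum_coe_ne_top (ENNReal.tsum_le_tsum fun x => tsub_le_self)⟩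

/-- From `μ ≤ (μ - ν) + ν` the excess of the image is at most the image of the excess, and a kernel
preserves total mass. -/
theorem tsum_bind_tsub_le (μ ν : PMF X) (κ : X → PMF Y) :
    ∑' y, (μ.bind κ y - ν.bind κ y) ≤ ∑' x, (μ x - ν x) := by
  have h : ∀ y, μ.bind κ y - ν.bind κ y ≤ ∑' x, (μ x - ν x) * κ x y := fun y => by
    rw [tsub_le_iff_right, PMF.bind_apply, PMF.bind_apply, ← ENNReal.tsum_add]
    refine ENNReal.tsum_le_tsum fun x => ?_
    rw [← add_mul]
    exact mul_le_mul_left le_tsub_add _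
  refine (ENNReal.tsum_le_tsum h).trans ?_
  rw [ENNReal.tsum_comm]
  refine ENNReal.tsum_le_tsum fun x => ?_
  rw [ENNReal.tsum_mul_left, PMF.tsum_coe, mul_one]

/-- Markov kernels do not increase the distance of distributions. -/
theorem tsum_abs_bind_sub_le (μ ν : PMF X) (κ : X → PMF Y) :
    ∑' y, |(μ.bind κ y).toReal - (ν.bind κ y).toReal| ≤ ∑' x, |(μ x).toReal - (ν x).toReal| := by
  rw [tsum_abs_sub_eq (fun _ => PMF.apply_ne_top _ _) (fun _ => PMF.apply_ne_top _ _),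
    tsum_abs_sub_eq (fun _ => PMF.apply_ne_top _ _) (fun _ => PMF.apply_ne_top _ _)]
  refine ENNReal.toReal_mono (tsum_tsub_add_tsub_ne_top _ _) ?_
  rw [ENNReal.tsum_add, ENNReal.tsum_add]
  exact add_le_add (tsum_bind_tsub_le _ _ _) (tsum_bind_tsub_le _ _ _)

theorem expect_nonneg (μ : PMF X) {h : X → ℝ} (h0 : ∀ x, 0 ≤ h x) : 0 ≤ expect μ h :=
  tsum_nonneg fun x => mul_nonneg ENNReal.toReal_nonneg (h0 x)

theorem expect_le (μ : PMF X) {h : X → ℝ} {C : ℝ} (h0 : ∀ x, 0 ≤ h x) (h1 : ∀ x, h x ≤ C) :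
    expect μ h ≤ C := by
  have hs := (summable_toReal μ).mul_right C
  have hle : ∀ x, (μ x).toReal * h x ≤ (μ x).toReal * C := fun x =>
    mul_le_mul_of_nonneg_left (h1 x) ENNReal.toReal_nonneg
  have h2 := (Summable.of_nonneg_of_le
    (fun x => mul_nonneg ENNReal.toReal_nonneg (h0 x)) hle hs).tsum_le_tsum hle hs
  rw [tsum_mul_right, ← ENNReal.tsum_toReal_eq fun x => PMF.apply_ne_top _ _, μ.tsum_coe] at h2
  simpa [expect] using h2

theorem expect_eq_zero (μ : PMF X) {h : X → ℝ} (h0 : ∀ x ∈ μ.support, h x = 0) :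
    expect μ h = 0 := by
  refine (tsum_congr fun x => ?_).trans tsum_zero
  by_cases hx : μ x = 0
  · simp [hx]
  · rw [h0 x ((PMF.mem_support_iff _ _).2 hx), mul_zero]

theorem expect_pure (a : X) (h : X → ℝ) : expect (PMF.pure a) h = h a := by
  classical
  rw [expect, tsum_eq_single a fun x hx => by simp [PMF.pure_apply, hx]]
  simp

/-- A function that vanishes where `ν` does not is small on average over `μ` close to `ν`. -/
theorem expect_le_mul_tsum_abs_sub (μ ν : PMF X) {h : X → ℝ} {C : ℝ} (h0 : ∀ x, 0 ≤ h x)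
    (h1 : ∀ x, h x ≤ C) (h2 : ∀ x ∈ μ.support, x ∈ ν.support → h x = 0) :
    expect μ h ≤ C * ∑' x, |(μ x).toReal - (ν x).toReal| := by
  have hs := (summable_abs_sub μ ν).mul_left C
  have hle : ∀ x, (μ x).toReal * h x ≤ C * |(μ x).toReal - (ν x).toReal| := fun x => by
    have hC := (h0 x).trans (h1 x)
    by_cases hx : μ x = 0
    · rw [hx, ENNReal.toReal_zero, zero_mul]; positivity
    · by_cases hy : ν x = 0
      · rw [hy, ENNReal.toReal_zero, sub_zero, abs_of_nonneg ENNReal.toReal_nonneg, mul_comm]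
        exact mul_le_mul_of_nonneg_right (h1 x) ENNReal.toReal_nonneg
      · rw [h2 x ((PMF.mem_support_iff _ _).2 hx) ((PMF.mem_support_iff _ _).2 hy), mul_zero]
        positivity
  rw [← tsum_mul_left]
  exact (Summable.of_nonneg_of_le (fun x => mul_nonneg ENNReal.toReal_nonneg (h0 x)) hle
    hs).tsum_le_tsum hle hs

-- The positive and the negative part of `p` minus the point mass at `a` each have at most the mass
-- that `p` puts outside `a`.
open Classical in
theorem half_mul_tsum_pure_le {p : X → ℝ≥0∞} (hp : ∑' x, p x = 1) (a : X) :
    2⁻¹ * ∑' x, ((p x - PMF.pure a x) + (PMF.pure a x - p x)) ≤ ∑' x, if x = a then 0 else p x := by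
  have h1 : ∑' x, (PMF.pure a x - p x) ≤ ∑' x, if x = a then 0 else p x := by
    rw [tsum_eq_single a fun x hx => by simp [PMF.pure_apply, hx], PMF.pure_apply, if_pos rfl,
      tsub_le_iff_right, ← hp]
    rw [show p a = ∑' x, if x = a then p x else 0 by rw [tsum_ite_eq], ← ENNReal.tsum_add]
    exact ENNReal.tsum_le_tsum fun x => by split_ifs <;> simp
  have h2 : ∑' x, (p x - PMF.pure a x) ≤ ∑' x, if x = a then 0 else p x := by
    refine ENNReal.tsum_le_tsum fun x => ?_
    split_ifs with h
    · rw [h, PMF.pure_apply, if_pos rfl, tsub_le_iff_right, zero_add, ← hp]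
      exact ENNReal.le_tsum a
    · exact tsub_le_self
  rw [ENNReal.tsum_add]
  refine (mul_le_mul_right (add_le_add h2 h1) _).trans ?_
  rw [← two_mul, ← mul_assoc, ENNReal.inv_mul_cancel (by simp) (by simp), one_mul]

open Classical in
/-- If `h` inverts the kernel `κ` on the support of `ν`, then it samples from the posterior
distributions of `μ` up to the distance from `μ` to `ν`. -/
theorem expect_tvDist_posterior_le (μ ν : PMF X) (κ : X → PMF Y) (h : Y → X)
    (hh : ∀ x ∈ ν.support, ∀ y ∈ (κ x).support, h y = x) :
    expect (μ.bind κ) (fun y => tvDist (posterior μ κ y) fun x => (PMF.pure (h y) x).toReal)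
      ≤ ∑' x, |(μ x).toReal - (ν x).toReal| := by
  set p : Y → X → ℝ≥0∞ := fun y x => μ x * κ x y / μ.bind κ y with hpdef
  -- Where `y` has probability zero, the quotient is `0 / 0 = 0`.
  have hp_top : ∀ y x, p y x ≠ ∞ := fun y x => by
    by_cases hy : μ.bind κ y = 0
    · have : μ x * κ x y = 0 := by
        rw [PMF.bind_apply, ENNReal.tsum_eq_zero] at hy
        exact hy x
      simp [hpdef, this]
    · exact ENNReal.div_ne_top (ENNReal.mul_ne_top (PMF.apply_ne_top _ _) (PMF.apply_ne_top _ _)) hy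
  set τ : Y → ℝ≥0∞ := fun y => 2⁻¹ * ∑' x, ((p y x - PMF.pure (h y) x) + (PMF.pure (h y) x - p y x))
  have hτ : ∀ y, tvDist (posterior μ κ y) (fun x => (PMF.pure (h y) x).toReal) = (τ y).toReal :=
    fun y => by
      rw [tvDist, ENNReal.toReal_mul, ← tsum_abs_sub_eq (hp_top y) fun x => PMF.apply_ne_top _ _]
      simp [posterior, hpdef]
  -- Weighted with the probability of `y`, the error is at most the joint mass of the pairs with `x
  -- ≠ h y`.
  have hmul : ∀ y, μ.bind κ y * τ y ≤ ∑' x, if x = h y then 0 else μ x * κ x y := fun y => by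
    by_cases hy : μ.bind κ y = 0
    · simp [hy]
    · have hy' : μ.bind κ y ≠ ∞ := PMF.apply_ne_top _ _
      have hsum : ∑' x, p y x = 1 := by
        simp only [hpdef, div_eq_mul_inv]
        rw [ENNReal.tsum_mul_right, ← PMF.bind_apply, ENNReal.mul_inv_cancel hy hy']
      refine (mul_le_mul_right (half_mul_tsum_pure_le hsum (h y)) _).trans ?_
      rw [← ENNReal.tsum_mul_left]
      refine ENNReal.tsum_le_tsum fun x => ?_
      rw [mul_ite, mul_zero, hpdef]
      dsimp only
      rw [ENNReal.mul_div_cancel hy hy']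
  -- Such pairs occur only for `x` outside the support of `ν`, and there `μ x = μ x - ν x`.
  have hle : ∑' y, μ.bind κ y * τ y ≤ ∑' x, (μ x - ν x) := by
    refine (ENNReal.tsum_le_tsum hmul).trans ?_
    rw [ENNReal.tsum_comm]
    refine ENNReal.tsum_le_tsum fun x => ?_
    by_cases hx : ν x = 0
    · rw [hx, tsub_zero]
      refine (ENNReal.tsum_le_tsum (g := fun y => μ x * κ x y) fun y => ?_).trans ?_
      · split_ifs <;> simp
      · rw [ENNReal.tsum_mul_left, PMF.tsum_coe, mul_one]
    · refine le_of_eq_of_le (ENNReal.tsum_eq_zero.2 fun y => ?_) zero_le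
      by_cases hy : κ x y = 0
      · simp [hy]
      · rw [if_pos (hh x ((PMF.mem_support_iff _ _).2 hx) y ((PMF.mem_support_iff _ _).2 hy)).symm]
  have hle' : ∑' y, μ.bind κ y * τ y ≤ ∑' x, ((μ x - ν x) + (ν x - μ x)) :=
    hle.trans (ENNReal.tsum_le_tsum fun x => le_self_add)
  rw [tsum_abs_sub_eq (fun _ => PMF.apply_ne_top _ _) (fun _ => PMF.apply_ne_top _ _)]
  refine le_of_eq_of_le ?_ (ENNReal.toReal_mono (tsum_tsub_add_tsub_ne_top _ _) hle')
  rw [ENNReal.tsum_toReal_eq fun y => ne_top_of_le_ne_top (tsum_tsub_add_tsub_ne_top μ ν)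
    ((ENNReal.le_tsum y).trans hle')]
  exact tsum_congr fun y => by rw [ENNReal.toReal_mul, ← hτ]

end

/-! ## Fall spaces -/

section

variable {n : ℕ}

theorem FallSpace.zero_mem (F : FallSpace n) : (fun _ => 0) ∈ F.carrier := by
  obtain ⟨h, hh⟩ := F.exp_mem
  exact F.mono _ hh _ (fun _ => le_rfl) fun K => by positivity

/-- Closure under sums gives natural multiples, and monotonicity then gives arbitrary constant
factors. -/
theorem FallSpace.mem_of_le_mul (F : FallSpace n) {ε δ : (Fin n → ℕ) → ℝ} (hε : ε ∈ F.carrier) (C : ℝ)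
    (h0 : ∀ K, 0 ≤ δ K) (h : ∀ K, δ K ≤ C * ε K) : δ ∈ F.carrier := by
  obtain ⟨N, hN⟩ := exists_nat_ge C
  have hNε : (fun K => N * ε K) ∈ F.carrier := by
    clear hN
    induction N with
    | zero => simpa using F.zero_mem
    | succ N ih =>
      refine (funext fun K => ?_ : (fun K => N * ε K) + ε = fun K => ((N + 1 : ℕ) : ℝ) * ε K) ▸
        F.add _ ih _ hε
      simp only [Pi.add_apply]; push_cast; ring
  exact F.mono _ hNε _ h0 fun K =>
    (h K).trans (mul_le_mul_of_nonneg_right hN (F.nonneg _ hε K))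

/-! ## Efficient injections -/

/-- Strict monotonicity implies `k ≤ p(J, k)`. So the preimage is the greatest `k`, up to the given
last component, at which `p(J, k)` does not exceed that component; the inverse so defined never
exceeds its argument. -/
theorem efficientInjection_alphaP (p : MvPolynomial (Fin (n + 1)) ℕ)
    (hp : IncreasingLast fun K => MvPolynomial.eval K p) : EfficientInjection (alphaP p) where
  poly i := by
    by_cases hi : i = Fin.last n
    · subst hi
      exact ⟨p, fun L => by simp [alphaP]⟩
    · exact ⟨.X i, fun L => by simp [alphaP, hi]⟩
  time := polyTime_alphaP p
  inv := by
    classical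
    refine ⟨fun K => Function.update K (Fin.last n) (Nat.findGreatest (fun k =>
      MvPolynomial.eval (Function.update K (Fin.last n) k) p ≤ K (Fin.last n)) (K (Fin.last n))),
      fun i => ⟨.X i, fun K => ?_⟩, fun L => ?_⟩
    · by_cases hi : i = Fin.last n
      · subst hi
        simpa using Nat.findGreatest_le _
      · simp [hi]
    · have hL : MvPolynomial.eval L p
          = MvPolynomial.eval (Function.update L (Fin.last n) (L (Fin.last n))) p := by simp
      have hle : L (Fin.last n) ≤ MvPolynomial.eval L p :=
        ((hp L).le_apply (x := L (Fin.last n))).trans_eq hL.symm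
      have : Nat.findGreatest (fun k => MvPolynomial.eval (Function.update L (Fin.last n) k) p
          ≤ MvPolynomial.eval L p) (MvPolynomial.eval L p) = L (Fin.last n) := by
        rw [Nat.findGreatest_eq_iff]
        refine ⟨hle, fun _ => hL.ge, fun k hk _ h => ?_⟩
        exact absurd ((hp L) hk) (not_lt.2 (h.trans_eq hL))
      simp [alphaP, this]

end

/-! ## Fast-growing polynomials -/

theorem Polynomial.exists_eval_le_mul_pow (q : Polynomial ℕ) :
    ∃ C d : ℕ, ∀ y, 1 ≤ y → q.eval y ≤ C * y ^ d := by
  induction q using Polynomial.induction_on' with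
  | add p q hp hq =>
    obtain ⟨C, d, hp⟩ := hp
    obtain ⟨C', d', hq⟩ := hq
    refine ⟨C + C', d + d', fun y hy => ?_⟩
    rw [Polynomial.eval_add, add_mul]
    exact add_le_add ((hp y hy).trans (Nat.mul_le_mul_left _ (Nat.pow_le_pow_right hy (by omega))))
      ((hq y hy).trans (Nat.mul_le_mul_left _ (Nat.pow_le_pow_right hy (by omega))))
  | monomial k a => exact ⟨a, k, fun y _ => by simp⟩

/-- If `q y ≤ C * y ^ d`, it suffices that `C * (c + 1) ^ d ≤ x ^ (c + 1 - d)`. Because `x ≥ 2`, the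
right side is at least `2 ^ (c + 1 - d)`, which wins for large `c` uniformly in `x`. This is what
lets the clock outrun a simulation whose cost also depends on `c`. -/
theorem Polynomial.exists_eval_le_pow (q : Polynomial ℕ) :
    ∃ c₀ : ℕ, ∀ c, c₀ ≤ c → ∀ x, 2 ≤ x → q.eval (x * (c + 1)) ≤ x ^ (c + 1) := by
  obtain ⟨C, d, hq⟩ := Polynomial.exists_eval_le_mul_pow q
  have ht := (tendsto_pow_const_div_const_pow_of_one_lt d (one_lt_two (α := ℝ))).eventually
    (gt_mem_nhds (show (0 : ℝ) < 1 / ((C + 1) * 2 ^ d) by positivity))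
  obtain ⟨m, hm⟩ := Filter.eventually_atTop.1 ht
  -- `m` is the threshold of the exponential estimate; adding `d` makes `c + 1 - d` a genuine
  -- difference.
  refine ⟨m + d, fun c hc x hx => (hq _ (by nlinarith)).trans ?_⟩
  have h1 := hm (c + 1) (by omega)
  rw [div_lt_div_iff₀ (by positivity) (by positivity), one_mul] at h1
  have h2 : (c + 1) ^ d * ((C + 1) * 2 ^ d) < 2 ^ (c + 1) := by exact_mod_cast h1
  have h3 : C * (c + 1) ^ d * 2 ^ d ≤ 2 ^ (c + 1 - d) * 2 ^ d := by
    rw [← pow_add, Nat.sub_add_cancel (by omega)]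
    refine le_trans ?_ h2.le
    calc C * (c + 1) ^ d * 2 ^ d = (c + 1) ^ d * (C * 2 ^ d) := by ring
      _ ≤ _ := Nat.mul_le_mul_left _ (Nat.mul_le_mul_right _ (by omega))
  have h4 : C * (c + 1) ^ d ≤ x ^ (c + 1 - d) :=
    (Nat.le_of_mul_le_mul_right h3 (by positivity)).trans (Nat.pow_le_pow_left hx _)
  calc C * (x * (c + 1)) ^ d = x ^ d * (C * (c + 1) ^ d) := by rw [mul_pow]; ring
    _ ≤ x ^ d * x ^ (c + 1 - d) := Nat.mul_le_mul_left _ h4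
    _ = x ^ (c + 1) := by rw [← pow_add, Nat.add_sub_cancel' (by omega)]

theorem MvPolynomial.exists_eval_le {m : ℕ} (t : MvPolynomial (Fin m) ℕ) :
    ∃ q : Polynomial ℕ, ∀ L, MvPolynomial.eval L t ≤ q.eval (∑ i, L i) := by
  induction t using MvPolynomial.induction_on with
  | C c => exact ⟨Polynomial.C c, fun L => by simp⟩
  | add p q hp hq =>
    obtain ⟨p', hp⟩ := hp
    obtain ⟨q', hq⟩ := hq
    exact ⟨p' + q', fun L => by simpa using add_le_add (hp L) (hq L)⟩
  | mul_X p i hp =>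
    obtain ⟨p', hp⟩ := hp
    exact ⟨p' * .X, fun L => by
      simpa using Nat.mul_le_mul (hp L)
        (Finset.single_le_sum (f := L) (fun _ _ => Nat.zero_le _) (Finset.mem_univ i))⟩

/-! ### The polynomials `powPolynomial` and the choice of the program -/

section

variable {n : ℕ}

/-- The polynomial `p` with `alphaP p = powIndex c`. -/
noncomputable def powPolynomial (n c : ℕ) : MvPolynomial (Fin (n + 1)) ℕ :=
  (4 * ∑ i, MvPolynomial.X i + 2) ^ (c + 1)

theorem eval_powPolynomial (c : ℕ) (L : Fin (n + 1) → ℕ) :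
    MvPolynomial.eval L (powPolynomial n c) = (4 * ∑ i, L i + 2) ^ (c + 1) := by
  simp [powPolynomial]

theorem alphaP_powPolynomial (c : ℕ) (L : Fin (n + 1) → ℕ) :
    alphaP (powPolynomial n c) L = powIndex c L := by
  rw [alphaP, eval_powPolynomial, powIndex]

theorem increasingLast_powPolynomial (c : ℕ) :
    IncreasingLast fun K => MvPolynomial.eval K (powPolynomial n c) := by
  intro K k l hkl
  simp only [eval_powPolynomial, Fin.sum_univ_castSucc]
  refine Nat.pow_lt_pow_left ?_ (by omega)
  simp only [Function.update_self, Function.update_of_ne (Fin.castSucc_lt_last _).ne]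
  omega

/-- Since `x ^ (c + 1) < 2 ^ (x * (c + 1))`, the code of the index is only linear in `c`, whereas
the clock is exponential in it. -/
theorem length_enc_powIndex_le (c : ℕ) (L : Fin (n + 1) → ℕ) :
    (Coded.enc (powIndex c L)).length
      ≤ 2 * (∑ i, L i + (4 * ∑ i, L i + 2) * (c + 1)) + 2 * (n + 1) := by
  refine (length_tuple_le _).trans ?_
  rw [List.map_ofFn, List.sum_ofFn, List.length_ofFn, Fin.sum_univ_castSucc, Fin.sum_univ_castSucc]
  have h1 : ∑ i : Fin n, (List.length ∘ fun i => (Coded.enc (powIndex c L i) : Word)) i.castSucc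
      ≤ ∑ i : Fin n, L i.castSucc := Finset.sum_le_sum fun i _ =>
    (length_bits_le (powIndex c L i.castSucc)).trans_eq (by
      rw [powIndex, Function.update_of_ne (Fin.castSucc_lt_last i).ne])
  have h2 : (List.length ∘ fun i => (Coded.enc (powIndex c L i) : Word)) (Fin.last n)
      ≤ (4 * (∑ i : Fin n, L i.castSucc + L (Fin.last n)) + 2) * (c + 1) := by
    have h3 : (List.length ∘ fun i => (Coded.enc (powIndex c L i) : Word)) (Fin.last n)
        = Nat.size (powIndex c L (Fin.last n)) := (Nat.size_eq_bits_len _)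
    rw [h3, powIndex, Function.update_self, Nat.size_le, pow_mul, Fin.sum_univ_castSucc]
    exact Nat.pow_lt_pow_left Nat.lt_two_pow_self (by omega)
  omega

/-- The word `z` and the zeros behind it form one infinite continuation of `a`, as quantified over
in `TM.IsPrefixFreeUniversal`. -/
theorem programTape_append (a z : Word) :
    programTape (a ++ z) (fun _ => false) = programTape a fun i => z.getD i false := by
  funext j
  unfold programTape
  split_ifs with h
  · congr 1
    simp only [List.getD_eq_getElem?_getD]
    rcases lt_or_ge j.toNat a.length with h | h
    · rw [List.getElem?_append_left h, List.getElem?_eq_getElem h]; rfl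
    · rw [List.getElem?_append_right h, List.getElem?_eq_none h]; rfl
  · rfl

/-- The head of the output tape starts at cell `0`, so after `t` steps cell `t` is still blank. -/
theorem TM.length_output_le {n : ℕ} (M : TM n) (inp : Fin n → ℤ → Option Bool) (t : ℕ) :
    (M.run inp t).output.length ≤ t := by
  have h : (M.run inp t).head 0 ≤ t ∧ ∀ j : ℤ, t ≤ j → (M.run inp t).cells 0 j = none := by
    induction t with
    | zero => exact ⟨le_rfl, fun _ _ => rfl⟩
    | succ t ih =>
      rw [TM.run_succ]
      unfold TM.step
      cases M.δ (M.run inp t).state (fun i => inp i ((M.run inp t).inHead i))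
        (fun j => (M.run inp t).cells j ((M.run inp t).head j)) with
      | none =>
        refine ⟨ih.1.trans (by simp), fun j hj => ih.2 j ?_⟩
        push_cast at hj; omega
      | some d =>
        have : (d.2.2 0).2.offset ≤ 1 := by cases (d.2.2 0).2 <;> simp [Move.offset]
        have h1 := ih.1
        refine ⟨?_, fun j hj => ?_⟩
        · simp; omega
        · push_cast at hj
          simp only [Option.map_some, Option.getD_some]
          rw [Function.update_of_ne (by omega)]
          exact ih.2 j (by omega)
  refine le_of_eq_of_le (b := sInf {i : ℕ | (M.run inp t).cells 0 i = none}) ?_ ?_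
  · simp [TM.Cfg.output]
  exact Nat.sInf_le (h.2 t le_rfl)

variable {ΓR : Set ((Fin (n + 1) → ℕ) → ℕ)}

theorem SteadilyGrowing.exists_le {γ : (Fin (n + 1) → ℕ) → ℕ} (h : SteadilyGrowing γ)
    (h1 : ∀ K, 1 ≤ γ K) (l : ℕ) : ∃ t : MvPolynomial (Fin (n + 1)) ℕ, ∀ K, l ≤ γ (alphaP t K) := by
  obtain ⟨t, ht⟩ := h.exists_two_pow_mul_le l
  exact ⟨t, fun K => (Nat.lt_two_pow_self.le.trans (Nat.le_mul_of_pos_right _ (h1 K))).trans (ht K)⟩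

theorem SteadilyGrowing.alphaP_mono {γ : (Fin (n + 1) → ℕ) → ℕ} (h : SteadilyGrowing γ)
    {t p : MvPolynomial (Fin (n + 1)) ℕ} {K : Fin (n + 1) → ℕ}
    (htp : MvPolynomial.eval K t ≤ MvPolynomial.eval K p) : γ (alphaP t K) ≤ γ (alphaP p K) :=
  h.mono K htp

/-- A universal machine can be made to sample from a given samplable ensemble. -/
theorem exists_program {r s : (Fin (n + 1) → ℕ) → ℕ} (hr : SteadilyGrowing r)
    (hs : SteadilyGrowing s) (hr1 : ∀ K, 1 ≤ r K) {U : TM 3} (hU : U.IsPrefixFreeUniversal)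
    (σ : Scheme (n + 1) (GammaOf s) (GammaZero (n + 1)) Unit Word) (l : ℕ)
    (t : MvPolynomial (Fin (n + 1)) ℕ) :
    ∃ (a : Word) (p : MvPolynomial (Fin (n + 1)) ℕ), IncreasingLast (fun K => MvPolynomial.eval K p) ∧
      ∀ L, σ.rnd L [] ≤ s (alphaP p L) ∧ l ≤ r (alphaP p L) ∧ a.length ≤ r (alphaP p L) ∧
        MvPolynomial.eval L t ≤ MvPolynomial.eval L p ∧
        ∀ z w, U.ev (alphaP p L (Fin.last n)) (a ++ z) ![Coded.enc (alphaP p L), w]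
          = σ.alg L () (w.take (σ.rnd L [])) [] := by
  have hσ : (fun L => σ.rnd L []) ∈ GammaOf s := by simpa only [σ.adv_eq_nil] using σ.rnd_mem
  obtain ⟨b, hb⟩ := GammaOf.poly hs.poly hσ
  obtain ⟨t₁, ht₁⟩ := hσ
  -- The machine, its program `a` and the time bounds `qN`, `qU` are all fixed before `c`.
  obtain ⟨N, qN, hN⟩ := exists_sampling_machine σ hb
  obtain ⟨a, qU, ha⟩ := hU N
  obtain ⟨t₂, ht₂⟩ := hr.exists_le hr1 (max l a.length)
  obtain ⟨Q₁, hQ₁⟩ := MvPolynomial.exists_eval_le (t + t₁ + t₂)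
  -- `Q₁` covers the lower bounds on `p`, and the composite is the simulation time. With `X = (4 * g
  -- + 2) * (c + 1)` and `g + 1 ≤ X`, the number `g + 1` plus the length of the code is at most `5 *
  -- X + 2 * (n + 1)`.
  obtain ⟨c, hc⟩ := Polynomial.exists_eval_le_pow
    (Q₁ + qU.comp (qN.comp (5 * .X + Polynomial.C (2 * (n + 1)))))
  have hc := hc c le_rfl
  refine ⟨a, powPolynomial n c, increasingLast_powPolynomial c, fun L => ?_⟩
  set g := ∑ i, L i with hg
  have hX : g + 1 ≤ (4 * g + 2) * (c + 1) := by nlinarith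
  have hcg := hc (4 * g + 2) (by omega)
  rw [Polynomial.eval_add, Polynomial.eval_comp, Polynomial.eval_comp, ← eval_powPolynomial] at hcg
  have h1 : MvPolynomial.eval L t + MvPolynomial.eval L t₁ + MvPolynomial.eval L t₂
      ≤ Q₁.eval ((4 * g + 2) * (c + 1)) := by
    rw [← map_add, ← map_add]
    exact (hQ₁ L).trans (eval_mono_nat _ (by omega))
  refine ⟨(ht₁ L).trans (hs.alphaP_mono (by omega)), ?_, ?_, by omega, fun z w => ?_⟩
  · exact ((le_max_left _ _).trans (ht₂ L)).trans (hr.alphaP_mono (by omega))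
  · exact ((le_max_right _ _).trans (ht₂ L)).trans (hr.alphaP_mono (by omega))
  · have h2 := ha _ _ _ (hN c L w) fun i => z.getD i false
    rw [TM.ev, programTape_append, alphaP_powPolynomial]
    refine h2.run_eq ((eval_mono_nat _ (eval_mono_nat _ ?_)).trans
      (le_trans (Nat.le_add_left _ _) (hcg.trans_eq ?_)))
    · have := length_enc_powIndex_le c L
      rw [← hg] at this ⊢
      simp only [Polynomial.eval_add, Polynomial.eval_mul, Polynomial.eval_X, Polynomial.eval_C,
        Polynomial.eval_ofNat]
      omega
    · rw [powIndex, Function.update_self, eval_powPolynomial]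

end

/-! ## The reduction -/

section

open scoped ENNReal

theorem unif_add_map {Y : Type*} (k l : ℕ) (f : Word → Y) :
    (unif (k + l)).map f = (unif k).bind fun u => (unif l).map fun v => f (u ++ v) := by
  rw [unif_add, PMF.map_bind]
  simp only [PMF.map_comp, Function.comp_def]

/-- Fixing prefixes of `b` and `a` amounts to a change of density. -/
theorem bind_unif_prefix_apply {k l : ℕ} {u v : Word} (hu : u.length ≤ k) (hv : v.length ≤ k)
    (G : Word → Word → Word → Word) {W : Word → ℝ≥0∞}
    (hW : ∀ b a w, b.length = k → a.length = k → W (G b a w)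
      = (if b.take u.length = u then 2 ^ u.length else 0)
        * (if a.take v.length = v then 2 ^ v.length else 0)) (x : Word) :
    ((unif k).bind fun b => (unif k).bind fun a => (unif l).map fun w => G b a w) x * W x
      = ((unif k).bind fun b => (unif k).bind fun a => (unif l).map fun w =>
          G (u ++ b.drop u.length) (v ++ a.drop v.length) w) x := by
  have h1 : ((unif k).bind fun b => (unif k).bind fun a => (unif l).map fun w =>
      G (u ++ b.drop u.length) (v ++ a.drop v.length) w)
      = ((unif k).map fun y => u ++ y.drop u.length).bind fun b =>
        ((unif k).map fun y => v ++ y.drop v.length).bind fun a => (unif l).map fun w => G b a w := by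
    simp only [PMF.bind_map, Function.comp_def]
  rw [h1, ← one_mul (PMF.bind ((unif k).map fun y => u ++ y.drop u.length) _ x)]
  refine bind_apply_mul fun b => ?_
  rw [unif_map_prefix u hu, one_mul, mul_assoc]
  by_cases hb : b.length = k
  · congr 1
    refine bind_apply_mul fun a => ?_
    rw [unif_map_prefix v hv]
    by_cases ha : a.length = k
    · by_cases hx : ((unif l).map fun w => G b a w) x = 0
      · rw [hx]; simp
      · obtain ⟨w, -, rfl⟩ := (PMF.mem_support_map_iff _ _ _).1 ((PMF.mem_support_iff _ _).2 hx)
        rw [hW b a w hb ha]; ring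
    · rw [unif_apply, if_neg ha]; simp
  · rw [unif_apply, if_neg hb]; simp

variable {n : ℕ}

/-- Of two codes that are prefixes of one word, one is a prefix of the other, hence they are equal
by prefix-freeness. So the decomposition is unique and `Function.extend` takes the intended value.
-/
theorem prefixValue_append {E : Type*} [Coded E] (hpf : PrefixFree E) (𝔉 : E → ℕ → Word → ℝ) (φ : E)
    (z : Word) (k : ℕ) (x : Word) : prefixValue 𝔉 (Coded.enc φ ++ z) k x = 𝔉 φ k x := by
  have hinj : Function.Injective fun t : E × Word => Coded.enc t.1 ++ t.2 := by
    rintro ⟨ψ, u⟩ ⟨χ, v⟩ h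
    have key : ∀ (ψ χ : E) (u v : Word), (Coded.enc ψ).length ≤ (Coded.enc χ).length →
        Coded.enc ψ ++ u = Coded.enc χ ++ v → ψ = χ := by
      intro ψ χ u v hl h
      obtain ⟨w, hw⟩ := List.prefix_of_prefix_length_le ⟨u, h⟩ (List.prefix_append _ v) hl
      by_cases hw0 : w = []
      · rw [hw0, List.append_nil] at hw
        exact Coded.enc_injective hw
      · exact absurd hw.symm (hpf χ ψ w hw0)
    dsimp only at h
    obtain rfl : ψ = χ := by
      rcases le_total (Coded.enc ψ).length (Coded.enc χ).length with hl | hl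
      · exact key _ _ _ _ hl h
      · exact (key _ _ _ _ hl h.symm).symm
    rw [List.append_cancel_left h]
  exact hinj.extend_apply (fun t => 𝔉 t.1 k x) 0 (φ, z)

theorem universalFun_tuple {E : Type*} [Coded E] (𝔉 : E → ℕ → Word → ℝ) (b : Word) (k : ℕ)
    (a x : Word) : universalFun 𝔉 (tuple [b, Coded.enc k, a, x]) = prefixValue 𝔉 b k x := by
  have hinj : Function.Injective fun t : Word × ℕ × Word × Word =>
      tuple [t.1, Coded.enc t.2.1, t.2.2.1, t.2.2.2] := by
    rintro ⟨b, k, a, x⟩ ⟨b', k', a', x'⟩ h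
    have h1 := tuple_injective [b, Coded.enc k, a, x] [b', Coded.enc k', a', x'] rfl h
    simp only [List.cons.injEq, and_true] at h1
    obtain ⟨rfl, h2, rfl, rfl⟩ := h1
    rw [Coded.enc_injective h2]
  exact hinj.extend_apply (fun t => prefixValue 𝔉 t.1 t.2.1 t.2.2.2) 0 (b, k, a, x)

theorem DistProblem.fbar_of_mem (P : DistProblem n) {x : Word} (hx : x ∈ P.dist.supp) :
    P.fbar x = P.f ⟨x, hx⟩ :=
  Subtype.val_injective.extend_apply P.f 0 ⟨x, hx⟩

theorem DistProblem.exists_abs_fbar_le (P : DistProblem n) : ∃ C : ℝ, 0 ≤ C ∧ ∀ x, |P.fbar x| ≤ C := by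
  obtain ⟨C, hC⟩ := P.bounded
  exact ⟨max C 0, le_max_right _ _, abs_extend_le _ _ _ (le_max_right _ _) fun x =>
    (hC x).trans (le_max_left _ _)⟩

theorem length_tuple_four (b c a x : Word) : (tuple [b, c, a, x]).length
    = 2 * b.length + 2 * c.length + 2 * a.length + 2 * x.length + 6 := by
  simp only [tuple, List.length_append, List.length_cons, length_double]
  omega

/-- A scheme that uses no randomness and no advice. -/
noncomputable def Scheme.ofFun {m : ℕ} {X Y : Type*} [Coded X] [Coded Y] {ΓR ΓA : Set ((Fin m → ℕ) → ℕ)}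
    (f : (Fin m → ℕ) → X → Y) (hf : SchemeTime (fun L x (_ _ : Word) => f L x) fun _ _ => 0)
    (hR : (fun _ => 0) ∈ ΓR) (hA : (fun _ => 0) ∈ ΓA) : Scheme m ΓR ΓA X Y where
  alg L x _ _ := f L x
  rnd _ _ := 0
  adv _ := []
  time := hf
  rnd_mem := hR
  adv_mem := hA

theorem Scheme.kernel_ofFun {m : ℕ} {X Y : Type*} [Coded X] [Coded Y]
    {ΓR ΓA : Set ((Fin m → ℕ) → ℕ)} (f : (Fin m → ℕ) → X → Y) (hf) (hR) (hA) (K : Fin m → ℕ) (x : X) :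
    (Scheme.ofFun (ΓR := ΓR) (ΓA := ΓA) f hf hR hA).kernel K x = PMF.pure (f K x) := by
  simp only [Scheme.kernel, Scheme.ofFun, unif_zero, PMF.pure_map]

/-- A randomised scheme that uses no randomness and no advice. -/
noncomputable def MScheme.ofFun {m : ℕ} {X Y : Type*} [Coded X] [Coded Y]
    {ΓR ΓA : Set ((Fin m → ℕ) → ℕ)}
    (f : (Fin m → ℕ) → X → Y) (hf : SchemeTime (fun L x (_ _ : Word) => f L x) fun _ _ => 0)
    (hR : (fun _ => 0) ∈ ΓR) (hA : (fun _ => 0) ∈ ΓA) : MScheme m ΓR ΓA X Y where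
  alg L x _ _ := f L x
  rnd _ _ := 0
  adv _ := PMF.pure []
  time := hf
  rnd_mem := ⟨_, hR, fun _ _ _ => le_rfl⟩
  adv_mem := ⟨_, hA, fun _ z hz => by
    rw [PMF.support_pure, Set.mem_singleton_iff] at hz
    rw [hz]; rfl⟩

theorem MScheme.kernel_ofFun {m : ℕ} {X Y : Type*} [Coded X] [Coded Y]
    {ΓR ΓA : Set ((Fin m → ℕ) → ℕ)} (f : (Fin m → ℕ) → X → Y) (hf) (hR) (hA) (K : Fin m → ℕ) (x : X) :
    (MScheme.ofFun (ΓR := ΓR) (ΓA := ΓA) f hf hR hA).kernel K x = PMF.pure (f K x) := by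
  simp only [MScheme.kernel, MScheme.ofFun, unif_zero, PMF.pure_map, PMF.pure_bind]

theorem zero_mem_pullGrowth_gammaOf {m : ℕ} {r : (Fin (n + 1) → ℕ) → ℕ}
    (α : (Fin m → ℕ) → Fin (n + 1) → ℕ) : (fun _ => 0) ∈ pullGrowth (GammaOf r) α :=
  ⟨fun _ => 0, ⟨0, fun _ => Nat.zero_le _⟩, fun _ => le_rfl⟩

theorem zero_mem_pullGrowth_gammaZero {m : ℕ} (α : (Fin m → ℕ) → Fin n → ℕ) :
    (fun _ => 0) ∈ pullGrowth (GammaZero n) α :=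
  ⟨fun _ => 0, fun _ => rfl, fun _ => le_rfl⟩

theorem PolyTime.comp_alphaP {r : (Fin (n + 1) → ℕ) → ℕ} (h : PolyTime r)
    (p : MvPolynomial (Fin (n + 1)) ℕ) : PolyTime fun L => r (alphaP p L) :=
  polyTime_of_FPon (h.FPon (K := fun L => alphaP p L)
    (FPN.alphaP p fun i => FPN.unary (K := id) i))

theorem comp_alphaP_mem_gammaPoly {r : (Fin (n + 1) → ℕ) → ℕ} (h : r ∈ GammaPoly (n + 1))
    (p : MvPolynomial (Fin (n + 1)) ℕ) : (fun L => r (alphaP p L)) ∈ GammaPoly (n + 1) := by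
  obtain ⟨b, hb⟩ := h
  obtain ⟨b', hb'⟩ := exists_mvPolynomial_alphaP b p
  exact ⟨b', fun L => (hb _).trans_eq (hb' L).symm⟩

/-- The scheme of the reduction. -/
noncomputable def reduceScheme {r : (Fin (n + 1) → ℕ) → ℕ} (hrt : PolyTime r) (hr : SteadilyGrowing r)
    (p t : MvPolynomial (Fin (n + 1)) ℕ) (φ a : Word) :
    Scheme (n + 1) (pullGrowth (GammaOf r) (alphaP p))
      (pullGrowth (GammaZero (n + 1)) (alphaP p)) Word Word where
  alg L x y _ := reduceAlg (fun L => r (alphaP p L)) p t φ a L x y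
  rnd L _ := r (alphaP p L) + r (alphaP p L)
  adv _ := []
  time := schemeTime_reduceAlg (hrt.comp_alphaP p) (comp_alphaP_mem_gammaPoly hr.poly p) p t φ a
  -- The reduction uses `2 * r` random bits, which one doubling brings into the growth space of `r`.
  rnd_mem := ⟨fun K => r K + r K, hr.mem_gammaOf (i := 1) fun K => by omega, fun _ => le_rfl⟩
  adv_mem := zero_mem_pullGrowth_gammaZero _

theorem kernel_reduceScheme {r : (Fin (n + 1) → ℕ) → ℕ} (hrt : PolyTime r) (hr : SteadilyGrowing r)
    (p t : MvPolynomial (Fin (n + 1)) ℕ) (φ a : Word) (L : Fin (n + 1) → ℕ) (x : Word) :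
    (reduceScheme hrt hr p t φ a).kernel L x = (unif (r (alphaP p L))).bind fun u =>
      (unif (r (alphaP p L))).map fun v => tuple [φ ++ u.drop φ.length,
        Coded.enc (alphaP p L (Fin.last n)), a ++ v.drop a.length, x.take (MvPolynomial.eval L t)] := by
  simp only [Scheme.kernel, reduceScheme]
  rw [unif_add_map]
  refine PMF.bind_congr_support _ fun u hu => PMF.map_congr_support _ fun v hv => ?_
  rw [mem_support_unif] at hu hv
  simp only [reduceAlg, ← hu, List.take_left', List.drop_left']
  rw [List.take_of_length_le (by omega)]
  simp [alphaP]
  rfl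

end

/-! ### The reduction, and the sampler of the universal ensemble -/

section

variable {n : ℕ}

theorem tvDist_nonneg {X : Type*} (μ ν : X → ℝ) : 0 ≤ tvDist μ ν :=
  mul_nonneg (by norm_num) (tsum_nonneg fun _ => abs_nonneg _)

theorem tsum_abs_sub_eq_two_mul_tvDist {X : Type*} (μ ν : X → ℝ) :
    ∑' x, |μ x - ν x| = 2 * tvDist μ ν := by
  rw [tvDist]; ring

theorem Scheme.kernel_eq_map {m : ℕ} {X Y : Type*} [Coded X] [Coded Y] {ΓR : Set ((Fin m → ℕ) → ℕ)}
    (σ : Scheme m ΓR (GammaZero m) X Y) (K : Fin m → ℕ) (x : X) :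
    σ.kernel K x = (unif (σ.rnd K [])).map fun y => σ.alg K x y [] := by
  simp only [Scheme.kernel, σ.adv_eq_nil]

theorem SchemeTime.exists_length_le {m : ℕ} {X : Type*} [Coded X]
    {S : (Fin m → ℕ) → X → Word → Word → Word} {R : (Fin m → ℕ) → Word → ℕ} (h : SchemeTime S R) :
    ∃ t : MvPolynomial (Fin m) ℕ, ∀ K x y z, (S K x y z).length ≤ MvPolynomial.eval K t := by
  obtain ⟨M, t, hM⟩ := h.alg
  refine ⟨t, fun K x y z => ?_⟩
  have := M.length_output_le ![wordTape (Coded.enc K), wordTape (Coded.enc x), wordTape y,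
    wordTape z] (MvPolynomial.eval K t)
  rwa [(hM K x y z).2] at this

/-- The image of a samplable distribution under the reduction, if the program `a` simulates the
sampler. -/
theorem bind_kernel_reduceScheme {r s : (Fin (n + 1) → ℕ) → ℕ} (hrt : PolyTime r)
    (hr : SteadilyGrowing r) {U : TM 3} {p t : MvPolynomial (Fin (n + 1)) ℕ} (φ : Word) {a : Word}
    {R : ℕ} {f : Word → Word} {L : Fin (n + 1) → ℕ} (hf : ∀ y, (f y).length ≤ MvPolynomial.eval L t)
    (hR : R ≤ s (alphaP p L))
    (hU : ∀ z w, U.ev (alphaP p L (Fin.last n)) (a ++ z) ![Coded.enc (alphaP p L), w]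
      = f (w.take R)) :
    ((unif R).map f).bind ((reduceScheme hrt hr p t φ a).kernel L)
      = (unif (r (alphaP p L))).bind fun u => (unif (r (alphaP p L))).bind fun v =>
        (unif (s (alphaP p L))).map fun w => tuple [φ ++ u.drop φ.length,
          Coded.enc (alphaP p L (Fin.last n)), a ++ v.drop a.length,
          U.ev (alphaP p L (Fin.last n)) (a ++ v.drop a.length) ![Coded.enc (alphaP p L), w]] := by
  rw [PMF.bind_map]
  simp only [Function.comp_def, kernel_reduceScheme, hU, List.take_of_length_le (hf _)]
  rw [PMF.bind_comm]
  congr 1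
  funext u
  simp only [PMF.map, Function.comp_def]
  rw [PMF.bind_comm]
  congr 1
  funext v
  -- The sampler needs only the first `R` bits of `w`; the remaining ones are integrated out.
  rw [← unif_map_take hR, PMF.bind_map]
  rfl

/-- For inputs drawn from the sampler every condition holds exactly: `hdens` gives the density of
the image, and `hform` the shape of its words. Each error for `P.dist` is then at most a constant
times the distance in `hnear`, and the fall space absorbs the constant. -/
theorem exists_reduction (F : FallSpace (n + 1)) {r s : (Fin (n + 1) → ℕ) → ℕ} (hrt : PolyTime r)
    (hr : SteadilyGrowing r) (hs : SteadilyGrowing s) (hr1 : ∀ K, 1 ≤ r K)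
    {U : TM 3} (hU : U.IsPrefixFreeUniversal) {E : Type*} [Coded E] (hpf : PrefixFree E)
    (𝔉 : E → ℕ → Word → ℝ) (h𝔉 : ∃ C : ℝ, ∀ φ k x, |𝔉 φ k x| ≤ C) (P : DistProblem (n + 1))
    (hP : Samplable F (GammaOf s) (GammaZero (n + 1)) P.dist) (hPf : EventuallyValue 𝔉 P.f) :
    ReducesTo F (GammaOf r) (GammaZero (n + 1)) P (universalProblem r s U 𝔉 h𝔉) := by
  obtain ⟨σ, hσ⟩ := hP
  obtain ⟨φ, q, hq⟩ := hPf
  obtain ⟨t, ht⟩ := σ.time.exists_length_le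
  -- Sampled words have length at most `t`, so a clock of at least `q'` ensures that the value of 𝔉
  -- is final.
  obtain ⟨q', hq'⟩ := exists_mvPolynomial_comp q t
  obtain ⟨a, p, hp, hprog⟩ := exists_program hr hs hr1 hU σ (Coded.enc φ).length q'
  obtain ⟨b, hb⟩ := comp_alphaP_mem_gammaPoly hr.poly p
  -- Bounds the length of an image word: doubled components of lengths at most `b`, `p`, `b` and
  -- `t`, and three separators of length 2.
  set T : MvPolynomial (Fin (n + 1)) ℕ := 4 * b + 2 * p + 2 * t + 6 with hT
  have hTe : ∀ L, MvPolynomial.eval L T = 4 * MvPolynomial.eval L b + 2 * MvPolynomial.eval L p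
    + 2 * MvPolynomial.eval L t + 6 := fun L => by simp [hT]
  set π := reduceScheme hrt hr p t (Coded.enc φ) a with hπ
  set Q := universalProblem r s U 𝔉 h𝔉
  have hk : ∀ L, alphaP p L (Fin.last n) = MvPolynomial.eval L p := fun L => by simp [alphaP]
  have hkl : ∀ L, (Coded.enc (alphaP p L (Fin.last n)) : Word).length ≤ MvPolynomial.eval L p :=
    fun L => (length_bits_le _).trans_eq (hk L)
  -- the image of the sampler has a simple density
  have hdens : ∀ L x, Q.dist (alphaP p L) x * ENNReal.ofReal (weightAlg T (Coded.enc φ) a L x)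
      = (σ.kernel L ()).bind (π.kernel L) x := by
    intro L x
    obtain ⟨h₁, h₂, h₃, h₄, h₅⟩ := hprog L
    rw [σ.kernel_eq_map, hπ, bind_kernel_reduceScheme hrt hr (Coded.enc φ) (fun y => ht L () y []) h₁ h₅]
    refine bind_unif_prefix_apply (k := r (alphaP p L)) (l := s (alphaP p L)) h₂ h₃
      (fun b a w => tuple [b, Coded.enc (alphaP p L (Fin.last n)), a,
        U.ev (alphaP p L (Fin.last n)) a ![Coded.enc (alphaP p L), w]])
      (W := fun x => ENNReal.ofReal (weightAlg T (Coded.enc φ) a L x)) (fun u v w hu hv => ?_) x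
    obtain ⟨e₁, e₂⟩ := splitC_iterate_tuple u (Coded.enc (alphaP p L (Fin.last n))) v
      (U.ev (alphaP p L (Fin.last n)) v ![Coded.enc (alphaP p L), w]) (MvPolynomial.eval L T) (by
        have h6 : r (alphaP p L) ≤ _ := hb L
        have h7 := hkl L
        rw [hTe]
        omega)
    simp only [weightAlg, e₁, e₂]
    split_ifs
    · push_cast
      rw [ENNReal.ofReal_pow (by norm_num), ENNReal.ofReal_ofNat, pow_add]
    all_goals simp
  have hform : ∀ L, ∀ x ∈ (σ.kernel L ()).support, ∀ y ∈ (π.kernel L x).support,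
      x.length ≤ MvPolynomial.eval L t ∧ ∃ u v : Word,
        u.length ≤ r (alphaP p L) ∧ (a ++ v).length ≤ r (alphaP p L) ∧
        (Coded.enc φ ++ u).length ≤ r (alphaP p L) ∧
        y = tuple [Coded.enc φ ++ u, Coded.enc (alphaP p L (Fin.last n)), a ++ v, x] := by
    intro L x hx y hy
    obtain ⟨h₁, h₂, h₃, h₄, h₅⟩ := hprog L
    rw [σ.kernel_eq_map, PMF.mem_support_map_iff] at hx
    obtain ⟨w, -, rfl⟩ := hx
    have hx := ht L () w []
    rw [hπ, kernel_reduceScheme, PMF.mem_support_bind_iff] at hy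
    obtain ⟨u, hu, hy⟩ := hy
    rw [PMF.mem_support_map_iff] at hy
    obtain ⟨v, hv, rfl⟩ := hy
    rw [mem_support_unif] at hu hv
    refine ⟨hx, u.drop (Coded.enc φ).length, v.drop a.length, ?_, ?_, ?_, ?_⟩
    · simp; omega
    · simp; omega
    · simp; omega
    · rw [List.take_of_length_le hx]
  have hnear : ∀ L, ∑' x, |(P.dist L x).toReal - (σ.kernel L () x).toReal|
      = 2 * tvDist (fun x => (P.dist L x).toReal) (fun x => (σ.kernel L () x).toReal) :=
    fun L => tsum_abs_sub_eq_two_mul_tvDist _ _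
  refine ⟨p, hp, π, efficientInjection_alphaP p hp, ?_, ?_, ?_⟩
  · refine ⟨Scheme.ofFun (weightAlg T (Coded.enc φ) a) (schemeTime_weightAlg T (Coded.enc φ) a)
      (zero_mem_pullGrowth_gammaOf _) (zero_mem_pullGrowth_gammaZero _),
      ⟨2 ^ ((Coded.enc φ).length + a.length), fun L x _ => ?_⟩, ?_⟩
    · change weightAlg T (Coded.enc φ) a L x ≤ _
      unfold weightAlg
      split_ifs <;> simp
    · refine F.mem_of_le_mul hσ 2 (fun L => tsum_nonneg fun _ => abs_nonneg _) fun L => ?_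
      rw [← hnear]
      refine le_trans (le_of_eq (tsum_congr fun x => ?_))
        ((tsum_abs_bind_sub_le (P.dist L) (σ.kernel L ()) (π.kernel L)))
      rw [Scheme.kernel_ofFun, expect_pure, ← hdens, ENNReal.toReal_mul,
        ENNReal.toReal_ofReal (by positivity), abs_sub_comm]
  · obtain ⟨C₁, hC₁, hP₁⟩ := P.exists_abs_fbar_le
    obtain ⟨C₂, hC₂, hQ₂⟩ := Q.exists_abs_fbar_le
    have hbd : ∀ x y, |P.fbar x - Q.fbar y| ≤ C₁ + C₂ := fun x y =>
      (abs_sub _ _).trans (add_le_add (hP₁ x) (hQ₂ y))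
    refine F.mem_of_le_mul hσ ((C₁ + C₂) * 2) (fun L => expect_nonneg _ fun x => expect_nonneg _
      fun y => abs_nonneg _) fun L => ?_
    rw [mul_assoc, ← hnear]
    refine expect_le_mul_tsum_abs_sub _ _ (fun x => expect_nonneg _ fun y => abs_nonneg _)
      (fun x => expect_le _ (fun y => abs_nonneg _) (hbd x)) fun x hx hx' => ?_
    refine expect_eq_zero _ fun y hy => ?_
    -- By `hdens`, a word of positive mass in the image of the sampler has positive mass in the
    -- universal ensemble; hence the extension by zero does not interfere.
    have hyQ : y ∈ Q.dist.supp := by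
      refine ⟨alphaP p L, ?_⟩
      have h1 : y ∈ ((σ.kernel L ()).bind (π.kernel L)).support :=
        (PMF.mem_support_bind_iff _ _ _).2 ⟨x, hx', hy⟩
      rw [PMF.mem_support_iff, ← hdens] at h1
      exact (PMF.mem_support_iff _ _).2 (left_ne_zero_of_mul h1)
    obtain ⟨hxt, u, v, -, -, -, rfl⟩ := hform L x hx' y hy
    rw [P.fbar_of_mem ⟨L, hx⟩, Q.fbar_of_mem hyQ, hq ⟨x, L, hx⟩ (alphaP p L (Fin.last n)) ?_]
    · change |_ - universalFun 𝔉 _| = 0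
      rw [universalFun_tuple, prefixValue_append hpf, sub_self, abs_zero]
    · rw [hk]
      refine (eval_mono_nat q hxt).trans ?_
      rw [← hq']
      exact (hprog L).2.2.2.1
  · refine ⟨MScheme.ofFun _ (schemeTime_component T) (zero_mem_pullGrowth_gammaOf _)
      (zero_mem_pullGrowth_gammaZero _), ?_⟩
    refine F.mem_of_le_mul hσ 2 (fun L => expect_nonneg _ fun y => tvDist_nonneg _ _) fun L => ?_
    rw [← hnear]
    simp only [MScheme.kernel_ofFun]
    refine expect_tvDist_posterior_le _ _ _ _ fun x hx y hy => ?_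
    obtain ⟨hxt, u, v, -, hv, hu, rfl⟩ := hform L x hx y hy
    rw [List.take_of_length_le]
    · exact component_tuple _ 3 (by simp)
    · have h6 : r (alphaP p L) ≤ _ := hb L
      have h7 := hkl L
      rw [length_tuple_four, hTe]
      omega

/-- The universal ensemble is samplable. -/
theorem samplable_universalEnsemble (F : FallSpace (n + 1)) {r s : (Fin (n + 1) → ℕ) → ℕ}
    (hrt : PolyTime r) (hst : PolyTime s) (hr : SteadilyGrowing r) (hs : SteadilyGrowing s)
    (hrs : ∀ K, r K ≤ s K) (U : TM 3) :
    Samplable F (GammaOf s) (GammaZero (n + 1)) (universalEnsemble r s U) := by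
  -- Sampling is exact, so the error is the zero function. The `2 * r + s` bits are at most `4 * s`,
  -- whence two doublings.
  refine ⟨⟨fun K _ y _ => universalAlg r s U K y, fun K _ => r K + r K + s K, fun _ => [],
    schemeTime_universalAlg hrt hst hr.poly hs.poly U, hs.mem_gammaOf (i := 2) fun K => by
      have := hrs K
      omega, fun K => rfl⟩, ?_⟩
  convert F.zero_mem using 1
  funext K
  rw [tvDist]
  convert mul_zero _
  refine (tsum_congr fun x => ?_).trans tsum_zero
  rw [abs_eq_zero, sub_eq_zero]
  congr 2
  simp only [Scheme.kernel, universalEnsemble]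
  rw [unif_add_map, unif_add, PMF.bind_bind]
  refine PMF.bind_congr_support _ fun b hb => ?_
  rw [PMF.bind_map]
  refine PMF.bind_congr_support _ fun a ha => PMF.map_congr_support _ fun w hw => ?_
  rw [mem_support_unif] at hb ha hw
  have e₁ : (b ++ a ++ w).take (r K) = b := by rw [List.append_assoc, ← hb, List.take_left]
  have e₂ : ((b ++ a ++ w).drop (r K)).take (r K) = a := by
    rw [List.append_assoc, List.drop_left' hb, List.take_left' ha]
  have e₃ : ((b ++ a ++ w).drop (r K + r K)).take (s K) = w := by
    rw [List.drop_left' (by simp [ha, hb]), ← hw, List.take_length]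
  simp only [universalAlg, e₁, e₂, e₃]

end

end PolyEst

theorem mainTheorem9 (n : ℕ) (F : FallSpace (n + 1))
    (r s : (Fin (n + 1) → ℕ) → ℕ) (hrt : PolyTime r) (hst : PolyTime s)
    (hr : SteadilyGrowing r) (hs : SteadilyGrowing s) (hrs : ∀ K, 1 ≤ r K ∧ r K ≤ s K)
    (U : TM 3) (hU : U.IsPrefixFreeUniversal)
    {E : Type*} [Coded E] (hE : PolyTimeDecidableImage E) (hpf : PrefixFree E)
    (𝔉 : E → ℕ → Word → ℝ) (h𝔉 : ∃ C : ℝ, ∀ φ k x, |𝔉 φ k x| ≤ C) :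
    -- every problem of the class reduces to the universal problem
    (∀ P : DistProblem (n + 1),
      Samplable F (GammaOf s) (GammaZero (n + 1)) P.dist →
      (∃ (φ : E) (q : Polynomial ℕ), ∀ (x : P.dist.supp) (k : ℕ),
        q.eval (x : Word).length ≤ k → P.f x = 𝔉 φ k x) →
      ∃ p : MvPolynomial (Fin (n + 1)) ℕ,
        IncreasingLast (fun K => MvPolynomial.eval K p) ∧
        ∃ π : Scheme (n + 1) (pullGrowth (GammaOf r) (alphaP p))
            (pullGrowth (GammaZero (n + 1)) (alphaP p)) Word Word,
          IsPreciseReduction (ΓR := GammaOf r) (ΓA := GammaZero (n + 1)) F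
            P (universalProblem r s U 𝔉 h𝔉) (alphaP p) π) ∧
    -- all maps `α_p` with `p` increasing in the last argument are efficient injections
    (∀ p : MvPolynomial (Fin (n + 1)) ℕ, IncreasingLast (fun K => MvPolynomial.eval K p) →
      EfficientInjection (alphaP p)) ∧
    -- the universal ensemble is samplable, so the universal problem is complete
    -- as soon as its function belongs to the class
    Samplable F (GammaOf s) (GammaZero (n + 1)) (universalProblem r s U 𝔉 h𝔉).dist ∧
    (EventuallyValue 𝔉 (universalProblem r s U 𝔉 h𝔉).f →
      IsCompleteFor F (GammaOf r) (GammaZero (n + 1))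
        (SampX F (GammaOf s) (GammaZero (n + 1)) 𝔉) (universalProblem r s U 𝔉 h𝔉)) := by
  have hs1 : ∀ K, r K ≤ s K := fun K => (hrs K).2
  have hred : ∀ P : DistProblem (n + 1), Samplable F (GammaOf s) (GammaZero (n + 1)) P.dist →
      EventuallyValue 𝔉 P.f →
      ReducesTo F (GammaOf r) (GammaZero (n + 1)) P (universalProblem r s U 𝔉 h𝔉) :=
    fun P hP hf => exists_reduction F hrt hr hs (fun K => (hrs K).1) hU hpf 𝔉 h𝔉 P hP hf
  have hsamp := samplable_universalEnsemble F hrt hst hr hs hs1 U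
  exact ⟨hred, efficientInjection_alphaP, hsamp, fun hf => ⟨⟨hsamp, hf⟩, fun P hP => hred P hP.1 hP.2⟩⟩
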